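/- Fix a prime $p$. For a scheme $S$ let $W(S)$ be the ring of $p$-typical Witt vectors $x=(x_0,x_1,\ldots)$ of $H^0(S,\mathcal O_S)$, let $W^\times$ be the group scheme of invertible Witt vectors, and let $F$ be the Witt vector Frobenius. A scheme is called $p$-nilpotent if the function $p$ is locally nilpotent on it. Let $W_{\mathrm{prim}}(S)\subset W(S)$ be the set of those $x$ for which $x_0$ is locally nilpotent and $x_1$ is invertible if $S$ is $p$-nilpotent, and the empty set otherwise. Let $\Sigma:=W_{\mathrm{prim}}/W^\times$ be the fpqc quotient stack for the action of $W^\times$ on $W_{\mathrm{prim}}$ by division, $(\lambda,x)\mapsto\lambda^{-1}x$; thus an object of the groupoid $\Sigma(S)$ is a $W^\times$-torsor on $S$ for the fpqc topology together with a $W^\times$-equivariant map from it to $W_{\mathrm{prim}}$. The Frobenius maps of $W_{\mathrm{prim}}$ and $W^\times$ induce a morphism $F:\Sigma\to\Sigma$. For a category $\mathcal C$ with a functor $F:\mathcal C\to\mathcal C$, let $\mathcal C[F^{-1}]$ be the colimit, in the 2-categorical sense, of $\mathcal C\xrightarrow{F}\mathcal C\xrightarrow{F}\mathcal C\xrightarrow{F}\cdots$.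 The functor $F$ is called contracting if $\mathcal C[F^{-1}]$ is a point, i.e. is equivalent to the category with one object and one morphism. Let $\mathcal C^F$ be the category of pairs $(c,\alpha)$, where $c\in\mathcal C$ and $\alpha:c\to F(c)$ is an isomorphism. **Proposition.** For every quasi-compact quasi-separated $p$-nilpotent scheme $S$, the functor $\Sigma(S)\to\Sigma(S)$ induced by $F:\Sigma\to\Sigma$ is contracting. **Corollary.** Let $\Sigma^F$ be the stack such that $\Sigma^F(S)=\Sigma(S)^F$ for every scheme $S$. Then (i) $\Sigma^F$ is equivalent to the formal scheme $\mathrm{Spf}\,\mathbb Z_p$ (as stacks over the category of schemes); (ii) under this equivalence, the canonical morphism $\Sigma^F\to\Sigma$, $(c,\alpha)\mapsto c$, is isomorphic to the morphism $p:\mathrm{Spf}\,\mathbb Z_p\to\Sigma$, i.e. to the composite $\mathrm{Spf}\,\mathbb Z_p\to W_{\mathrm{prim}}\to\Sigma$, where the first map is given by the Witt vector $p\in W(\mathbb Z_p)$. -/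

import Mathlib

open CategoryTheory AlgebraicGeometry Opposite

universe u

namespace Prismatization

section WittFunctor

variable (p : ℕ) [Fact p.Prime]

/-- The ring `W(S)` of `S`-points of the ring scheme of `p`-typical Witt vectors. -/
abbrev W (S : Scheme.{u}) : Type u := WittVector p Γ(S, ⊤)

variable {p}

/-- Restriction of Witt vectors along a morphism of schemes. -/
noncomputable def res {T S : Scheme.{u}} (f : T ⟶ S) : W p S →+* W p T :=
  WittVector.map f.appTop.hom

lemma res_coeff {T S : Scheme.{u}} (f : T ⟶ S) (x : W p S) (n : ℕ) :
    (res f x).coeff n = f.appTop (x.coeff n) := rfl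

lemma res_id {S : Scheme.{u}} (x : W p S) : res (𝟙 S) x = x := by
  ext n; simp [res_coeff]

lemma res_comp {U T S : Scheme.{u}} (g : U ⟶ T) (f : T ⟶ S) (x : W p S) :
    res (g ≫ f) x = res g (res f x) := by
  ext n; simp only [res_coeff, Scheme.Hom.comp_appTop]; rfl

lemma res_frobenius {T S : Scheme.{u}} (f : T ⟶ S) (x : W p S) :
    res f (WittVector.frobenius x) = WittVector.frobenius (res f x) :=
  (WittVector.frobenius_isPoly p).map _ _

/-- Restriction of units of the ring of Witt vectors along a morphism of schemes. -/
noncomputable def resU {T S : Scheme.{u}} (f : T ⟶ S) : (W p S)ˣ →* (W p T)ˣ :=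
  Units.map (res (p := p) f).toMonoidHom

/-- The Witt vector Frobenius on `W^×`. -/
noncomputable def frobU {S : Scheme.{u}} : (W p S)ˣ →* (W p S)ˣ :=
  Units.map (WittVector.frobenius : W p S →+* W p S).toMonoidHom

lemma coe_resU {T S : Scheme.{u}} (f : T ⟶ S) (x : (W p S)ˣ) :
    ((resU f x : (W p T)ˣ) : W p T) = res f (x : W p S) := rfl

lemma coe_frobU {S : Scheme.{u}} (x : (W p S)ˣ) :
    ((frobU x : (W p S)ˣ) : W p S) = WittVector.frobenius (x : W p S) := rfl

lemma resU_id {S : Scheme.{u}} (x : (W p S)ˣ) : resU (𝟙 S) x = x :=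
  Units.ext (res_id _)

lemma resU_comp {U T S : Scheme.{u}} (g : U ⟶ T) (f : T ⟶ S) (x : (W p S)ˣ) :
    resU (g ≫ f) x = resU g (resU f x) := Units.ext (res_comp _ _ _)

lemma resU_frobU {T S : Scheme.{u}} (f : T ⟶ S) (x : (W p S)ˣ) :
    resU f (frobU x) = frobU (resU f x) := Units.ext (res_frobenius _ _)

/-- The Witt vectors of `T` are the morphisms from `T` to the spectrum of `ℤ[x₀, x₁, …]`. -/
noncomputable def wittEquiv (T : Scheme.{u}) :
    (T ⟶ Spec (CommRingCat.of (MvPolynomial (ULift.{u} ℕ) (ULift.{u} ℤ)))) ≃ W p T :=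
  (AffineSpace.toSpecMvPolyIntEquiv (ULift.{u} ℕ)).trans
    { toFun := fun v => WittVector.mk p fun n => v ⟨n⟩
      invFun := fun x n => x.coeff n.down
      left_inv := fun _ => rfl
      right_inv := fun _ => rfl }

lemma wittEquiv_comp {T U : Scheme.{u}} (g : U ⟶ T)
    (h : T ⟶ Spec (CommRingCat.of (MvPolynomial (ULift.{u} ℕ) (ULift.{u} ℤ)))) :
    wittEquiv (p := p) U (g ≫ h) = res g (wittEquiv T h) := by
  ext n
  exact AffineSpace.toSpecMvPolyIntEquiv_comp _ g h ⟨n⟩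

/-- Gluing of Witt vectors along an fpqc covering sieve. -/
lemma res_glue {S : Scheme.{u}} {R : Sieve S} (hR : R ∈ Scheme.fpqcTopology S)
    (w : ∀ ⦃T : Scheme.{u}⦄ (f : T ⟶ S), R f → W p T)
    (hw : ∀ ⦃T U : Scheme.{u}⦄ (f : T ⟶ S) (g : U ⟶ T) (hf : R f),
      w (g ≫ f) (R.downward_closed hf g) = res g (w f hf)) :
    ∃ x : W p S, ∀ ⦃T : Scheme.{u}⦄ (f : T ⟶ S) (hf : R f), res f x = w f hf := by
  have hA : Presieve.IsSheaf Scheme.fpqcTopology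
      (yoneda.obj (Spec (CommRingCat.of (MvPolynomial (ULift.{u} ℕ) (ULift.{u} ℤ))))) :=
    GrothendieckTopology.Subcanonical.isSheaf_of_isRepresentable _
  obtain ⟨t, ht, -⟩ := hA R hR (fun T f hf => (wittEquiv (p := p) T).symm (w f hf)) ((Presieve.compatible_iff_sieveCompatible _).2 (by
    intro U T f g hf
    apply (wittEquiv (p := p) T).injective
    change wittEquiv T ((wittEquiv T).symm _) = wittEquiv T (g ≫ (wittEquiv U).symm (w f hf))
    rw [wittEquiv_comp, Equiv.apply_symm_apply, Equiv.apply_symm_apply, hw]))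
  refine ⟨wittEquiv S t, fun T f hf => ?_⟩
  rw [← wittEquiv_comp, ← Equiv.eq_symm_apply]
  exact ht f hf

lemma res_sep {S : Scheme.{u}} {R : Sieve S} (hR : R ∈ Scheme.fpqcTopology S) {x y : W p S}
    (h : ∀ ⦃T : Scheme.{u}⦄ (f : T ⟶ S), R f → res f x = res f y) : x = y := by
  have hA : Presieve.IsSheaf Scheme.fpqcTopology
      (yoneda.obj (Spec (CommRingCat.of (MvPolynomial (ULift.{u} ℕ) (ULift.{u} ℤ))))) :=
    GrothendieckTopology.Subcanonical.isSheaf_of_isRepresentable _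
  apply (wittEquiv (p := p) S).symm.injective
  apply (hA R hR).isSeparatedFor.ext
  intro T f hf
  apply (wittEquiv (p := p) T).injective
  change wittEquiv T (f ≫ _) = wittEquiv T (f ≫ _)
  rw [wittEquiv_comp, wittEquiv_comp, Equiv.apply_symm_apply, Equiv.apply_symm_apply, h f hf]

lemma resU_sep {S : Scheme.{u}} {R : Sieve S} (hR : R ∈ Scheme.fpqcTopology S) {x y : (W p S)ˣ}
    (h : ∀ ⦃T : Scheme.{u}⦄ (f : T ⟶ S), R f → resU f x = resU f y) : x = y :=
  Units.ext (res_sep hR fun _ f hf => congrArg Units.val (h f hf))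

lemma resU_glue {S : Scheme.{u}} {R : Sieve S} (hR : R ∈ Scheme.fpqcTopology S)
    (w : ∀ ⦃T : Scheme.{u}⦄ (f : T ⟶ S), R f → (W p T)ˣ)
    (hw : ∀ ⦃T U : Scheme.{u}⦄ (f : T ⟶ S) (g : U ⟶ T) (hf : R f),
      w (g ≫ f) (R.downward_closed hf g) = resU g (w f hf)) :
    ∃ x : (W p S)ˣ, ∀ ⦃T : Scheme.{u}⦄ (f : T ⟶ S) (hf : R f), resU f x = w f hf := by
  obtain ⟨x, hx⟩ := res_glue hR (fun T f hf => (w f hf : W p T))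
    (fun T U f g hf => congrArg Units.val (hw f g hf))
  obtain ⟨y, hy⟩ := res_glue hR (fun T f hf => ((w f hf)⁻¹ : (W p T)ˣ).1)
    (fun T U f g hf => by
      have := congrArg (fun z : (W p U)ˣ => (z⁻¹).1) (hw f g hf)
      simpa only [← map_inv, coe_resU] using this)
  have hxy : x * y = 1 := res_sep hR fun T f hf => by
    rw [map_mul, hx f hf, hy f hf, map_one, Units.mul_inv]
  exact ⟨⟨x, y, hxy, by rw [mul_comm, hxy]⟩, fun T f hf => Units.ext (hx f hf)⟩

end WittFunctor

section Primitive

/-- A global function on a scheme is locally nilpotent if every point has an open neighbourhood on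
which the function is nilpotent. -/
def IsLocallyNilpotent {S : Scheme.{u}} (a : Γ(S, ⊤)) : Prop :=
  ∀ s : S, ∃ U : S.Opens, s ∈ U ∧ IsNilpotent (S.presheaf.map (homOfLE le_top : U ⟶ ⊤).op a)

/-- A scheme is `p`-nilpotent if the function `p` is locally nilpotent on it. -/
def IsPNilpotent (p : ℕ) (S : Scheme.{u}) : Prop :=
  IsLocallyNilpotent (S := S) (p : Γ(S, ⊤))

lemma isLocallyNilpotent_iff {S : Scheme.{u}} (a : Γ(S, ⊤)) :
    IsLocallyNilpotent a ↔ S.basicOpen a = ⊥ := by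
  constructor
  · intro h
    rw [eq_bot_iff]
    intro s hs
    obtain ⟨U, hsU, hU⟩ := h s
    have h1 : S.basicOpen (S.presheaf.map (homOfLE le_top : U ⟶ ⊤).op a) = ⊥ :=
      S.basicOpen_eq_bot_of_isNilpotent U _ hU
    rw [Scheme.basicOpen_res] at h1
    rw [← h1]
    exact ⟨hsU, hs⟩
  · intro h s
    obtain ⟨U, hU, hsU, -⟩ := S.isBasis_affineOpens.exists_subset_of_mem_open
      (Set.mem_univ s) isOpen_univ
    obtain ⟨V, hV, rfl⟩ := hU
    refine ⟨V, hsU, ?_⟩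
    rw [Scheme.isNilpotent_iff_basicOpen_eq_bot_of_isCompact hV.isCompact, Scheme.basicOpen_res, h]
    simp

lemma IsLocallyNilpotent.pullback {T S : Scheme.{u}} (f : T ⟶ S) {a : Γ(S, ⊤)}
    (h : IsLocallyNilpotent a) : IsLocallyNilpotent (f.appTop a) := by
  rw [isLocallyNilpotent_iff] at h ⊢
  rw [← Scheme.preimage_basicOpen_top, h]
  rfl

lemma exists_mem_range {S : Scheme.{u}} {R : Sieve S} (hR : R ∈ Scheme.fpqcTopology S) (s : S) :
    ∃ (T : Scheme.{u}) (f : T ⟶ S), R f ∧ s ∈ Set.range f := by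
  rw [Precoverage.mem_toGrothendieck_iff_of_isStableUnderComposition] at hR
  obtain ⟨Q, hQ, hQR⟩ := hR
  obtain ⟨T, f, hf, hs⟩ := (Presieve.mem_comap_jointlySurjectivePrecoverage_iff _).1 hQ.2.1 s
  exact ⟨T, f, hQR _ _ hf, hs⟩

lemma isLocallyNilpotent_of_cover {S : Scheme.{u}} {R : Sieve S} (hR : R ∈ Scheme.fpqcTopology S)
    {a : Γ(S, ⊤)}
    (h : ∀ ⦃T : Scheme.{u}⦄ (f : T ⟶ S), R f → IsLocallyNilpotent (f.appTop a)) :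
    IsLocallyNilpotent a := by
  rw [isLocallyNilpotent_iff, eq_bot_iff]
  intro s hs
  obtain ⟨T, f, hf, t, rfl⟩ := exists_mem_range hR s
  have h1 := h f hf
  rw [isLocallyNilpotent_iff, ← Scheme.preimage_basicOpen_top] at h1
  have : t ∈ f ⁻¹ᵁ S.basicOpen a := hs
  rw [h1] at this
  exact this

lemma isUnit_of_basicOpen_eq_top {S : Scheme.{u}} {a : Γ(S, ⊤)} (h : S.basicOpen a = ⊤) :
    IsUnit a := by
  refine S.toRingedSpace.isUnit_of_isUnit_germ ⊤ a fun x hx => ?_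
  have h1 : x ∈ S.basicOpen a := by rw [h]; trivial
  exact (S.mem_basicOpen a x hx).1 h1

lemma isUnit_of_cover {S : Scheme.{u}} {R : Sieve S} (hR : R ∈ Scheme.fpqcTopology S)
    {a : Γ(S, ⊤)} (h : ∀ ⦃T : Scheme.{u}⦄ (f : T ⟶ S), R f → IsUnit (f.appTop a)) :
    IsUnit a := by
  apply isUnit_of_basicOpen_eq_top
  rw [eq_top_iff]
  intro s _
  obtain ⟨T, f, hf, t, rfl⟩ := exists_mem_range hR s
  have h1 := T.basicOpen_of_isUnit (h f hf)
  rw [← Scheme.preimage_basicOpen_top] at h1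
  have : t ∈ f ⁻¹ᵁ S.basicOpen a := by rw [h1]; trivial
  exact this

variable {p : ℕ} [Fact p.Prime]

/-- The `S`-points of the formal scheme `W_prim`. -/
structure IsPrimitive {S : Scheme.{u}} (x : W p S) : Prop where
  isPNilpotent : IsPNilpotent p S
  coeff_zero : IsLocallyNilpotent (x.coeff 0)
  coeff_one : IsUnit (x.coeff 1)

lemma IsPrimitive.res {T S : Scheme.{u}} {x : W p S} (hx : IsPrimitive x) (f : T ⟶ S) :
    IsPrimitive (res f x) where
  isPNilpotent := by
    have := hx.isPNilpotent.pullback f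
    rwa [map_natCast] at this
  coeff_zero := hx.coeff_zero.pullback f
  coeff_one := hx.coeff_one.map f.appTop.hom

lemma isPrimitive_of_cover {S : Scheme.{u}} {R : Sieve S} (hR : R ∈ Scheme.fpqcTopology S)
    {x : W p S} (h : ∀ ⦃T : Scheme.{u}⦄ (f : T ⟶ S), R f → IsPrimitive (Prismatization.res f x)) :
    IsPrimitive x where
  isPNilpotent := isLocallyNilpotent_of_cover hR fun T f hf => by
    rw [map_natCast]; exact (h f hf).isPNilpotent
  coeff_zero := isLocallyNilpotent_of_cover hR fun T f hf => (h f hf).coeff_zero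
  coeff_one := isUnit_of_cover hR fun T f hf => (h f hf).coeff_one

lemma isLocallyNilpotent_iff_evaluation {S : Scheme.{u}} (a : Γ(S, ⊤)) :
    IsLocallyNilpotent a ↔ ∀ s : S, S.Γevaluation s a = 0 := by
  rw [isLocallyNilpotent_iff, Scheme.basicOpen_eq_bot_iff_forall_evaluation_eq_zero]
  exact ⟨fun h s => h ⟨s, trivial⟩, fun h s => h s⟩

lemma isUnit_iff_evaluation {S : Scheme.{u}} (a : Γ(S, ⊤)) :
    IsUnit a ↔ ∀ s : S, S.Γevaluation s a ≠ 0 := by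
  constructor
  · intro h s
    exact (h.map (S.Γevaluation s).hom).ne_zero
  · intro h
    apply isUnit_of_basicOpen_eq_top
    rw [eq_top_iff]
    intro s _
    exact (S.evaluation_ne_zero_iff_mem_basicOpen s (U := ⊤) trivial a).1 (h s)

/-- Evaluation of Witt vectors at a point. -/
noncomputable def evalAt {S : Scheme.{u}} (s : S) : W p S →+* WittVector p (S.residueField s) :=
  WittVector.map (S.Γevaluation s).hom

lemma evalAt_coeff {S : Scheme.{u}} (s : S) (x : W p S) (n : ℕ) :
    (evalAt s x).coeff n = S.Γevaluation s (x.coeff n) := rfl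

/-- A Witt vector is primitive if and only if it is so at every point. -/
lemma isPrimitive_iff {S : Scheme.{u}} (x : W p S) :
    IsPrimitive x ↔ ∀ s : S, CharP (S.residueField s) p ∧
      (evalAt s x).coeff 0 = 0 ∧ (evalAt s x).coeff 1 ≠ 0 := by
  have key : IsPNilpotent p S ↔ ∀ s : S, CharP (S.residueField s) p := by
    rw [IsPNilpotent, isLocallyNilpotent_iff_evaluation]
    refine forall_congr' fun s => ?_
    rw [CharP.charP_iff_prime_eq_zero Fact.out, map_natCast]
  constructor
  · intro h s
    exact ⟨key.1 h.1 s, (isLocallyNilpotent_iff_evaluation _).1 h.2 s,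
      (isUnit_iff_evaluation _).1 h.3 s⟩
  · intro h
    exact ⟨key.2 fun s => (h s).1, (isLocallyNilpotent_iff_evaluation _).2 fun s => (h s).2.1,
      (isUnit_iff_evaluation _).2 fun s => (h s).2.2⟩

lemma coeff_unit_mul {k : Type*} [Field k] [CharP k p] (u : (WittVector p k)ˣ)
    {x : WittVector p k} (h0 : x.coeff 0 = 0) (h1 : x.coeff 1 ≠ 0) :
    (u * x : WittVector p k).coeff 0 = 0 ∧ (u * x : WittVector p k).coeff 1 ≠ 0 := by
  refine ⟨by rw [WittVector.mul_coeff_zero, h0, mul_zero], ?_⟩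
  have hx : WittVector.verschiebung (x.shift 1) = x := by
    simpa using (WittVector.eq_iterate_verschiebung (x := x) (n := 1) (by simpa using h0)).symm
  have hu : (u : WittVector p k).coeff 0 ≠ 0 := by
    intro h
    have h2 : ((u : WittVector p k) * (u⁻¹ : (WittVector p k)ˣ)).coeff 0 = 1 := by
      rw [Units.mul_inv, WittVector.one_coeff_zero]
    rw [WittVector.mul_coeff_zero, h, zero_mul] at h2
    exact zero_ne_one h2
  rw [mul_comm, ← hx, ← WittVector.verschiebung_mul_frobenius]
  have h3 : (x.shift 1).coeff 0 = x.coeff 1 := by rw [WittVector.shift_coeff]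
  rw [show (1 : ℕ) = 0 + 1 from rfl, WittVector.verschiebung_coeff_succ,
    WittVector.mul_coeff_zero, WittVector.coeff_frobenius_charP]
  exact mul_ne_zero (by rwa [h3]) (pow_ne_zero _ hu)

lemma IsPrimitive.unit_mul {S : Scheme.{u}} {x : W p S} (hx : IsPrimitive x) (v : (W p S)ˣ) :
    IsPrimitive (v * x : W p S) := by
  rw [isPrimitive_iff] at hx ⊢
  intro s
  obtain ⟨hp, h0, h1⟩ := hx s
  rw [map_mul]
  exact ⟨hp, coeff_unit_mul (Units.map (evalAt s).toMonoidHom v) h0 h1⟩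

lemma IsPrimitive.frobenius {S : Scheme.{u}} {x : W p S} (hx : IsPrimitive x) :
    IsPrimitive (WittVector.frobenius x) := by
  rw [isPrimitive_iff] at hx ⊢
  intro s
  obtain ⟨hp, h0, h1⟩ := hx s
  have : evalAt s (WittVector.frobenius x) = WittVector.frobenius (evalAt s x) :=
    (WittVector.frobenius_isPoly p).map _ _
  rw [this, WittVector.coeff_frobenius_charP, WittVector.coeff_frobenius_charP, h0]
  exact ⟨hp, zero_pow (Fact.out : p.Prime).ne_zero, pow_ne_zero _ h1⟩

lemma isPrimitive_natCast {S : Scheme.{u}} (hS : IsPNilpotent p S) : IsPrimitive (p : W p S) := by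
  rw [isPrimitive_iff]
  intro s
  have hp : CharP (S.residueField s) p := by
    rw [CharP.charP_iff_prime_eq_zero Fact.out, ← map_natCast (S.Γevaluation s).hom]
    exact (isLocallyNilpotent_iff_evaluation _).1 hS s
  rw [map_natCast, WittVector.coeff_p_zero, WittVector.coeff_p_one]
  exact ⟨hp, rfl, one_ne_zero⟩

end Primitive
end Prismatization

namespace Prismatization

section Torsor

variable (p : ℕ) [Fact p.Prime]

/-- An fpqc torsor under the group `W^×` over a scheme `S`: an fpqc sheaf `P` over `S`, with an
action of `W^×` over `S` which is simply transitive on the fibres of `P ⟶ S`, such that `P ⟶ S`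
has sections fpqc-locally on `S`. -/
structure WTorsor (S : Scheme.{u}) : Type (u + 2) where
  /-- the underlying sheaf -/
  sheaf : Scheme.{u}ᵒᵖ ⥤ Type (u + 1)
  isSheaf : Presieve.IsSheaf Scheme.fpqcTopology sheaf
  /-- the projection to `S` -/
  proj : ∀ {T : Scheme.{u}}, sheaf.obj (op T) → (T ⟶ S)
  proj_map : ∀ {T U : Scheme.{u}} (f : U ⟶ T) (x : sheaf.obj (op T)),
    proj (sheaf.map f.op x) = f ≫ proj x
  /-- the action of `W^×` -/
  action : ∀ T : Scheme.{u}, MulAction (W p T)ˣ (sheaf.obj (op T))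
  map_smul : ∀ {T U : Scheme.{u}} (f : U ⟶ T) (a : (W p T)ˣ) (x : sheaf.obj (op T)),
    sheaf.map f.op (a • x) = resU f a • sheaf.map f.op x
  proj_smul : ∀ {T : Scheme.{u}} (a : (W p T)ˣ) (x : sheaf.obj (op T)), proj (a • x) = proj x
  simply_transitive : ∀ {T : Scheme.{u}} (x y : sheaf.obj (op T)), proj x = proj y →
    ∃! a : (W p T)ˣ, a • x = y
  locally_nonempty : ∃ R ∈ Scheme.fpqcTopology S, ∀ ⦃T : Scheme.{u}⦄ (f : T ⟶ S), R f →
    ∃ x : sheaf.obj (op T), proj x = f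

attribute [instance] WTorsor.action

variable {p}

namespace WTorsor

variable {S : Scheme.{u}} (P : WTorsor p S)

/-- The set of `T`-points of a torsor. -/
abbrev pts (T : Scheme.{u}) : Type (u + 1) := P.sheaf.obj (op T)

/-- Restriction of points of a torsor. -/
def rst {T U : Scheme.{u}} (f : U ⟶ T) (x : P.pts T) : P.pts U := P.sheaf.map f.op x

lemma rst_id {T : Scheme.{u}} (x : P.pts T) : P.rst (𝟙 T) x = x := by simp [rst]

lemma rst_comp {T U V : Scheme.{u}} (g : V ⟶ U) (f : U ⟶ T) (x : P.pts T) :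
    P.rst (g ≫ f) x = P.rst g (P.rst f x) := by simp [rst]

lemma proj_rst {T U : Scheme.{u}} (f : U ⟶ T) (x : P.pts T) :
    P.proj (P.rst f x) = f ≫ P.proj x := P.proj_map f x

lemma rst_smul {T U : Scheme.{u}} (f : U ⟶ T) (a : (W p T)ˣ) (x : P.pts T) :
    P.rst f (a • x) = resU f a • P.rst f x := P.map_smul f a x

lemma smul_left_cancel {T : Scheme.{u}} {a b : (W p T)ˣ} {x : P.pts T} (h : a • x = b • x) :
    a = b :=
  (P.simply_transitive x (b • x) (P.proj_smul b x).symm).unique h rfl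

/-- The unique `a` with `a • x = y`. -/
noncomputable def ratio {T : Scheme.{u}} (x y : P.pts T) (h : P.proj x = P.proj y) : (W p T)ˣ :=
  (P.simply_transitive x y h).choose

lemma ratio_smul {T : Scheme.{u}} (x y : P.pts T) (h : P.proj x = P.proj y) :
    P.ratio x y h • x = y := (P.simply_transitive x y h).choose_spec.1

lemma ratio_eq {T : Scheme.{u}} {x y : P.pts T} (h : P.proj x = P.proj y) {a : (W p T)ˣ}
    (ha : a • x = y) : P.ratio x y h = a :=
  P.smul_left_cancel ((P.ratio_smul x y h).trans ha.symm)

lemma sep {T : Scheme.{u}} {R : Sieve T} (hR : R ∈ Scheme.fpqcTopology T) {x y : P.pts T}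
    (h : ∀ ⦃U : Scheme.{u}⦄ (f : U ⟶ T), R f → P.rst f x = P.rst f y) : x = y :=
  (P.isSheaf R hR).isSeparatedFor.ext fun _ f hf => h f hf

lemma glue {T : Scheme.{u}} {R : Sieve T} (hR : R ∈ Scheme.fpqcTopology T)
    (w : ∀ ⦃U : Scheme.{u}⦄ (f : U ⟶ T), R f → P.pts U)
    (hw : ∀ ⦃U V : Scheme.{u}⦄ (f : U ⟶ T) (g : V ⟶ U) (hf : R f),
      w (g ≫ f) (R.downward_closed hf g) = P.rst g (w f hf)) :
    ∃ x : P.pts T, ∀ ⦃U : Scheme.{u}⦄ (f : U ⟶ T) (hf : R f), P.rst f x = w f hf := by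
  obtain ⟨t, ht, -⟩ := P.isSheaf R hR (fun U f hf => w f hf)
    ((Presieve.compatible_iff_sieveCompatible _).2 fun U V f g hf => hw f g hf)
  exact ⟨t, fun U f hf => ht f hf⟩

/-- Over any scheme over `S`, the sections of a torsor exist fpqc-locally. -/
lemma exists_cover {T : Scheme.{u}} (g : T ⟶ S) :
    ∃ R ∈ Scheme.fpqcTopology T, ∀ ⦃U : Scheme.{u}⦄ (f : U ⟶ T), R f →
      ∃ x : P.pts U, P.proj x = f ≫ g := by
  obtain ⟨R, hR, h⟩ := P.locally_nonempty
  exact ⟨R.pullback g, GrothendieckTopology.pullback_stable _ g hR, fun U f hf => h _ hf⟩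

end WTorsor

lemma hom_sep {S T : Scheme.{u}} {R : Sieve T} (hR : R ∈ Scheme.fpqcTopology T) {x y : T ⟶ S}
    (h : ∀ ⦃U : Scheme.{u}⦄ (f : U ⟶ T), R f → f ≫ x = f ≫ y) : x = y := by
  have hA : Presieve.IsSheaf Scheme.fpqcTopology (yoneda.obj S) :=
    GrothendieckTopology.Subcanonical.isSheaf_of_isRepresentable _
  exact (hA R hR).isSeparatedFor.ext fun _ f hf => h f hf

lemma hom_glue {S T : Scheme.{u}} {R : Sieve T} (hR : R ∈ Scheme.fpqcTopology T)
    (w : ∀ ⦃U : Scheme.{u}⦄ (f : U ⟶ T), R f → (U ⟶ S))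
    (hw : ∀ ⦃U V : Scheme.{u}⦄ (f : U ⟶ T) (g : V ⟶ U) (hf : R f),
      w (g ≫ f) (R.downward_closed hf g) = g ≫ w f hf) :
    ∃ x : T ⟶ S, ∀ ⦃U : Scheme.{u}⦄ (f : U ⟶ T) (hf : R f), f ≫ x = w f hf := by
  have hA : Presieve.IsSheaf Scheme.fpqcTopology (yoneda.obj S) :=
    GrothendieckTopology.Subcanonical.isSheaf_of_isRepresentable _
  obtain ⟨t, ht, -⟩ := hA R hR (fun U f hf => w f hf)
    ((Presieve.compatible_iff_sieveCompatible _).2 fun U V f g hf => hw f g hf)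
  exact ⟨t, fun U f hf => ht f hf⟩

variable (p)

/-- The `T`-points of the trivial `W^×`-torsor over `S`. -/
abbrev TrivialPt (S T : Scheme.{u}) : Type u := (T ⟶ S) × (W p T)ˣ

/-- `W^×` acts on the trivial torsor by multiplication. -/
noncomputable instance (S T : Scheme.{u}) : MulAction (W p T)ˣ (ULift.{u + 1} (TrivialPt p S T)) where
  smul a x := ⟨x.down.1, a * x.down.2⟩
  one_smul x := congrArg ULift.up (Prod.ext rfl (one_mul x.down.2))
  mul_smul a b x := congrArg ULift.up (Prod.ext rfl (mul_assoc a b x.down.2))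

/-- The presheaf of points of the trivial torsor. -/
noncomputable def trivialPresheaf (S : Scheme.{u}) : Scheme.{u}ᵒᵖ ⥤ Type (u + 1) where
  obj T := ULift.{u + 1} (TrivialPt p S T.unop)
  map f := TypeCat.ofHom fun x => ⟨f.unop ≫ x.down.1, resU f.unop x.down.2⟩
  map_id T := by
    refine TypeCat.Hom.ext (TypeCat.Fun.ext (funext fun x => ?_))
    exact congrArg ULift.up (Prod.ext (Category.id_comp (ULift.down x).1)
      (resU_id (ULift.down x).2))
  map_comp f g := by
    refine TypeCat.Hom.ext (TypeCat.Fun.ext (funext fun x => ?_))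
    exact congrArg ULift.up (Prod.ext (Category.assoc g.unop f.unop (ULift.down x).1)
      (resU_comp g.unop f.unop (ULift.down x).2))

lemma isSheaf_trivialPresheaf (S : Scheme.{u}) :
    Presieve.IsSheaf Scheme.fpqcTopology (trivialPresheaf p S) := by
  intro T R hR w hw
  rw [Presieve.compatible_iff_sieveCompatible] at hw
  let v : ∀ ⦃U : Scheme.{u}⦄ (f : U ⟶ T), R f → TrivialPt p S U :=
    fun U f hf => ULift.down (w f hf)
  have hv : ∀ ⦃U V : Scheme.{u}⦄ (f : U ⟶ T) (g : V ⟶ U) (hf : R f),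
      v (g ≫ f) (R.downward_closed hf g) = (g ≫ (v f hf).1, resU g (v f hf).2) :=
    fun U V f g hf => congrArg ULift.down (hw f g hf)
  obtain ⟨b, hb⟩ := hom_glue hR (fun U f hf => (v f hf).1)
    (fun U V f g hf => congrArg Prod.fst (hv f g hf))
  obtain ⟨c, hc⟩ := resU_glue hR (fun U f hf => (v f hf).2)
    (fun U V f g hf => congrArg Prod.snd (hv f g hf))
  refine ⟨ULift.up (b, c), fun U f hf => ?_, fun t ht => ?_⟩
  · exact congrArg ULift.up (Prod.ext (hb f hf) (hc f hf))
  · have ht' : ∀ ⦃U : Scheme.{u}⦄ (f : U ⟶ T) (hf : R f),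
        ((f ≫ (ULift.down t).1, resU f (ULift.down t).2) : TrivialPt p S U) = v f hf :=
      fun U f hf => congrArg ULift.down (ht f hf)
    refine congrArg ULift.up (Prod.ext (hom_sep hR fun U f hf => ?_)
      (resU_sep hR fun U f hf => ?_))
    · rw [hb f hf]
      exact congrArg Prod.fst (ht' f hf)
    · rw [hc f hf]
      exact congrArg Prod.snd (ht' f hf)

/-- The trivial torsor. -/
noncomputable def WTorsor.trivial (S : Scheme.{u}) : WTorsor p S where
  sheaf := trivialPresheaf p S
  isSheaf := isSheaf_trivialPresheaf p S
  proj := fun x => (ULift.down x).1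
  proj_map := fun _ _ => rfl
  action := fun T => inferInstanceAs (MulAction (W p T)ˣ (ULift.{u + 1} (TrivialPt p S T)))
  map_smul := fun f a x => congrArg ULift.up (Prod.ext rfl (map_mul (resU f) a (ULift.down x).2))
  proj_smul := fun _ _ => rfl
  simply_transitive := by
    rintro T ⟨⟨f, a⟩⟩ ⟨⟨g, b⟩⟩ h
    obtain rfl : f = g := h
    refine ⟨b * a⁻¹, congrArg ULift.up (Prod.ext rfl (inv_mul_cancel_right b a)), ?_⟩
    intro c hc
    have hc' : c * a = b := congrArg (fun z : ULift.{u + 1} (TrivialPt p S T) => z.down.2) hc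
    rw [← hc', mul_inv_cancel_right]
  locally_nonempty :=
    ⟨⊤, GrothendieckTopology.top_mem _ S, fun T f _ => ⟨ULift.up (f, 1), rfl⟩⟩

variable {p} in
/-- The equivariant map from the trivial torsor to `W` which takes the unit section to `w`, where
the units act by division. -/
noncomputable def trivialξ {S T : Scheme.{u}} (w : W p S) (x : ULift.{u + 1} (TrivialPt p S T)) :
    W p T := ↑x.down.2⁻¹ * res x.down.1 w

end Torsor

section Frob

variable {p : ℕ} [Fact p.Prime] {S : Scheme.{u}} (P : WTorsor p S)

/-- The `T`-points of the torsor obtained from `P` by pushing out along `F : W^× ⟶ W^×`, i.e. of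
the contracted product of `P` and `W^×`, the quotient of `P × W^×` by the relation
`(a • x, c) ~ (x, F(a) * c)`: over a morphism `T ⟶ S`, they are the maps `y` from `P` restricted
to `T` to `W^×` with `y(a • x) = F(a)⁻¹ * y(x)` (the class of `(x, c)` being the map whose value
at `x` is `c`). -/
structure FrobPt (T : Scheme.{u}) : Type (u + 1) where
  /-- the morphism to the base -/
  base : T ⟶ S
  /-- the equivariant map -/
  val : ∀ ⦃U : Scheme.{u}⦄ (h : U ⟶ T) (x : P.pts U), P.proj x = h ≫ base → (W p U)ˣ
  val_rst : ∀ ⦃U V : Scheme.{u}⦄ (h : U ⟶ T) (k : V ⟶ U) (x : P.pts U)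
    (hx : P.proj x = h ≫ base) (hx' : P.proj (P.rst k x) = (k ≫ h) ≫ base),
    val (k ≫ h) (P.rst k x) hx' = resU k (val h x hx)
  val_smul : ∀ ⦃U : Scheme.{u}⦄ (h : U ⟶ T) (a : (W p U)ˣ) (x : P.pts U)
    (hx : P.proj x = h ≫ base) (hx' : P.proj (a • x) = h ≫ base),
    val h (a • x) hx' = (frobU a)⁻¹ * val h x hx

namespace FrobPt

variable {P}

lemma val_congr {T : Scheme.{u}} (y : FrobPt P T) {U : Scheme.{u}} {h h' : U ⟶ T} (e : h = h')
    {x x' : P.pts U} (e' : x = x') (hx : P.proj x = h ≫ y.base) (hx' : P.proj x' = h' ≫ y.base) :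
    y.val h x hx = y.val h' x' hx' := by
  subst e e'; rfl

lemma ext' {T : Scheme.{u}} {y z : FrobPt P T} (hb : y.base = z.base)
    (hv : ∀ ⦃U : Scheme.{u}⦄ (h : U ⟶ T) (x : P.pts U) (hx : P.proj x = h ≫ y.base)
      (hx' : P.proj x = h ≫ z.base), y.val h x hx = z.val h x hx') : y = z := by
  obtain ⟨b, v, _, _⟩ := y
  obtain ⟨b', v', _, _⟩ := z
  obtain rfl : b = b' := hb
  obtain rfl : v = v' := by
    funext U h x hx
    exact hv h x hx hx
  rfl

/-- Restriction of points. -/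
def rst {T T' : Scheme.{u}} (f : T' ⟶ T) (y : FrobPt P T) : FrobPt P T' where
  base := f ≫ y.base
  val _ h x hx := y.val (h ≫ f) x (by rw [hx, Category.assoc])
  val_rst U V h k x hx hx' := by
    rw [← y.val_rst (h ≫ f) k x (by rw [hx, Category.assoc]) (by simpa using hx')]
    exact y.val_congr (Category.assoc _ _ _) rfl _ _
  val_smul U h a x hx hx' := y.val_smul _ _ _ _ _

/-- The action of `W^×` on the class of `(x, c)` is through the action on `c`. -/
noncomputable def act {T : Scheme.{u}} (a : (W p T)ˣ) (y : FrobPt P T) : FrobPt P T where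
  base := y.base
  val _ h x hx := resU h a * y.val h x hx
  val_rst U V h k x hx hx' := by rw [y.val_rst h k x hx hx', map_mul, resU_comp]
  val_smul U h b x hx hx' := by
    rw [y.val_smul h b x hx hx']
    exact mul_left_comm (resU h a) (frobU b)⁻¹ (y.val h x hx)

noncomputable instance (T : Scheme.{u}) : MulAction (W p T)ˣ (FrobPt P T) where
  smul := act
  one_smul y := by
    refine ext' (y := act 1 y) rfl fun U h x hx hx' => ?_
    change resU h 1 * y.val h x hx = y.val h x hx
    rw [map_one, one_mul]
  mul_smul a b y := by
    refine ext' (y := act (a * b) y) (z := act a (act b y)) rfl fun U h x hx hx' => ?_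
    change resU h (a * b) * y.val h x hx = resU h a * (resU h b * y.val h x hx)
    rw [map_mul, mul_assoc]

lemma smul_base {T : Scheme.{u}} (a : (W p T)ˣ) (y : FrobPt P T) : (a • y).base = y.base := rfl

lemma smul_val {T : Scheme.{u}} (a : (W p T)ˣ) (y : FrobPt P T) {U : Scheme.{u}} (h : U ⟶ T)
    (x : P.pts U) (hx : P.proj x = h ≫ y.base) :
    (a • y).val h x hx = resU h a * y.val h x hx := rfl

/-- Two points over the same base point agree if they agree on a covering by sections of `P`. -/
lemma ext_local {T : Scheme.{u}} {y z : FrobPt P T} (hb : y.base = z.base)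
    {R : Sieve T} (hR : R ∈ Scheme.fpqcTopology T)
    (hv : ∀ ⦃U : Scheme.{u}⦄ (h : U ⟶ T), R h → ∃ (x : P.pts U) (hx : P.proj x = h ≫ y.base)
      (hx' : P.proj x = h ≫ z.base), y.val h x hx = z.val h x hx') : y = z := by
  refine ext' hb fun U h x hx hx' => ?_
  refine resU_sep (GrothendieckTopology.pullback_stable _ h hR) fun V k hk => ?_
  obtain ⟨x₀, hx₀, hx₀', e⟩ := hv (k ≫ h) hk
  have h1 : P.proj (P.rst k x) = (k ≫ h) ≫ y.base := by
    rw [P.proj_rst, hx, Category.assoc]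
  have h2 : P.proj (P.rst k x) = (k ≫ h) ≫ z.base := by
    rw [P.proj_rst, hx', Category.assoc]
  rw [← y.val_rst h k x hx h1, ← z.val_rst h k x hx' h2]
  obtain ⟨a, ha, -⟩ := P.simply_transitive x₀ (P.rst k x) (by rw [hx₀, h1])
  have h3 : P.proj (a • x₀) = (k ≫ h) ≫ y.base := by rw [P.proj_smul, hx₀]
  have h4 : P.proj (a • x₀) = (k ≫ h) ≫ z.base := by rw [P.proj_smul, hx₀']
  rw [y.val_congr rfl ha.symm h1 h3, z.val_congr rfl ha.symm h2 h4, y.val_smul _ a x₀ hx₀ h3,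
    z.val_smul _ a x₀ hx₀' h4, e]

/-- The point given by a section of `P`, i.e. the class of `(x, 1)`. -/
noncomputable def ofSection {T : Scheme.{u}} (x : P.pts T) : FrobPt P T where
  base := P.proj x
  val U h y hy := frobU (P.ratio y (P.rst h x) (by rw [hy, P.proj_rst]))
  val_rst U V h k y hy hy' := by
    rw [resU_frobU]
    congr 1
    apply P.ratio_eq
    rw [P.rst_comp, ← P.rst_smul, P.ratio_smul]
  val_smul U h a y hy hy' := by
    rw [← map_inv, ← map_mul]
    congr 1
    apply P.ratio_eq
    rw [smul_smul, inv_mul_cancel_comm]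
    exact P.ratio_smul _ _ _

lemma ofSection_val_self {T U : Scheme.{u}} (x : P.pts T) (h : U ⟶ T)
    (hx : P.proj (P.rst h x) = h ≫ (ofSection x).base) :
    (ofSection x).val h (P.rst h x) hx = 1 := by
  change frobU (P.ratio _ _ _) = 1
  rw [P.ratio_eq (a := 1) _ (one_smul _ _), map_one]

variable (P) in
/-- The presheaf of points of the pushed out torsor. -/
def presheaf : Scheme.{u}ᵒᵖ ⥤ Type (u + 1) where
  obj T := FrobPt P T.unop
  map f := TypeCat.ofHom fun y => rst f.unop y
  map_id T := by
    ext y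
    exact ext' (Category.id_comp _) fun U h x hx hx' => y.val_congr (Category.comp_id _) rfl _ _
  map_comp f g := by
    ext y
    exact ext' (Category.assoc _ _ _) fun U h x hx hx' =>
      y.val_congr (Category.assoc _ _ _).symm rfl _ _

lemma isSheaf_presheaf : Presieve.IsSheaf Scheme.fpqcTopology (presheaf P) := by
  intro T R hR w hw
  rw [Presieve.compatible_iff_sieveCompatible] at hw
  let v : ∀ ⦃U : Scheme.{u}⦄ (f : U ⟶ T), R f → FrobPt P U := fun U f hf => w f hf
  have hv : ∀ ⦃U V : Scheme.{u}⦄ (f : U ⟶ T) (g : V ⟶ U) (hf : R f),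
      v (g ≫ f) (R.downward_closed hf g) = rst g (v f hf) := fun U V f g hf => hw f g hf
  obtain ⟨b, hb⟩ := hom_glue hR (fun U f hf => (v f hf).base)
    (fun U V f g hf => by rw [hv f g hf]; rfl)
  have key : ∀ ⦃U : Scheme.{u}⦄ (h : U ⟶ T) (x : P.pts U), P.proj x = h ≫ b →
      ∃ c : (W p U)ˣ, ∀ ⦃V : Scheme.{u}⦄ (k : V ⟶ U) (hk : R (k ≫ h))
        (hx' : P.proj (P.rst k x) = 𝟙 V ≫ (v (k ≫ h) hk).base),
        resU k c = (v (k ≫ h) hk).val (𝟙 V) (P.rst k x) hx' := by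
    intro U h x hx
    have h1 : ∀ ⦃V : Scheme.{u}⦄ (k : V ⟶ U) (hk : R (k ≫ h)),
        P.proj (P.rst k x) = 𝟙 V ≫ (v (k ≫ h) hk).base := fun V k hk => by
      rw [P.proj_rst, hx, Category.id_comp, ← hb, Category.assoc]
    obtain ⟨c, hc⟩ := resU_glue (GrothendieckTopology.pullback_stable _ h hR)
      (fun V k hk => (v (k ≫ h) hk).val (𝟙 V) (P.rst k x) (h1 k hk)) (by
        intro V V' k j hk
        have h2 : P.proj (P.rst k x) = 𝟙 V ≫ (v (k ≫ h) hk).base := h1 k hk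
        have h3 : P.proj (P.rst j (P.rst k x)) = (j ≫ 𝟙 V) ≫ (v (k ≫ h) hk).base := by
          rw [P.proj_rst, h2, Category.assoc]
        have e : ∀ (z : FrobPt P V') (hz : P.proj (P.rst (j ≫ k) x) = 𝟙 V' ≫ z.base),
            z = rst j (v (k ≫ h) hk) →
            z.val (𝟙 V') (P.rst (j ≫ k) x) hz
              = (v (k ≫ h) hk).val (j ≫ 𝟙 V) (P.rst j (P.rst k x)) h3 := by
          rintro z hz rfl
          exact val_congr _ ((Category.id_comp j).trans (Category.comp_id j).symm)
            (P.rst_comp _ _ _) _ _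
        rw [← (v (k ≫ h) hk).val_rst (𝟙 V) j (P.rst k x) h2 h3]
        refine e _ _ ?_
        refine Eq.trans ?_ (hv (k ≫ h) j hk)
        have e' : ∀ (f g : V' ⟶ T) (hf : R f) (hg : R g), f = g → v f hf = v g hg := by
          rintro f g hf hg rfl
          rfl
        exact e' _ _ _ _ (Category.assoc _ _ _))
    exact ⟨c, fun V k hk _ => hc k hk⟩
  choose c hc using key
  have sepc : ∀ ⦃U : Scheme.{u}⦄ (h : U ⟶ T) (x : P.pts U) (hx : P.proj x = h ≫ b)
      (d : (W p U)ˣ), (∀ ⦃V : Scheme.{u}⦄ (k : V ⟶ U) (hk : R (k ≫ h))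
        (hx' : P.proj (P.rst k x) = 𝟙 V ≫ (v (k ≫ h) hk).base),
        resU k d = (v (k ≫ h) hk).val (𝟙 V) (P.rst k x) hx') → d = c h x hx := by
    intro U h x hx d hd
    refine resU_sep (GrothendieckTopology.pullback_stable _ h hR) fun V k hk => ?_
    have h2 : P.proj (P.rst k x) = 𝟙 V ≫ (v (k ≫ h) hk).base := by
      rw [P.proj_rst, hx, Category.id_comp, ← Category.assoc]
      exact hb (k ≫ h) hk
    rw [hd k hk h2, hc h x hx k hk h2]
  have vc : ∀ ⦃U : Scheme.{u}⦄ (f g : U ⟶ T) (hf : R f) (hg : R g), f = g →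
      ∀ (x y : P.pts U) (hx : P.proj x = 𝟙 U ≫ (v f hf).base)
        (hy : P.proj y = 𝟙 U ≫ (v g hg).base), x = y →
        (v f hf).val (𝟙 U) x hx = (v g hg).val (𝟙 U) y hy := by
    rintro U f g hf hg rfl x y hx hy rfl
    rfl
  have rc : ∀ ⦃U : Scheme.{u}⦄ (y z : FrobPt P U) (h : U ⟶ U) (x : P.pts U)
      (hy : P.proj x = h ≫ y.base) (hz : P.proj x = h ≫ z.base), y = z →
      y.val h x hy = z.val h x hz := by
    rintro U y z h x hy hz rfl
    rfl
  let t : FrobPt P T :=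
    { base := b
      val := c
      val_rst := by
        intro U V h k x hx hx'
        symm
        refine sepc _ _ _ _ fun V' j hj h3 => ?_
        have hj' : R ((j ≫ k) ≫ h) := by rwa [Category.assoc]
        have h4 : P.proj (P.rst (j ≫ k) x) = 𝟙 V' ≫ (v ((j ≫ k) ≫ h) hj').base := by
          rw [P.proj_rst, hx, Category.id_comp, ← hb, Category.assoc, Category.assoc,
            Category.assoc]
        rw [← resU_comp, hc h x hx (j ≫ k) hj' h4]
        exact vc _ _ _ _ (Category.assoc _ _ _) _ _ _ _ (P.rst_comp _ _ _)
      val_smul := by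
        intro U h a x hx hx'
        symm
        refine sepc _ _ _ _ fun V k hk h3 => ?_
        have h2 : P.proj (P.rst k x) = 𝟙 V ≫ (v (k ≫ h) hk).base := by
          rw [P.proj_rst, hx, Category.id_comp, ← hb, Category.assoc]
        have h4 : P.proj (resU k a • P.rst k x) = 𝟙 V ≫ (v (k ≫ h) hk).base := by
          rw [P.proj_smul, h2]
        rw [map_mul, hc h x hx k hk h2, val_congr _ rfl (P.rst_smul k a x) h3 h4,
          (v (k ≫ h) hk).val_smul (𝟙 V) (resU k a) (P.rst k x) h2 h4, map_inv, resU_frobU] }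
  refine ⟨t, fun U f hf => ?_, fun t' ht' => ?_⟩
  · change rst f t = v f hf
    refine ext' (hb f hf) fun V h x hx hx' => ?_
    have hx2 : P.proj x = (h ≫ f) ≫ b := hx.trans (Category.assoc _ _ _).symm
    change c (h ≫ f) x hx2 = _
    have h1 : R (h ≫ f) := R.downward_closed hf h
    have h2 : R (𝟙 V ≫ h ≫ f) := by rwa [Category.id_comp]
    have h3 : P.proj (P.rst (𝟙 V) x) = 𝟙 V ≫ (v (𝟙 V ≫ h ≫ f) h2).base := by
      rw [P.rst_id, hx2, ← hb, Category.id_comp, Category.id_comp]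
    have h4 : P.proj x = 𝟙 V ≫ (v (h ≫ f) h1).base := by
      rw [hx2, ← hb, Category.id_comp]
    rw [← resU_id (c (h ≫ f) x hx2), hc (h ≫ f) x hx2 (𝟙 V) h2 h3,
      vc _ _ h2 h1 (Category.id_comp _) _ _ h3 h4 (P.rst_id x)]
    have h5 : P.proj x = 𝟙 V ≫ (rst h (v f hf)).base := by
      rw [hx', Category.id_comp]
      rfl
    rw [rc _ _ _ _ h4 h5 (hv f h hf)]
    exact val_congr _ (Category.id_comp h) rfl _ _
  · have ht : ∀ ⦃U : Scheme.{u}⦄ (f : U ⟶ T) (hf : R f), rst f t' = v f hf := ht'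
    have hb' : t'.base = b := hom_sep hR fun U f hf => by
      rw [hb f hf, ← ht f hf]
      rfl
    refine ext' hb' fun U h x hx hx' => ?_
    refine sepc h x hx' _ fun V k hk h3 => ?_
    have h4 : P.proj (P.rst k x) = (k ≫ h) ≫ t'.base := by
      rw [P.proj_rst, hx, Category.assoc]
    have h5 : P.proj (P.rst k x) = 𝟙 V ≫ (rst (k ≫ h) t').base := by
      rw [h4, Category.id_comp]
      rfl
    rw [← t'.val_rst h k x hx h4, ← rc _ _ _ _ h5 h3 (ht _ hk)]
    exact val_congr _ (Category.id_comp _).symm rfl _ _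

lemma val_ratio {T : Scheme.{u}} {y z : FrobPt P T} (_ : y.base = z.base) {U : Scheme.{u}}
    (h : U ⟶ T) (x x' : P.pts U) (hy : P.proj x = h ≫ y.base) (hz : P.proj x = h ≫ z.base)
    (hy' : P.proj x' = h ≫ y.base) (hz' : P.proj x' = h ≫ z.base) :
    z.val h x hz * (y.val h x hy)⁻¹ = z.val h x' hz' * (y.val h x' hy')⁻¹ := by
  obtain ⟨a, rfl, -⟩ := P.simply_transitive x x' (by rw [hy, hy'])
  rw [y.val_smul h a x hy hy', z.val_smul h a x hz hz', mul_inv, inv_inv,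
    mul_mul_mul_comm, inv_mul_cancel, one_mul]

end FrobPt

/-- The push-out of a `W^×`-torsor along `F : W^× ⟶ W^×`. -/
noncomputable def WTorsor.frob : WTorsor p S where
  sheaf := FrobPt.presheaf P
  isSheaf := FrobPt.isSheaf_presheaf
  proj y := FrobPt.base y
  proj_map _ _ := rfl
  action T := inferInstanceAs (MulAction (W p T)ˣ (FrobPt P T))
  map_smul {T U} f a x := by
    refine FrobPt.ext' (y := FrobPt.rst f (FrobPt.act a x))
      (z := FrobPt.act (resU f a) (FrobPt.rst f x)) rfl fun V h z hz hz' => ?_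
    change resU (h ≫ f) a * _ = resU h (resU f a) * _
    rw [resU_comp]
    rfl
  proj_smul _ _ := rfl
  simply_transitive {T} y z hyz := by
    change FrobPt P T at y z
    change y.base = z.base at hyz
    obtain ⟨R, hR, hR'⟩ := P.exists_cover y.base
    choose x hx using hR'
    obtain ⟨a, ha⟩ := resU_glue hR
      (fun U f hf => z.val f (x f hf) ((hx f hf).trans (by rw [hyz])) *
        (y.val f (x f hf) (hx f hf))⁻¹) (by
        intro U V f g hf
        have h1 : P.proj (P.rst g (x f hf)) = (g ≫ f) ≫ y.base := by
          rw [P.proj_rst, hx, Category.assoc]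
        have h2 : P.proj (P.rst g (x f hf)) = (g ≫ f) ≫ z.base := by rw [h1, hyz]
        rw [map_mul, map_inv, ← y.val_rst f g (x f hf) (hx f hf) h1,
          ← z.val_rst f g (x f hf) _ h2]
        exact FrobPt.val_ratio hyz _ _ _ _ _ _ _)
    refine ⟨a, ?_, fun b hb => ?_⟩
    · refine FrobPt.ext_local (y := FrobPt.act a y) hyz hR fun U f hf =>
        ⟨x f hf, hx f hf, (hx f hf).trans (by rw [hyz]), ?_⟩
      change resU f a * y.val f (x f hf) (hx f hf) = _
      rw [ha f hf, inv_mul_cancel_right]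
    · change FrobPt.act b y = z at hb
      subst hb
      refine resU_sep hR fun U f hf => ?_
      rw [ha f hf]
      exact (mul_inv_cancel_right (resU f b) (y.val f (x f hf) (hx f hf))).symm
  locally_nonempty := by
    obtain ⟨R, hR, h⟩ := P.locally_nonempty
    exact ⟨R, hR, fun T f hf => (h f hf).imp' FrobPt.ofSection fun x hx => hx⟩

end Frob

section Sigma

variable (p : ℕ) [Fact p.Prime]

/-- The objects of the quotient stack `Σ = W_prim / W^×`, where `W^×` acts on `W_prim` by
`(a, x) ↦ a⁻¹ * x`: a scheme `S`, a `W^×`-torsor over `S` and a `W^×`-equivariant map from it to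
`W_prim`. -/
structure SigmaPt : Type (u + 2) where
  /-- the scheme `S` -/
  base : Scheme.{u}
  /-- the torsor -/
  torsor : WTorsor p base
  /-- the equivariant map -/
  ξ : ∀ {T : Scheme.{u}}, torsor.pts T → W p T
  ξ_isPrimitive : ∀ {T : Scheme.{u}} (x : torsor.pts T), IsPrimitive (ξ x)
  ξ_rst : ∀ {T U : Scheme.{u}} (f : U ⟶ T) (x : torsor.pts T), ξ (torsor.rst f x) = res f (ξ x)
  ξ_smul : ∀ {T : Scheme.{u}} (a : (W p T)ˣ) (x : torsor.pts T), ξ (a • x) = ↑a⁻¹ * ξ x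

variable {p}

namespace SigmaPt

/-- The morphisms of `Σ` over a morphism `f` of schemes: the equivariant maps of torsors over `f`
which are compatible with the maps to `W_prim`. -/
structure Hom (A B : SigmaPt.{u} p) : Type (u + 1) where
  /-- the morphism of schemes -/
  base : A.base ⟶ B.base
  /-- the map of torsors -/
  map : ∀ {T : Scheme.{u}}, A.torsor.pts T → B.torsor.pts T
  map_rst : ∀ {T U : Scheme.{u}} (f : U ⟶ T) (x : A.torsor.pts T),
    map (A.torsor.rst f x) = B.torsor.rst f (map x)
  map_smul : ∀ {T : Scheme.{u}} (a : (W p T)ˣ) (x : A.torsor.pts T), map (a • x) = a • map x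
  proj_map : ∀ {T : Scheme.{u}} (x : A.torsor.pts T),
    B.torsor.proj (map x) = A.torsor.proj x ≫ base
  ξ_map : ∀ {T : Scheme.{u}} (x : A.torsor.pts T), B.ξ (map x) = A.ξ x

/-- The identity morphism. -/
def Hom.id (A : SigmaPt.{u} p) : Hom A A where
  base := 𝟙 _
  map x := x
  map_rst _ _ := rfl
  map_smul _ _ := rfl
  proj_map _ := (Category.comp_id _).symm
  ξ_map _ := rfl

/-- The composition of morphisms. -/
def Hom.comp {A B C : SigmaPt.{u} p} (f : Hom A B) (g : Hom B C) : Hom A C where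
  base := f.base ≫ g.base
  map x := g.map (f.map x)
  map_rst h x := by rw [f.map_rst, g.map_rst]
  map_smul a x := by rw [f.map_smul, g.map_smul]
  proj_map x := by rw [g.proj_map, f.proj_map, Category.assoc]
  ξ_map x := by rw [g.ξ_map, f.ξ_map]

lemma Hom.ext' {A B : SigmaPt.{u} p} {f g : Hom A B} (hb : f.base = g.base)
    (hm : ∀ (T : Scheme.{u}) (x : A.torsor.pts T), f.map x = g.map x) : f = g := by
  obtain ⟨b, m, _, _, _, _⟩ := f
  obtain ⟨b', m', _, _, _, _⟩ := g
  obtain rfl : b = b' := hb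
  obtain rfl : @m = @m' := by
    funext T x
    exact hm T x
  rfl

instance : Category.{u + 1} (SigmaPt.{u} p) where
  Hom := Hom
  id := Hom.id
  comp := Hom.comp
  id_comp {A _} f :=
    Hom.ext' (f := Hom.comp (Hom.id A) f) (g := f) (Category.id_comp f.base) fun _ _ => rfl
  comp_id {_ B} f :=
    Hom.ext' (f := Hom.comp f (Hom.id B)) (g := f) (Category.comp_id f.base) fun _ _ => rfl
  assoc f g h :=
    Hom.ext' (f := Hom.comp (Hom.comp f g) h) (g := Hom.comp f (Hom.comp g h))
      (Category.assoc f.base g.base h.base) fun _ _ => rfl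

@[ext]
lemma hom_ext {A B : SigmaPt.{u} p} {f g : A ⟶ B} (hb : Hom.base f = Hom.base g)
    (hm : ∀ {T : Scheme.{u}} (x : A.torsor.pts T), Hom.map f x = Hom.map g x) : f = g := by
  exact Hom.ext' hb fun _ x => hm x

lemma comp_base {A B C : SigmaPt.{u} p} (f : A ⟶ B) (g : B ⟶ C) :
    Hom.base (f ≫ g) = Hom.base f ≫ Hom.base g := rfl

lemma comp_map {A B C : SigmaPt.{u} p} (f : A ⟶ B) (g : B ⟶ C) {T : Scheme.{u}}
    (x : A.torsor.pts T) : Hom.map (f ≫ g) x = Hom.map g (Hom.map f x) := rfl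

/-- Morphisms of torsors are cartesian squares. -/
lemma exists_unique_lift {A B : SigmaPt.{u} p} (φ : A ⟶ B) {T : Scheme.{u}} (g : T ⟶ A.base)
    (y : B.torsor.pts T) (hy : B.torsor.proj y = g ≫ Hom.base φ) :
    ∃! x : A.torsor.pts T, A.torsor.proj x = g ∧ Hom.map φ x = y := by
  have uniq : ∀ {U : Scheme.{u}} (x x' : A.torsor.pts U), A.torsor.proj x = A.torsor.proj x' →
      Hom.map φ x = Hom.map φ x' → x = x' := by
    intro U x x' h h'
    obtain ⟨a, rfl, -⟩ := A.torsor.simply_transitive x x' h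
    rw [Hom.map_smul] at h'
    have : a = 1 := B.torsor.smul_left_cancel (x := Hom.map φ x) (by rw [← h', one_smul])
    rw [this, one_smul]
  obtain ⟨R, hR, hR'⟩ := A.torsor.exists_cover g
  have : ∀ ⦃U : Scheme.{u}⦄ (f : U ⟶ T), R f → ∃ x : A.torsor.pts U, A.torsor.proj x = f ≫ g ∧
      Hom.map φ x = B.torsor.rst f y := by
    intro U f hf
    obtain ⟨x, hx⟩ := hR' f hf
    obtain ⟨a, ha, -⟩ := B.torsor.simply_transitive (Hom.map φ x) (B.torsor.rst f y) (by
      rw [Hom.proj_map, B.torsor.proj_rst, hx, hy, Category.assoc])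
    exact ⟨a • x, by rw [A.torsor.proj_smul, hx], by rw [Hom.map_smul, ha]⟩
  choose x hx hx' using this
  obtain ⟨t, ht⟩ := A.torsor.glue hR x (by
    intro U V f k hf
    apply uniq
    · rw [hx, A.torsor.proj_rst, hx, Category.assoc]
    · rw [hx', Hom.map_rst, hx', B.torsor.rst_comp])
  refine ⟨t, ⟨?_, ?_⟩, ?_⟩
  · exact hom_sep hR fun U f hf => by rw [← A.torsor.proj_rst, ht f hf, hx]
  · exact B.torsor.sep hR fun U f hf => by rw [← Hom.map_rst, ht f hf, hx']
  · rintro t' ⟨h1, h2⟩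
    apply uniq
    · rw [h1]
      exact hom_sep hR fun U f hf => by rw [← A.torsor.proj_rst, ht f hf, hx]
    · rw [h2]
      exact B.torsor.sep hR fun U f hf => by rw [← Hom.map_rst, ht f hf, hx']

/-- The map to `W_prim` on the push-out of the torsor along Frobenius: the class of `(x, c)` goes to
`c⁻¹ * F(ξ(x))`. -/
lemma exists_frobξ (A : SigmaPt.{u} p) {T : Scheme.{u}} (y : FrobPt A.torsor T) :
    ∃ w : W p T, ∀ ⦃U : Scheme.{u}⦄ (h : U ⟶ T) (x : A.torsor.pts U)
      (hx : A.torsor.proj x = h ≫ y.base),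
      res h w = (↑(y.val h x hx)⁻¹ * WittVector.frobenius (A.ξ x) : W p U) := by
  have indep : ∀ ⦃U : Scheme.{u}⦄ (h : U ⟶ T) (x x' : A.torsor.pts U)
      (hx : A.torsor.proj x = h ≫ y.base) (hx' : A.torsor.proj x' = h ≫ y.base),
      (↑(y.val h x hx)⁻¹ * WittVector.frobenius (A.ξ x) : W p U) =
        ↑(y.val h x' hx')⁻¹ * WittVector.frobenius (A.ξ x') := by
    intro U h x x' hx hx'
    obtain ⟨a, rfl, -⟩ := A.torsor.simply_transitive x x' (by rw [hx, hx'])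
    rw [y.val_smul h a x hx hx', A.ξ_smul, mul_inv, inv_inv, map_mul, Units.val_mul,
      ← coe_frobU, map_inv, mul_assoc, mul_left_comm, ← mul_assoc (frobU a : W p U),
      Units.mul_inv, one_mul]
  obtain ⟨R, hR, hR'⟩ := A.torsor.exists_cover y.base
  choose x hx using hR'
  obtain ⟨w, hw⟩ := res_glue hR
    (fun U f hf =>
      (↑(y.val f (x f hf) (hx f hf))⁻¹ * WittVector.frobenius (A.ξ (x f hf)) : W p U)) (by
      intro U V f g hf
      have h1 : A.torsor.proj (A.torsor.rst g (x f hf)) = (g ≫ f) ≫ y.base := by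
        rw [A.torsor.proj_rst, hx, Category.assoc]
      rw [indep _ _ _ _ h1, map_mul, y.val_rst f g (x f hf) (hx f hf) h1, A.ξ_rst, res_frobenius,
        ← map_inv, coe_resU])
  refine ⟨w, fun U h x' hx' => ?_⟩
  refine res_sep (GrothendieckTopology.pullback_stable _ h hR) fun V k hk => ?_
  have h1 : A.torsor.proj (A.torsor.rst k x') = (k ≫ h) ≫ y.base := by
    rw [A.torsor.proj_rst, hx', Category.assoc]
  have hk' : R (k ≫ h) := hk
  rw [← res_comp, hw _ hk', indep _ _ _ _ h1, map_mul, y.val_rst h k x' hx' h1, A.ξ_rst,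
    res_frobenius, ← map_inv, coe_resU]

/-- The map to `W_prim` on the push-out of the torsor along Frobenius. -/
noncomputable def frobξ (A : SigmaPt.{u} p) {T : Scheme.{u}} (y : FrobPt A.torsor T) : W p T :=
  (A.exists_frobξ y).choose

lemma res_frobξ (A : SigmaPt.{u} p) {T : Scheme.{u}} (y : FrobPt A.torsor T) {U : Scheme.{u}}
    (h : U ⟶ T) (x : A.torsor.pts U) (hx : A.torsor.proj x = h ≫ y.base) :
    res h (A.frobξ y) = (↑(y.val h x hx)⁻¹ * WittVector.frobenius (A.ξ x) : W p U) :=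
  (A.exists_frobξ y).choose_spec h x hx

/-- The Frobenius of `Σ` on objects, induced by `F : W^× ⟶ W^×` and `F : W_prim ⟶ W_prim`. -/
noncomputable def frobObj (A : SigmaPt.{u} p) : SigmaPt.{u} p where
  base := A.base
  torsor := A.torsor.frob
  ξ y := A.frobξ y
  ξ_isPrimitive {T} y := by
    change FrobPt A.torsor T at y
    obtain ⟨R, hR, hR'⟩ := A.torsor.exists_cover y.base
    refine isPrimitive_of_cover hR fun U f hf => ?_
    obtain ⟨x, hx⟩ := hR' f hf
    rw [A.res_frobξ y f x hx]
    exact (A.ξ_isPrimitive x).frobenius.unit_mul _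
  ξ_rst {T U} f y := by
    change FrobPt A.torsor T at y
    change A.frobξ (FrobPt.rst f y) = res f (A.frobξ y)
    obtain ⟨R, hR, hR'⟩ := A.torsor.exists_cover (f ≫ y.base)
    refine res_sep hR fun V h hh => ?_
    obtain ⟨x, hx⟩ := hR' h hh
    have hx' : A.torsor.proj x = (h ≫ f) ≫ y.base := by rw [hx, Category.assoc]
    rw [A.res_frobξ (FrobPt.rst f y) h x hx, ← res_comp, A.res_frobξ y (h ≫ f) x hx']
    rfl
  ξ_smul {T} a y := by
    change FrobPt A.torsor T at y
    change A.frobξ (FrobPt.act a y) = ↑a⁻¹ * A.frobξ y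
    obtain ⟨R, hR, hR'⟩ := A.torsor.exists_cover y.base
    refine res_sep hR fun V h hh => ?_
    obtain ⟨x, hx⟩ := hR' h hh
    rw [map_mul, A.res_frobξ (FrobPt.act a y) h x hx, A.res_frobξ y h x hx, ← coe_resU]
    change ((resU h a * y.val h x hx)⁻¹.1 * _ : W p V) = _
    rw [mul_inv, Units.val_mul, map_inv, mul_assoc]

/-- The map of pushed out torsors induced by a morphism: the class of `(x, c)` goes to the class
of `(φ(x), c)`. -/
noncomputable def frobMapPt {A B : SigmaPt.{u} p} (φ : A ⟶ B) {T : Scheme.{u}}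
    (y : FrobPt A.torsor T) : FrobPt B.torsor T where
  base := y.base ≫ Hom.base φ
  val U h x' hx' :=
    let H := exists_unique_lift φ (h ≫ y.base) x' (by rw [hx', Category.assoc])
    y.val h H.choose H.choose_spec.1.1
  val_rst U V h k x' hx' hx'' := by
    have H := exists_unique_lift φ (h ≫ y.base) x' (by rw [hx', Category.assoc])
    have H' := exists_unique_lift φ ((k ≫ h) ≫ y.base) (B.torsor.rst k x')
      (by simp only [hx'', Category.assoc])
    have e : H'.choose = A.torsor.rst k H.choose := by
      refine H'.unique H'.choose_spec.1 ⟨?_, ?_⟩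
      · rw [A.torsor.proj_rst, H.choose_spec.1.1, Category.assoc]
      · rw [Hom.map_rst, H.choose_spec.1.2]
    have h1 : A.torsor.proj (A.torsor.rst k H.choose) = (k ≫ h) ≫ y.base := by
      rw [← e, H'.choose_spec.1.1]
    change y.val (k ≫ h) H'.choose _ = resU k (y.val h H.choose _)
    rw [← y.val_rst h k H.choose H.choose_spec.1.1 h1]
    exact y.val_congr rfl e _ _
  val_smul U h a x' hx' hx'' := by
    have H := exists_unique_lift φ (h ≫ y.base) x' (by rw [hx', Category.assoc])
    have H' := exists_unique_lift φ (h ≫ y.base) (a • x') (by rw [hx'', Category.assoc])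
    have e : H'.choose = a • H.choose := by
      refine H'.unique H'.choose_spec.1 ⟨?_, ?_⟩
      · rw [A.torsor.proj_smul, H.choose_spec.1.1]
      · rw [Hom.map_smul, H.choose_spec.1.2]
    have h1 : A.torsor.proj (a • H.choose) = h ≫ y.base := by
      rw [← e, H'.choose_spec.1.1]
    change y.val h H'.choose _ = (frobU a)⁻¹ * y.val h H.choose _
    rw [← y.val_smul h a H.choose H.choose_spec.1.1 h1]
    exact y.val_congr rfl e _ _

lemma frobMapPt_val {A B : SigmaPt.{u} p} (φ : A ⟶ B) {T : Scheme.{u}}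
    (y : FrobPt A.torsor T) {U : Scheme.{u}} (h : U ⟶ T) (x : A.torsor.pts U)
    (hx : A.torsor.proj x = h ≫ y.base)
    (hx' : B.torsor.proj (Hom.map φ x) = h ≫ (frobMapPt φ y).base) :
    (frobMapPt φ y).val h (Hom.map φ x) hx' = y.val h x hx := by
  have H := exists_unique_lift φ (h ≫ y.base) (Hom.map φ x) (by rw [hx', Category.assoc]; rfl)
  exact y.val_congr rfl (H.unique H.choose_spec.1 ⟨hx, rfl⟩) _ _

/-- Points of the pushed out torsor agree if they agree on the image of a torsor. -/
lemma frobPt_ext {A B : SigmaPt.{u} p} (φ : A ⟶ B) {T : Scheme.{u}} {y z : FrobPt B.torsor T}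
    (g : T ⟶ A.base) (hy : y.base = g ≫ Hom.base φ) (hz : z.base = g ≫ Hom.base φ)
    (hv : ∀ ⦃U : Scheme.{u}⦄ (h : U ⟶ T) (x : A.torsor.pts U) (_ : A.torsor.proj x = h ≫ g)
      (hx : B.torsor.proj (Hom.map φ x) = h ≫ y.base)
      (hx' : B.torsor.proj (Hom.map φ x) = h ≫ z.base),
      y.val h (Hom.map φ x) hx = z.val h (Hom.map φ x) hx') : y = z := by
  refine FrobPt.ext' (hy.trans hz.symm) fun U h x' hx hx' => ?_
  obtain ⟨x, ⟨h1, rfl⟩, -⟩ := exists_unique_lift φ (h ≫ g) x' (by rw [hx, hy, Category.assoc])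
  exact hv h x h1 hx hx'

/-- The Frobenius of `Σ` on morphisms. -/
noncomputable def frobMap {A B : SigmaPt.{u} p} (φ : A ⟶ B) : frobObj A ⟶ frobObj B :=
  Hom.mk (A := frobObj A) (B := frobObj B) (Hom.base (A := A) (B := B) φ) (fun y => frobMapPt φ y)
    (by
      intro T U f y
      change FrobPt A.torsor T at y
      change frobMapPt φ (FrobPt.rst f y) = FrobPt.rst f (frobMapPt φ y)
      refine frobPt_ext φ (f ≫ y.base) rfl (Category.assoc _ _ _).symm fun V h x hx h1 h2 => ?_
      rw [frobMapPt_val φ (FrobPt.rst f y) h x hx]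
      have hx2 : A.torsor.proj x = (h ≫ f) ≫ y.base := by rw [hx]; exact (Category.assoc _ _ _).symm
      have hx3 : B.torsor.proj (Hom.map φ x) = (h ≫ f) ≫ (frobMapPt φ y).base := by
        rw [h2]; exact (Category.assoc _ _ _).symm
      exact (frobMapPt_val φ y (h ≫ f) x hx2 hx3).symm)
    (by
      intro T a y
      change FrobPt A.torsor T at y
      change frobMapPt φ (FrobPt.act a y) = FrobPt.act a (frobMapPt φ y)
      refine frobPt_ext φ y.base rfl rfl fun V h x hx h1 h2 => ?_
      rw [frobMapPt_val φ (FrobPt.act a y) h x hx]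
      exact (congrArg (resU h a * ·) (frobMapPt_val φ y h x hx h2)).symm)
    (fun _ => rfl)
    (by
      intro T y
      change FrobPt A.torsor T at y
      change B.frobξ (frobMapPt φ y) = A.frobξ y
      obtain ⟨R, hR, hR'⟩ := A.torsor.exists_cover y.base
      refine res_sep hR fun V h hh => ?_
      obtain ⟨x, hx⟩ := hR' h hh
      have hx' : B.torsor.proj (Hom.map φ x) = h ≫ (frobMapPt φ y).base := by
        rw [Hom.proj_map, hx, Category.assoc]
        rfl
      rw [A.res_frobξ y h x hx, B.res_frobξ (frobMapPt φ y) h (Hom.map φ x) hx',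
        frobMapPt_val φ y h x hx, Hom.ξ_map])

lemma frobMap_id (A : SigmaPt.{u} p) : frobMap (𝟙 A) = 𝟙 (frobObj A) := by
  refine Hom.ext' (A := frobObj A) (B := frobObj A) (f := frobMap (Hom.id A)) (g := Hom.id _) rfl
    fun T y => ?_
  change FrobPt A.torsor T at y
  change frobMapPt (Hom.id A) y = y
  refine frobPt_ext (Hom.id A) y.base rfl (Category.comp_id _).symm fun V h x hx h1 h2 => ?_
  exact frobMapPt_val (Hom.id A) y h x hx h1

lemma frobMap_comp {A B C : SigmaPt.{u} p} (f : A ⟶ B) (g : B ⟶ C) :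
    frobMap (f ≫ g) = frobMap f ≫ frobMap g := by
  refine Hom.ext' (A := frobObj A) (B := frobObj C) (f := frobMap (Hom.comp f g))
    (g := Hom.comp (frobMap f) (frobMap g)) rfl fun T y => ?_
  change FrobPt A.torsor T at y
  change frobMapPt (Hom.comp f g) y = frobMapPt g (frobMapPt f y)
  refine frobPt_ext (Hom.comp f g) y.base rfl (Category.assoc _ _ _) fun V h x hx h1 h2 => ?_
  have hx' : B.torsor.proj (Hom.map f x) = h ≫ (frobMapPt f y).base := by
    rw [Hom.proj_map, hx, Category.assoc]
    rfl
  exact (frobMapPt_val (Hom.comp f g) y h x hx h1).trans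
    ((frobMapPt_val f y h x hx hx').symm.trans
      (frobMapPt_val g (frobMapPt f y) h (Hom.map f x) hx' h2).symm)

/-- A primitive Witt vector gives an object of `Σ`: the trivial torsor, with the equivariant map
that takes the unit section to the given Witt vector. -/
noncomputable def ofPrim (S : Scheme.{u}) (w : W p S) (hw : IsPrimitive w) : SigmaPt.{u} p where
  base := S
  torsor := WTorsor.trivial p S
  ξ {T} x := trivialξ w x
  ξ_isPrimitive x := (hw.res _).unit_mul _
  ξ_rst {T U} f x := by
    obtain ⟨⟨g, c⟩⟩ := x
    change (↑(resU f c)⁻¹ * res (f ≫ g) w : W p U) = res f (↑c⁻¹ * res g w : W p T)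
    rw [map_mul, res_comp, ← map_inv, coe_resU]
  ξ_smul {T} a x := by
    obtain ⟨⟨g, c⟩⟩ := x
    change (↑(a * c)⁻¹ * res g w : W p T) = ↑a⁻¹ * (↑c⁻¹ * res g w)
    rw [mul_inv, Units.val_mul, mul_assoc]

/-- The functoriality of `ofPrim`. -/
noncomputable def ofPrimMap {S S' : Scheme.{u}} (f : S ⟶ S') (w : W p S) (hw : IsPrimitive w)
    (w' : W p S') (hw' : IsPrimitive w') (h : res f w' = w) : ofPrim S w hw ⟶ ofPrim S' w' hw' :=
  Hom.mk (A := ofPrim S w hw) (B := ofPrim S' w' hw') f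
    (fun {T} x => (⟨(ULift.down x).1 ≫ f, (ULift.down x).2⟩ : ULift.{u + 1} (TrivialPt p S' T)))
    (fun g x => congrArg ULift.up (Prod.ext (Category.assoc g (ULift.down x).1 f) rfl))
    (fun _ _ => rfl) (fun _ => rfl)
    (fun {T} x => by
      obtain ⟨⟨g, c⟩⟩ := x
      change (↑c⁻¹ * res (g ≫ f) w' : W p T) = ↑c⁻¹ * res g w
      rw [res_comp, h])

end SigmaPt

end Sigma

/-- The stack `Σ`, as a category over the category of schemes. -/
def Sigma (p : ℕ) [Fact p.Prime] : BasedCategory.{u + 1, u + 2} Scheme.{u} where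
  obj := SigmaPt.{u} p
  p :=
    { obj := SigmaPt.base
      map := SigmaPt.Hom.base
      map_id := fun _ => rfl
      map_comp := fun _ _ => rfl }

/-- The Frobenius `F : Σ ⟶ Σ`. -/
noncomputable def Sigma.frob (p : ℕ) [Fact p.Prime] : Sigma.{u} p ⥤ᵇ Sigma.{u} p where
  obj := SigmaPt.frobObj
  map := SigmaPt.frobMap
  map_id := SigmaPt.frobMap_id
  map_comp := SigmaPt.frobMap_comp
  w := rfl

end Prismatization

namespace Prismatization

section Colim

universe v w

variable {C : Type w} [Category.{v} C]

/-- The iterates of an endofunctor on objects. -/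
def iterObj (F : C ⥤ C) : ℕ → C → C
  | 0, c => c
  | k + 1, c => F.obj (iterObj F k c)

/-- The category `C[F⁻¹]`, the colimit of the sequence of categories `C ⟶ C ⟶ C ⟶ …` whose
transition functors are all equal to `F` (the colimit is understood in the 2-categorical sense).
An object is an object of the category with number `stage` of the sequence. -/
structure ColimLoc (F : C ⥤ C) where
  /-- the index in the sequence -/
  stage : ℕ
  /-- the object of the category with this index -/
  obj : C

namespace ColimLoc

variable {F : C ⥤ C}

/-- Representatives of morphisms of `C[F⁻¹]`: the morphisms between the images of two objects in
the category with number `N`, for all sufficiently big `N`, compatible with the transition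
functors. -/
structure PreHom (X Y : ColimLoc F) where
  /-- the number starting from which the morphism is defined -/
  start : ℕ
  /-- the morphism in the category with number `X.stage + k = Y.stage + l` -/
  map : ∀ k l : ℕ, X.stage + k = Y.stage + l → start ≤ X.stage + k →
    (iterObj F k X.obj ⟶ iterObj F l Y.obj)
  map_succ : ∀ (k l : ℕ) (h : X.stage + k = Y.stage + l) (hs : start ≤ X.stage + k)
    (h' : X.stage + (k + 1) = Y.stage + (l + 1)) (hs' : start ≤ X.stage + (k + 1)),
    map (k + 1) (l + 1) h' hs' = F.map (map k l h hs)

/-- Two representatives define the same morphism if they eventually agree. -/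
instance homSetoid (X Y : ColimLoc F) : Setoid (PreHom X Y) where
  r f g := ∃ N, ∀ (k l : ℕ) (h : X.stage + k = Y.stage + l) (hf : f.start ≤ X.stage + k)
    (hg : g.start ≤ X.stage + k), N ≤ X.stage + k → f.map k l h hf = g.map k l h hg
  iseqv :=
    { refl := fun _ => ⟨0, fun _ _ _ _ _ _ => rfl⟩
      symm := fun ⟨N, hN⟩ => ⟨N, fun k l h hf hg hk => (hN k l h hg hf hk).symm⟩
      trans := fun {_ g _} ⟨N, hN⟩ ⟨M, hM⟩ => ⟨max g.start (max N M), fun k l h hf hg hk =>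
        (hN k l h hf (by omega) (by omega)).trans (hM k l h (by omega) hg (by omega))⟩ }

/-- The identity. -/
def PreHom.id (X : ColimLoc F) : PreHom X X where
  start := 0
  map k l h _ := eqToHom (by rw [Nat.add_left_cancel h])
  map_succ k l h _ h' _ := by
    obtain rfl : k = l := Nat.add_left_cancel h
    simp only [eqToHom_refl, CategoryTheory.Functor.map_id]
    rfl

/-- The composition. -/
def PreHom.comp {X Y Z : ColimLoc F} (f : PreHom X Y) (g : PreHom Y Z) : PreHom X Z where
  start := max Y.stage (max f.start g.start)
  map k m h hs :=
    f.map k (X.stage + k - Y.stage) (by omega) (by omega) ≫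
      g.map (X.stage + k - Y.stage) m (by omega) (by omega)
  map_succ k m h hs h' hs' := by
    have key : ∀ l l' : ℕ, ∀ (h1 : X.stage + (k + 1) = Y.stage + l')
        (h2 : X.stage + k = Y.stage + l) (h3 : Y.stage + l' = Z.stage + (m + 1))
        (h4 : Y.stage + l = Z.stage + m) (h5 : f.start ≤ X.stage + (k + 1))
        (h6 : f.start ≤ X.stage + k) (h7 : g.start ≤ Y.stage + l') (h8 : g.start ≤ Y.stage + l),
        f.map (k + 1) l' h1 h5 ≫ g.map l' (m + 1) h3 h7 =
          F.map (f.map k l h2 h6 ≫ g.map l m h4 h8) := by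
      intro l l' h1 h2 h3 h4 h5 h6 h7 h8
      obtain rfl : l' = l + 1 := by omega
      rw [f.map_succ k l h2 h6, g.map_succ l m h4 h8]
      exact (F.map_comp _ _).symm
    exact key _ _ _ _ _ _ _ _ _ _

lemma PreHom.comp_map {X Y Z : ColimLoc F} (f : PreHom X Y) (g : PreHom Y Z) (k l m : ℕ)
    (h1 : X.stage + k = Y.stage + l) (h2 : Y.stage + l = Z.stage + m)
    (h3 : f.start ≤ X.stage + k) (h4 : g.start ≤ Y.stage + l) (h5 : X.stage + k = Z.stage + m)
    (h6 : (PreHom.comp f g).start ≤ X.stage + k) :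
    (PreHom.comp f g).map k m h5 h6 = f.map k l h1 h3 ≫ g.map l m h2 h4 := by
  obtain rfl : l = X.stage + k - Y.stage := by omega
  rfl

lemma PreHom.id_start (X : ColimLoc F) (n : ℕ) : (PreHom.id X).start ≤ n := Nat.zero_le n

lemma PreHom.id_map (X : ColimLoc F) (k : ℕ) (h : X.stage + k = X.stage + k)
    (h' : (PreHom.id X).start ≤ X.stage + k) : (PreHom.id X).map k k h h' = 𝟙 _ := rfl

instance : Category (ColimLoc F) where
  Hom X Y := Quotient (homSetoid X Y)
  id X := Quotient.mk _ (PreHom.id X)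
  comp {X Y Z} := Quotient.map₂ PreHom.comp (by
    rintro f f' ⟨N, hN⟩ g g' ⟨M, hM⟩
    refine ⟨max (max f.start f'.start) (max (max g.start g'.start) (max Y.stage (max N M))),
      fun k m h hf hg hk => ?_⟩
    obtain ⟨l, hl⟩ : ∃ l, X.stage + k = Y.stage + l := ⟨X.stage + k - Y.stage, by omega⟩
    rw [PreHom.comp_map f g k l m hl (by omega) (by omega) (by omega),
      PreHom.comp_map f' g' k l m hl (by omega) (by omega) (by omega),
      hN k l hl (by omega) (by omega) (by omega), hM l m (by omega) (by omega) (by omega)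
        (by omega)])
  id_comp {X Y} := by
    rintro ⟨f⟩
    refine Quotient.sound ⟨f.start, fun k l h hf hg hk => ?_⟩
    rw [PreHom.comp_map (PreHom.id X) f k k l rfl h (PreHom.id_start _ _) hg, PreHom.id_map]
    exact Category.id_comp _
  comp_id {X Y} := by
    rintro ⟨f⟩
    refine Quotient.sound ⟨f.start, fun k l h hf hg hk => ?_⟩
    rw [PreHom.comp_map f (PreHom.id Y) k l l h rfl hg (PreHom.id_start _ _), PreHom.id_map]
    exact Category.comp_id _
  assoc {X Y Z T} := by
    rintro ⟨f⟩ ⟨g⟩ ⟨e⟩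
    refine Quotient.sound ⟨max (max f.start g.start) (max (max e.start T.stage)
      (max Y.stage Z.stage)), fun k m h hf hg hk => ?_⟩
    obtain ⟨l, hl⟩ : ∃ l, X.stage + k = Y.stage + l := ⟨X.stage + k - Y.stage, by omega⟩
    obtain ⟨j, hj⟩ : ∃ j, X.stage + k = Z.stage + j := ⟨X.stage + k - Z.stage, by omega⟩
    have h1 : (PreHom.comp f g).start = max Y.stage (max f.start g.start) := rfl
    have h2 : (PreHom.comp g e).start = max Z.stage (max g.start e.start) := rfl
    rw [PreHom.comp_map (PreHom.comp f g) e k j m hj (by omega) (by omega) (by omega),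
      PreHom.comp_map f g k l j hl (by omega) (by omega) (by omega),
      PreHom.comp_map f (PreHom.comp g e) k l m hl (by omega) (by omega) (by omega),
      PreHom.comp_map g e l j m (by omega) (by omega) (by omega) (by omega), Category.assoc]

end ColimLoc

/-- An endofunctor `F` of a category `C` is contracting if `C[F⁻¹]` is a point, i.e. is equivalent
to the category with one object and one morphism. -/
def IsContracting (F : C ⥤ C) : Prop := Nonempty (ColimLoc F ≌ Discrete PUnit.{1})

end Colim

section Based

universe v v' w w'

variable {𝒮 : Type*} [Category 𝒮]

/-- The functor between the fibres over an object of the base induced by a functor of categories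
over the base. -/
def fiberFunctor {X : BasedCategory.{v, w} 𝒮} {Y : BasedCategory.{v', w'} 𝒮}
    (F : BasedFunctor X Y) (S : 𝒮) : Functor.Fiber X.p S ⥤ Functor.Fiber Y.p S where
  obj a := ⟨F.obj a.1, (F.w_obj a.1).trans a.2⟩
  map {a b} φ := ⟨F.map φ.1, by
    have := φ.2
    exact BasedFunctor.preserves_isHomLift F (𝟙 S) φ.1⟩
  map_id a := Subtype.ext (F.map_id a.1)
  map_comp φ ψ := Subtype.ext (F.map_comp φ.1 ψ.1)

/-- The objects of the category of fixed points of an endofunctor `F` over the base: pairs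
consisting of an object `c` and an isomorphism between `c` and `F(c)` over the identity of the
base. -/
structure FixedPt {X : BasedCategory.{v, w} 𝒮} (F : BasedFunctor X X) where
  /-- the object -/
  pt : X.obj
  /-- the isomorphism -/
  iso : pt ≅ F.obj pt
  isHomLift : X.p.IsHomLift (𝟙 (X.p.obj pt)) iso.hom

namespace FixedPt

variable {X : BasedCategory.{v, w} 𝒮} {F : BasedFunctor X X}

/-- The morphisms of pairs. -/
@[ext]
structure Hom (a b : FixedPt F) where
  /-- the morphism between the objects -/
  hom : a.pt ⟶ b.pt
  comm : a.iso.hom ≫ F.map hom = hom ≫ b.iso.hom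

instance : Category.{v} (FixedPt F) where
  Hom := Hom
  id a := ⟨𝟙 a.pt, by rw [CategoryTheory.Functor.map_id, Category.comp_id, Category.id_comp]⟩
  comp f g := ⟨f.hom ≫ g.hom, by
    rw [CategoryTheory.Functor.map_comp, ← Category.assoc, f.comm, Category.assoc, g.comm,
      Category.assoc]⟩
  id_comp f := Hom.ext (Category.id_comp f.hom)
  comp_id f := Hom.ext (Category.comp_id f.hom)
  assoc f g h := Hom.ext (Category.assoc f.hom g.hom h.hom)

end FixedPt

/-- The fixed points `X^F` of an endofunctor `F` over the base, as a category over the base. Its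
fibre over `S` consists of the pairs `(c, α)`, where `c` is an object of the fibre `X(S)` and `α` is
an isomorphism between `c` and `F(c)` in `X(S)`. -/
def fixedPoints {X : BasedCategory.{v, w} 𝒮} (F : BasedFunctor X X) :
    BasedCategory.{v, max v w} 𝒮 where
  obj := FixedPt F
  p :=
    { obj := fun a => X.p.obj a.pt
      map := fun f => X.p.map (FixedPt.Hom.hom f)
      map_id := fun a => X.p.map_id a.pt
      map_comp := fun f g => X.p.map_comp (FixedPt.Hom.hom f) (FixedPt.Hom.hom g) }

/-- The functor `X^F ⟶ X` which forgets `α`. -/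
def fixedPoints.forget {X : BasedCategory.{v, w} 𝒮} (F : BasedFunctor X X) :
    BasedFunctor (fixedPoints F) X where
  obj a := FixedPt.pt a
  map f := FixedPt.Hom.hom f
  map_id _ := rfl
  map_comp _ _ := rfl
  w := rfl

end Based

section SpfZp

variable (p : ℕ) [Fact p.Prime]

/-- The points of the formal scheme `Spf ℤ_p`: the pairs consisting of a scheme `S` and a
homomorphism `ℤ_p ⟶ H⁰(S, 𝒪_S)` which is continuous in the sense that the kernel of the composite
map `ℤ_p ⟶ H⁰(U, 𝒪_U)` is open for each affine open `U ⊆ S`. -/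
structure SpfPt : Type (u + 2) where
  /-- the scheme `S` -/
  base : Scheme.{u}
  /-- the homomorphism -/
  φ : ℤ_[p] →+* Γ(base, ⊤)
  isOpen_ker : ∀ U : base.Opens, IsAffineOpen U →
    IsOpen {a : ℤ_[p] | base.presheaf.map (homOfLE le_top : U ⟶ ⊤).op (φ a) = 0}

variable {p}

namespace SpfPt

/-- The morphisms of points of `Spf ℤ_p`: the morphisms of schemes compatible with the
homomorphisms from `ℤ_p`. -/
@[ext]
structure Hom (a b : SpfPt.{u} p) : Type (u + 1) where
  /-- the morphism of schemes -/
  base : a.base ⟶ b.base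
  comm : ∀ z : ℤ_[p], base.appTop (b.φ z) = a.φ z

instance : Category.{u + 1} (SpfPt.{u} p) where
  Hom := Hom
  id a := ⟨𝟙 a.base, fun _ => by simp⟩
  comp f g := ⟨f.base ≫ g.base, fun z => by
    rw [← f.comm, ← g.comm, Scheme.Hom.comp_appTop]; rfl⟩
  id_comp f := Hom.ext (Category.id_comp f.base)
  comp_id f := Hom.ext (Category.comp_id f.base)
  assoc f g h := Hom.ext (Category.assoc f.base g.base h.base)

lemma isPNilpotent (a : SpfPt.{u} p) : IsPNilpotent p a.base := by
  intro s
  obtain ⟨U, hU, hsU, -⟩ := a.base.isBasis_affineOpens.exists_subset_of_mem_open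
    (Set.mem_univ s) isOpen_univ
  obtain ⟨V, hV, rfl⟩ := hU
  refine ⟨V, hsU, ?_⟩
  have h1 := a.isOpen_ker V hV
  have h2 : Filter.Tendsto (fun n : ℕ => (p : ℤ_[p]) ^ n) Filter.atTop (nhds 0) := by
    refine tendsto_pow_atTop_nhds_zero_of_norm_lt_one ?_
    rw [PadicInt.norm_p]
    exact inv_lt_one_of_one_lt₀ (by exact_mod_cast (Fact.out : p.Prime).one_lt)
  have h3 := h2.eventually (h1.mem_nhds (by simp))
  obtain ⟨n, hn⟩ := h3.exists
  refine ⟨n, ?_⟩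
  simpa using hn

/-- The Witt vector obtained from `p ∈ W(ℤ_p)`. -/
noncomputable def witt (a : SpfPt.{u} p) : W p a.base :=
  WittVector.map a.φ (p : WittVector p ℤ_[p])

lemma isPrimitive_witt (a : SpfPt.{u} p) : IsPrimitive a.witt := by
  rw [witt, map_natCast]
  exact isPrimitive_natCast a.isPNilpotent

lemma res_witt {a b : SpfPt.{u} p} (f : a ⟶ b) : res (Hom.base f) b.witt = a.witt := by
  rw [witt, witt, map_natCast, map_natCast, map_natCast]

end SpfPt

variable (p)

/-- The formal scheme `Spf ℤ_p`, as a category over the category of schemes. -/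
def SpfZp : BasedCategory.{u + 1, u + 2} Scheme.{u} where
  obj := SpfPt.{u} p
  p :=
    { obj := SpfPt.base
      map := SpfPt.Hom.base
      map_id := fun _ => rfl
      map_comp := fun _ _ => rfl }

/-- The morphism `Spf ℤ_p ⟶ Σ` given by the composite map `Spf ℤ_p ⟶ W_prim ⟶ Σ`, where the first
map is the element `p ∈ W(ℤ_p)`. -/
noncomputable def deRhamPoint : BasedFunctor (SpfZp.{u} p) (Sigma.{u} p) where
  obj a := SigmaPt.ofPrim (SpfPt.base a) (SpfPt.witt a) (SpfPt.isPrimitive_witt a)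
  map f := SigmaPt.ofPrimMap (SpfPt.Hom.base f) _ _ _ _ (SpfPt.res_witt f)
  map_id _ := rfl
  map_comp _ _ := rfl
  w := rfl

end SpfZp

end Prismatization

namespace Prismatization

/-! ### Frobenius contraction on Witt vectors over a nilpotent thickening. -/

section WittAlgebra

open WittVector hiding frobenius

variable {p : ℕ} [hp : Fact p.Prime] {R : Type*} [CommRing R]

/-! Let `I` be an ideal of `R` with `p ∈ I` and `I ^ n = 0`. The components of `F(x)` are `x_k ^ p`
plus `p` times a polynomial in `x` without constant term, so `F` raises the `I`-adic order of Witt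
vectors with components in `I`. Hence `F^n` on `W(R)` factors through `W(R/I)`
(`iterate_frobenius_eq_of_wittMk_eq`), and identities between values of `F^n` may be checked modulo
`I`.

For a primitive `x` take `I = (p, x_0)`. Modulo `I` one has `x = V(u)`, where `u` is the shift of
`x`, a unit modulo `I` because `x_1` is one. From `FV = p` and `a V(u) = V(F(a) u)` it follows that
`U(x) = F^n(u)` is a unit of `W(R)` with `F^(n+1)(x) = p U(x)` and `U(ax) = F^(n+1)(a) U(x)`. So
`U⁻¹`, applied to the values of the equivariant map, trivializes the `(n+1)`-fold Frobenius push-out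
of any torsor in `Σ` and identifies the result with the point `p` (`exists_twistedHom`). If `ax =
x`, the same formulas give `F^(n+1)(a) = 1`, so parallel morphisms over `S` become equal after `n +
1` Frobenii (`eqUpToKer_of_isPrimitiveModulo`). On a quasi-compact quasi-separated base one `n`
serves all sections of the torsor, and `F` is contracting.

For the corollary, a section of the torsor of an object `(c, α)` gives a primitive `x` and a unit
`a` with `F(x) = ax`. The equations `c = a F(c)` and `cx = p` have exactly one solution among the
units: when `p` and `x_0` are nilpotent it is `c = a F(a) ⋯ F^n(a) U(x)⁻¹`, and uniqueness lets the
local solutions glue, without any compactness. This `c` is a canonical coordinate on the torsor,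
which identifies `(c, α)` with the point `p`. Thus `Σ^F(S)` is a point if `S` is `p`-nilpotent and
is empty otherwise. The same holds for `Spf ℤ_p`, because a ring in which `p` is nilpotent receives
exactly one homomorphism from `ℤ_p`. -/

lemma constantCoeff_frobeniusPolyAux (n : ℕ) :
    MvPolynomial.constantCoeff (frobeniusPolyAux p n) = 0 := by
  -- The constant term of `X n ^ p + p * frobeniusPolyAux p n` is a component of `F(0) = 0`; over
  -- `ℤ` the factor `p` can be cancelled.
  have h : MvPolynomial.aeval (0 : WittVector p ℤ).coeff (frobeniusPoly p n) = 0 := by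
    rw [← coeff_frobenius, map_zero, zero_coeff]
  have h0 : (0 : WittVector p ℤ).coeff = 0 := funext fun i => zero_coeff p ℤ i
  rw [h0, MvPolynomial.aeval_zero, frobeniusPoly] at h
  have hp0 : (p : ℤ) ≠ 0 := by exact_mod_cast hp.out.ne_zero
  simpa [hp.out.ne_zero, hp0] using h

lemma aeval_mem_of_constantCoeff_eq_zero (I : Ideal R) {x : ℕ → R} (hx : ∀ n, x n ∈ I)
    {f : MvPolynomial ℕ ℤ} (hf : MvPolynomial.constantCoeff f = 0) :
    MvPolynomial.aeval x f ∈ I := by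
  rw [← Ideal.Quotient.eq_zero_iff_mem]
  have h1 : (fun n => Ideal.Quotient.mk I (x n)) = 0 :=
    funext fun n => Ideal.Quotient.eq_zero_iff_mem.2 (hx n)
  have h2 := MvPolynomial.map_aeval x (Ideal.Quotient.mk I) f
  rw [h2, h1]
  simp [hf]

/-- The Frobenius takes Witt vectors with coefficients in a power of an ideal containing `p` to
Witt vectors with coefficients in the next power. -/
lemma coeff_frobenius_mem {I : Ideal R} (hI : (p : R) ∈ I) {j : ℕ} (hj : j ≠ 0)
    {x : WittVector p R} (hx : ∀ n, x.coeff n ∈ I ^ j) (n : ℕ) :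
    (WittVector.frobenius x).coeff n ∈ I ^ (j + 1) := by
  rw [coeff_frobenius, frobeniusPoly, map_add, map_mul, map_pow, MvPolynomial.aeval_X]
  -- Both summands gain a factor from `I`: the `p`-th power lies in `I ^ (j * p)` with `j * p ≥ j +
  -- 1` because `j ≥ 1`, and the other summand is `p ∈ I` times an element of `I ^ j`.
  refine add_mem ?_ ?_
  · refine Ideal.pow_le_pow_right (I := I) (n := j * p) ?_ ?_
    · have := hp.out.two_le
      have : 1 ≤ j := Nat.one_le_iff_ne_zero.2 hj
      nlinarith
    · rw [pow_mul]
      exact Ideal.pow_mem_pow (hx n) p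
  · rw [pow_succ']
    refine Ideal.mul_mem_mul ?_
      (aeval_mem_of_constantCoeff_eq_zero _ hx (constantCoeff_frobeniusPolyAux n))
    simpa using hI

lemma coeff_iterate_frobenius_mem {I : Ideal R} (hI : (p : R) ∈ I)
    {x : WittVector p R} (hx : ∀ n, x.coeff n ∈ I) (k n : ℕ) :
    (WittVector.frobenius^[k] x).coeff n ∈ I ^ (k + 1) := by
  induction k generalizing n with
  | zero => simpa using hx n
  | succ k ih =>
    rw [Function.iterate_succ_apply']
    exact coeff_frobenius_mem hI k.succ_ne_zero ih n

/-- The quotient map on Witt vectors. -/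
noncomputable def wittMk (p : ℕ) [Fact p.Prime] (I : Ideal R) :
    WittVector p R →+* WittVector p (R ⧸ I) :=
  WittVector.map (Ideal.Quotient.mk I)

lemma wittMk_coeff (I : Ideal R) (x : WittVector p R) (n : ℕ) :
    (wittMk p I x).coeff n = Ideal.Quotient.mk I (x.coeff n) := rfl

lemma wittMk_surjective (I : Ideal R) : Function.Surjective (wittMk p I) :=
  WittVector.map_surjective _ Ideal.Quotient.mk_surjective

lemma wittMk_frobenius (I : Ideal R) (x : WittVector p R) :
    wittMk p I (WittVector.frobenius x) = WittVector.frobenius (wittMk p I x) :=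
  (frobenius_isPoly p).map _ _

/-- By additivity it suffices to treat `a - b`, whose components lie in `I`; after `n` Frobenii they
lie in `I ^ (n + 1) = 0`. Every computation modulo `I` below is lifted to `W(R)` in this way. -/
lemma iterate_frobenius_eq_of_wittMk_eq {I : Ideal R} (hI : (p : R) ∈ I) {n : ℕ} (hn : I ^ n = ⊥)
    {a b : WittVector p R} (h : wittMk p I a = wittMk p I b) :
    (WittVector.frobenius^[n] a : WittVector p R) = WittVector.frobenius^[n] b := by
  rw [← sub_eq_zero, ← iterate_map_sub]
  ext k
  have h1 : ∀ k, (a - b).coeff k ∈ I := fun k => by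
    rw [← Ideal.Quotient.eq_zero_iff_mem, ← wittMk_coeff, map_sub, h, sub_self, zero_coeff]
  have h2 := Ideal.pow_le_pow_right n.le_succ (coeff_iterate_frobenius_mem hI h1 n k)
  rw [hn] at h2
  rw [zero_coeff]
  exact h2

lemma wittMk_eq_verschiebung {I : Ideal R} {x : WittVector p R} (hx : x.coeff 0 ∈ I) :
    wittMk p I x = verschiebung (wittMk p I (x.shift 1)) := by
  ext k
  cases k with
  | zero => rw [verschiebung_coeff_zero, wittMk_coeff, Ideal.Quotient.eq_zero_iff_mem.2 hx]
  | succ k => rw [verschiebung_coeff_succ, wittMk_coeff, wittMk_coeff, shift_coeff, add_comm]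

lemma iterate_frobenius_natCast (n m : ℕ) :
    (WittVector.frobenius^[n] (m : WittVector p R) : WittVector p R) = m :=
  Function.iterate_fixed (map_natCast _ m) n

/-- An ideal for which a Witt vector is, modulo that ideal, the Verschiebung of a unit, and a bound
for its exponent of nilpotency. -/
structure IsPrimitiveModulo (x : WittVector p R) (I : Ideal R) (n : ℕ) : Prop where
  natCast_mem : (p : R) ∈ I
  pow_eq_bot : I ^ n = ⊥
  coeff_zero_mem : x.coeff 0 ∈ I
  isUnit_coeff_one : IsUnit (x.coeff 1)

namespace IsPrimitiveModulo

variable {x : WittVector p R} {I : Ideal R} {n : ℕ} (h : IsPrimitiveModulo x I n)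

omit hp in
lemma le {m : ℕ} (h : IsPrimitiveModulo x I n) (hm : n ≤ m) : IsPrimitiveModulo x I m where
  __ := h
  pow_eq_bot := eq_bot_iff.2 (h.pow_eq_bot ▸ Ideal.pow_le_pow_right hm)

include h

/-- If `I` is the unit ideal, then `R = 0` because `I ^ n = 0`. The zero quotient does not have
characteristic `p` in the sense of `CharP`, so this trivial case must be split off wherever
characteristic `p` is used. -/
lemma subsingleton_or_charP : Subsingleton R ∨ CharP (R ⧸ I) p := by
  by_cases hI : I = ⊤
  · left
    have h1 := h.pow_eq_bot
    rw [hI, Ideal.top_pow] at h1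
    exact subsingleton_of_bot_eq_top h1.symm |> fun _ => (Submodule.subsingleton_iff R).1 ‹_›
  · right
    have : Nontrivial (R ⧸ I) := Ideal.Quotient.nontrivial_iff.2 hI
    rw [CharP.charP_iff_prime_eq_zero hp.out, ← map_natCast (Ideal.Quotient.mk I)]
    exact Ideal.Quotient.eq_zero_iff_mem.2 h.natCast_mem

lemma iterate_frobenius_eq {a b : WittVector p R} (hab : wittMk p I a = wittMk p I b) :
    (WittVector.frobenius^[n] a : WittVector p R) = WittVector.frobenius^[n] b :=
  iterate_frobenius_eq_of_wittMk_eq h.natCast_mem h.pow_eq_bot hab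

lemma wittMk_eq : wittMk p I x = verschiebung (wittMk p I (x.shift 1)) :=
  wittMk_eq_verschiebung h.coeff_zero_mem

/-- Modulo `I`, `x = V(u)` and `FV = p`, so `F(x) = p u`; then apply `F^n`, which fixes `p`. -/
lemma iterate_frobenius_succ :
    (WittVector.frobenius^[n + 1] x : WittVector p R) = WittVector.frobenius^[n] (x.shift 1) * p := by
  rw [Function.iterate_succ_apply, ← iterate_frobenius_natCast n p,
    ← iterate_map_mul]
  apply h.iterate_frobenius_eq
  rw [wittMk_frobenius, h.wittMk_eq, frobenius_verschiebung, map_mul, map_natCast]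

/-- The projection formula `a V(u) = V(F(a) u)` and the injectivity of `V` show that the shift of
`ax` is `F(a) u` modulo `I`. This is the equivariance needed to trivialize a torsor after Frobenius
push-out. -/
lemma iterate_frobenius_shift_mul (a : WittVector p R) :
    (WittVector.frobenius^[n] ((a * x).shift 1) : WittVector p R) =
      WittVector.frobenius^[n + 1] a * WittVector.frobenius^[n] (x.shift 1) := by
  rw [Function.iterate_succ_apply, ← iterate_map_mul]
  apply h.iterate_frobenius_eq
  have h0 : (a * x).coeff 0 ∈ I := by
    rw [mul_coeff_zero]
    exact I.mul_mem_left _ h.coeff_zero_mem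
  apply verschiebung_injective p (R ⧸ I)
  rw [← wittMk_eq_verschiebung h0, map_mul, map_mul, wittMk_frobenius, mul_comm (WittVector.frobenius (wittMk p I a)),
    verschiebung_mul_frobenius, ← h.wittMk_eq, mul_comm]

/-- In characteristic `p` a Witt vector with invertible zeroth component is invertible, and the
zeroth component of the shift is `x_1`. Any lift to `W(R)` of an inverse modulo `I` becomes a true
inverse after `F^n`. -/
lemma isUnit_iterate_frobenius_shift :
    IsUnit (WittVector.frobenius^[n] (x.shift 1) : WittVector p R) := by
  obtain h1 | h1 := h.subsingleton_or_charP
  · rw [show (WittVector.frobenius^[n] (x.shift 1) : WittVector p R) = 1 from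
      WittVector.ext fun k => Subsingleton.elim _ _]
    exact isUnit_one
  · obtain ⟨u, hu⟩ := h.isUnit_coeff_one.map (Ideal.Quotient.mk I)
    have h2 : (wittMk p I (x.shift 1)).coeff 0 = u := by
      rw [hu, wittMk_coeff, shift_coeff]
    have h3 : IsUnit (wittMk p I (x.shift 1)) := (mkUnit h2).isUnit
    obtain ⟨y, hy⟩ := h3.exists_right_inv
    obtain ⟨y, rfl⟩ := wittMk_surjective I y
    refine IsUnit.of_mul_eq_one (WittVector.frobenius^[n] y) ?_
    rw [← iterate_map_mul, ← iterate_map_one (WittVector.frobenius (p := p) (R := R)) n]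
    apply h.iterate_frobenius_eq
    rw [map_mul, hy, map_one]

/-- A substitute for cancelling `x`, which may be a zero divisor: the equivariance formula for the
product `y * x` expresses `0` as `F^(n+1)(y)` times a unit. -/
lemma iterate_frobenius_eq_zero {y : WittVector p R} (hy : y * x = 0) :
    (WittVector.frobenius^[n + 1] y : WittVector p R) = 0 := by
  have h1 := h.iterate_frobenius_shift_mul y
  rw [hy] at h1
  have h2 : (0 : WittVector p R).shift 1 = 0 := WittVector.ext fun k => by
    rw [shift_coeff, zero_coeff, zero_coeff]
  rw [h2, iterate_map_zero] at h1
  exact h.isUnit_iterate_frobenius_shift.mul_left_eq_zero.1 h1.symm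

lemma iterate_frobenius_congr {y z : WittVector p R} (hy : y * x = z * x) :
    (WittVector.frobenius^[n + 1] y : WittVector p R) = WittVector.frobenius^[n + 1] z := by
  rw [← sub_eq_zero, ← iterate_map_sub]
  exact h.iterate_frobenius_eq_zero (by rw [sub_mul, hy, sub_self])

/-- Compute the shift of `F(x) = ax` modulo `I` in two ways: it is `F(a) u` by the projection
formula, and `F(u)` because `F` and `V` commute in characteristic `p`. -/
lemma iterate_frobenius_shift_mul_of_frobenius_eq {a : WittVector p R}
    (ha : WittVector.frobenius x = a * x) :
    (WittVector.frobenius^[n + 1] a * WittVector.frobenius^[n] (x.shift 1) : WittVector p R) =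
      WittVector.frobenius^[n + 1] (x.shift 1) := by
  obtain h1 | h1 := h.subsingleton_or_charP
  · exact WittVector.ext fun k => Subsingleton.elim _ _
  rw [← h.iterate_frobenius_shift_mul, Function.iterate_succ_apply, ← ha]
  apply h.iterate_frobenius_eq
  have h0 : (WittVector.frobenius x).coeff 0 ∈ I := by
    rw [ha, mul_coeff_zero]
    exact I.mul_mem_left _ h.coeff_zero_mem
  apply verschiebung_injective p (R ⧸ I)
  rw [← wittMk_eq_verschiebung h0, wittMk_frobenius, wittMk_frobenius, h.wittMk_eq]
  exact (verschiebung_frobenius_comm (p := p) (R := R ⧸ I) _).symm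

end IsPrimitiveModulo

/-- The product `a * F(a) * ⋯ * Fⁿ⁻¹(a)`. -/
noncomputable def frobeniusNorm (a : (WittVector p R)ˣ) : ℕ → (WittVector p R)ˣ
  | 0 => 1
  | n + 1 => a * Units.map (WittVector.frobenius : WittVector p R →+* _).toMonoidHom (frobeniusNorm a n)

lemma frobeniusNorm_mul_iterate {a : (WittVector p R)ˣ} {y : WittVector p R}
    (h : WittVector.frobenius y = a * y) (n : ℕ) :
    (frobeniusNorm a n * y : WittVector p R) = WittVector.frobenius^[n] y := by
  induction n with
  | zero => simp [frobeniusNorm]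
  | succ n ih =>
    rw [Function.iterate_succ_apply', ← ih, map_mul, h, frobeniusNorm, Units.val_mul]
    change a * WittVector.frobenius (frobeniusNorm a n : WittVector p R) * y = WittVector.frobenius (frobeniusNorm a n : WittVector p R) * (a * y)
    ring

/-- Both sides are the product of the `n + 1` factors `a, F(a), …, F^n(a)`, with the first or the
last one split off. -/
lemma mul_frobenius_frobeniusNorm (a : (WittVector p R)ˣ) (n : ℕ) :
    (a * WittVector.frobenius (frobeniusNorm a n : WittVector p R) : WittVector p R) =
      frobeniusNorm a n * WittVector.frobenius^[n] (a : WittVector p R) := by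
  induction n with
  | zero => simp [frobeniusNorm]
  | succ n ih =>
    rw [Function.iterate_succ_apply']
    conv_lhs => rw [frobeniusNorm]
    rw [Units.val_mul]
    change (a * WittVector.frobenius
      (a * WittVector.frobenius (frobeniusNorm a n : WittVector p R) : WittVector p R) :
        WittVector p R) = _
    rw [ih, map_mul, ← mul_assoc]
    rfl

namespace IsPrimitiveModulo

variable {x : WittVector p R} {I : Ideal R} {n : ℕ} (h : IsPrimitiveModulo x I n)

include h

/-- A trivialization of a Frobenius-invariant primitive Witt vector. -/
lemma exists_unit_of_frobenius_eq {a : (WittVector p R)ˣ} (ha : WittVector.frobenius x = a * x) :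
    ∃ c : (WittVector p R)ˣ, (c : WittVector p R) = a * WittVector.frobenius (c : WittVector p R) ∧
      (c * x : WittVector p R) = p := by
  obtain ⟨u, hu⟩ := h.isUnit_iterate_frobenius_shift
  -- Here `u` is `F^n` of the shift of `x`. With `N = a F(a) ⋯ F^n(a)` one has `N x = F^(n+1)(x) = p
  -- u`, so `c = N u⁻¹` satisfies `c x = p`. The equation `c = a F(c)` reduces, by `a F(N) = N
  -- F^(n+1)(a)`, to `F^(n+1)(a) u = F(u)`, which is `h1`.
  refine ⟨frobeniusNorm a (n + 1) * u⁻¹, ?_, ?_⟩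
  · have h1 := h.iterate_frobenius_shift_mul_of_frobenius_eq ha
    rw [Function.iterate_succ_apply' _ _ (x.shift 1), ← hu] at h1
    have h2 : WittVector.frobenius (u⁻¹.1 : WittVector p R) * WittVector.frobenius (u : WittVector p R) = 1 := by
      rw [← map_mul, Units.inv_mul, map_one]
    rw [Units.val_mul, map_mul, ← mul_assoc, mul_frobenius_frobeniusNorm]
    calc _ = frobeniusNorm a (n + 1) * (u⁻¹.1 : WittVector p R) * 1 := (mul_one _).symm
      _ = frobeniusNorm a (n + 1) * (u⁻¹.1 : WittVector p R) *
          (WittVector.frobenius (u⁻¹.1 : WittVector p R) * (WittVector.frobenius^[n + 1] (a : WittVector p R) * u)) := by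
        rw [h1, h2]
      _ = frobeniusNorm a (n + 1) * WittVector.frobenius^[n + 1] (a : WittVector p R) *
          WittVector.frobenius (u⁻¹.1 : WittVector p R) * (u * u⁻¹.1) := by ring
      _ = _ := by rw [Units.mul_inv, mul_one]
  · rw [Units.val_mul, mul_right_comm, frobeniusNorm_mul_iterate ha, h.iterate_frobenius_succ,
      ← hu, mul_right_comm, Units.mul_inv, one_mul]

/-- Iterating `e = a F(e)` recovers `e` from `F^(n+1)(e)`, and the latter depends only on `e x`. -/
lemma unit_eq_of_frobenius_eq {a c d : (WittVector p R)ˣ}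
    (hc : (c : WittVector p R) = a * WittVector.frobenius (c : WittVector p R))
    (hd : (d : WittVector p R) = a * WittVector.frobenius (d : WittVector p R))
    (hx : (c * x : WittVector p R) = d * x) : c = d := by
  have key : ∀ e : (WittVector p R)ˣ, (e : WittVector p R) = a * WittVector.frobenius (e : WittVector p R) →
      ∀ k, (e : WittVector p R) = frobeniusNorm a k * WittVector.frobenius^[k] (e : WittVector p R) := by
    intro e he k
    induction k with
    | zero => simp [frobeniusNorm]
    | succ k ih =>
      rw [Function.iterate_succ_apply', frobeniusNorm, Units.val_mul]
      change _ = a * WittVector.frobenius (frobeniusNorm a k : WittVector p R) * _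
      rw [mul_assoc, ← map_mul, ← ih, ← he]
  refine Units.ext ?_
  rw [key c hc (n + 1), key d hd (n + 1), h.iterate_frobenius_congr hx]

end IsPrimitiveModulo

end WittAlgebra

/-! ### Finite refinements of fpqc coverings and a uniform nilpotency exponent. -/

section Bound

lemma exists_finite_refinement_of_cover {P : MorphismProperty Scheme.{u}}
    [P.RespectsLeft @IsOpenImmersion] {S : Scheme.{u}} [CompactSpace S] [QuasiSeparatedSpace S]
    (𝒰 : Scheme.Cover.{u + 1} (Scheme.precoverage P) S) [QuasiCompactCover 𝒰.toPreZeroHypercover] :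
    ∃ (ι : Type u) (_ : Finite ι) (X : ι → Scheme.{u}) (f : ∀ i, X i ⟶ S),
      (∀ i, CompactSpace (X i)) ∧ (∀ i, ∃ j g, f i = g ≫ 𝒰.f j) ∧
        Sieve.ofArrows X f ∈ Scheme.propQCTopology P S := by
  obtain ⟨𝒱, f, hfin, -⟩ := QuasiCompactCover.exists_hom.{u} 𝒰.qculift
  have hX : ∀ i, CompactSpace (𝒱.cover.X i) := fun i =>
    inferInstanceAs (CompactSpace (Spec (𝒱.X i)))
  refine ⟨𝒱.I₀, hfin, 𝒱.cover.X, 𝒱.cover.f, hX, fun i => ?_, ?_⟩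
  · have h1 : ∀ j, ∃ k g, 𝒰.qculift.f j = g ≫ 𝒰.f k := by
      rintro (j | j)
      · exact ⟨_, 𝟙 _, (Category.id_comp _).symm⟩
      · exact ⟨_, 𝟙 _, (Category.id_comp _).symm⟩
    obtain ⟨k, g, hg⟩ := h1 (f.s₀ i)
    exact ⟨k, f.h₀ i ≫ g, by rw [Category.assoc, ← hg, f.w₀ i]⟩
  -- Quasi-separatedness of `S` enters here: it makes maps from quasi-compact schemes to `S`
  -- quasi-compact, so that the finite family is again a quasi-compact cover.
  · have : ∀ i, QuasiCompact (𝒱.cover.f i) := fun i => quasiCompact_of_compactSpace (𝒱.cover.f i)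
    have : Finite 𝒱.cover.I₀ := hfin
    have : QuasiCompactCover 𝒱.cover.toPreZeroHypercover := .of_finite
    exact Scheme.Cover.mem_propQCTopology 𝒱.cover

/-- Needed in order to take a maximum of finitely many nilpotency exponents, each of which exists
because the member of the covering is quasi-compact. -/
lemma exists_finite_refinement {S : Scheme.{u}} [CompactSpace S] [QuasiSeparatedSpace S]
    {R : Sieve S} (hR : R ∈ Scheme.fpqcTopology S) :
    ∃ (ι : Type u) (_ : Finite ι) (X : ι → Scheme.{u}) (f : ∀ i, X i ⟶ S),
      (∀ i, CompactSpace (X i)) ∧ (∀ i, R (f i)) ∧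
        Sieve.ofArrows X f ∈ Scheme.fpqcTopology S := by
  rw [Precoverage.mem_toGrothendieck_iff_of_isStableUnderComposition] at hR
  obtain ⟨Q, hQ, hQR⟩ := hR
  obtain ⟨𝒰, h𝒰, rfl⟩ := Scheme.mem_propQCPrecoverage_iff_exists_quasiCompactCover.1 hQ
  have : MorphismProperty.RespectsLeft @Flat @IsOpenImmersion :=
    ⟨fun i (_ : IsOpenImmersion i) f (_ : Flat f) => inferInstanceAs (Flat (i ≫ f))⟩
  obtain ⟨ι, hι, X, f, hX, hf, hcov⟩ := exists_finite_refinement_of_cover 𝒰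
  refine ⟨ι, hι, X, f, hX, fun i => ?_, hcov⟩
  obtain ⟨j, g, hg⟩ := hf i
  rw [hg]
  exact R.downward_closed (hQR _ _ (Presieve.ofArrows.mk (f := 𝒰.f) j)) g

lemma IsLocallyNilpotent.isNilpotent {S : Scheme.{u}} [CompactSpace S] {a : Γ(S, ⊤)}
    (h : IsLocallyNilpotent a) : IsNilpotent a := by
  rw [Scheme.isNilpotent_iff_basicOpen_eq_bot_of_isCompact isCompact_univ]
  exact (isLocallyNilpotent_iff a).1 h

lemma eq_zero_of_cover {S : Scheme.{u}} {R : Sieve S} (hR : R ∈ Scheme.fpqcTopology S)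
    {a : Γ(S, ⊤)} (h : ∀ ⦃T : Scheme.{u}⦄ (f : T ⟶ S), R f → f.appTop a = 0) : a = 0 := by
  -- The function is made into a Witt vector with constant components, so that separatedness of `W`
  -- applies; the choice of the prime is immaterial.
  have : Fact (Nat.Prime 2) := ⟨Nat.prime_two⟩
  have h1 : (WittVector.mk 2 fun _ => a : W 2 S) = WittVector.mk 2 fun _ => 0 :=
    res_sep hR fun T f hf => by
      ext n
      rw [res_coeff, res_coeff]
      exact (h f hf).trans (map_zero _).symm
  exact congrArg (fun x : W 2 S => x.coeff 0) h1

variable {p : ℕ} [Fact p.Prime]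

lemma coeff_zero_unit_mul {S : Scheme.{u}} (a : (W p S)ˣ) (x : W p S) :
    (a * x : W p S).coeff 0 = (a : W p S).coeff 0 * x.coeff 0 :=
  WittVector.mul_coeff_zero _ _

/-- The ideal generated by `p` and the zeroth component of a Witt vector. -/
def primIdeal {R : Type*} [CommRing R] (x : WittVector p R) : Ideal R :=
  Ideal.span {(p : R), x.coeff 0}

omit [Fact p.Prime] in
lemma primIdeal_pow_eq_bot {R : Type*} [CommRing R] {x : WittVector p R} {N m : ℕ}
    (hN : (p : R) ^ N = 0) (hm : x.coeff 0 ^ m = 0) : primIdeal x ^ (N + m) = ⊥ := by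
  rw [primIdeal, Ideal.span_insert, eq_bot_iff]
  refine (Ideal.sup_pow_add_le_pow_sup_pow).trans ?_
  rw [Ideal.span_singleton_pow, Ideal.span_singleton_pow, hN, hm]
  simp

omit [Fact p.Prime] in
lemma IsPrimitive.isPrimitiveModulo {S : Scheme.{u}} {x : W p S} (hx : IsPrimitive x) {N m : ℕ}
    (hN : (p : Γ(S, ⊤)) ^ N = 0) (hm : x.coeff 0 ^ m = 0) :
    IsPrimitiveModulo x (primIdeal x) (N + m) where
  natCast_mem := Ideal.subset_span (by simp)
  pow_eq_bot := primIdeal_pow_eq_bot hN hm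
  coeff_zero_mem := Ideal.subset_span (by simp)
  isUnit_coeff_one := hx.coeff_one

/-- On a quasi-compact scheme, a single exponent works for all sections of a torsor. -/
lemma SigmaPt.exists_isPrimitiveModulo (A : SigmaPt.{u} p) [CompactSpace A.base]
    [QuasiSeparatedSpace A.base]
    (hA : IsPNilpotent p A.base) :
    ∃ n, ∀ {T : Scheme.{u}} (x : A.torsor.pts T),
      IsPrimitiveModulo (A.ξ x) (primIdeal (A.ξ x)) n := by
  obtain ⟨N, hN⟩ := hA.isNilpotent
  obtain ⟨R, hR, hne⟩ := A.torsor.locally_nonempty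
  obtain ⟨ι, _, X, f, hX, hf, hcov⟩ := exists_finite_refinement hR
  choose s hs using fun i => hne (f i) (hf i)
  choose m hm using fun i => (A.ξ_isPrimitive (s i)).coeff_zero.isNilpotent
  obtain ⟨M, hM⟩ : ∃ M, ∀ i, m i ≤ M := by
    obtain ⟨M, hM⟩ := (Set.finite_range m).bddAbove
    exact ⟨M, fun i => hM ⟨i, rfl⟩⟩
  refine ⟨N + M, fun {T} x => (A.ξ_isPrimitive x).isPrimitiveModulo ?_ ?_⟩
  · have := congrArg (A.torsor.proj x).appTop hN
    simpa using this
  · refine eq_zero_of_cover (GrothendieckTopology.pullback_stable _ (A.torsor.proj x) hcov)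
      fun U g hg => ?_
    obtain ⟨_, h, k, ⟨i⟩, hk⟩ := hg
    -- Locally `x` is a unit multiple of one of the finitely many chosen sections. The unit
    -- multiplies the zeroth component of `ξ` by a function, so the exponent for that section still
    -- works.
    obtain ⟨a, ha, -⟩ := A.torsor.simply_transitive (A.torsor.rst h (s i)) (A.torsor.rst g x) (by
      rw [A.torsor.proj_rst, A.torsor.proj_rst, hs, hk])
    rw [map_pow, ← res_coeff, ← A.ξ_rst, ← ha, A.ξ_smul, coeff_zero_unit_mul, mul_pow, A.ξ_rst,
      res_coeff, ← map_pow, pow_eq_zero_of_le (hM i) (hm i), map_zero, mul_zero]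

end Bound

/-! ### A criterion for an endofunctor to be contracting. -/

section Colim

universe v w

variable {C : Type w} [Category.{v} C] {F : C ⥤ C}

variable (F) in
/-- Two parallel morphisms become equal after applying the functor `n` times. -/
def EqAfter : ∀ (_ : ℕ) {A B : C} (_ _ : A ⟶ B), Prop
  | 0, _, _, f, g => f = g
  | n + 1, _, _, f, g => EqAfter n (F.map f) (F.map g)

namespace ColimLoc

/-- A morphism at one stage is propagated to all later stages by applying `F`. The `eqToHom`s only
account for `k = k₀ + (k - k₀)` not being definitional. -/
lemma nonempty_preHom {X Y : ColimLoc F} (k₀ l₀ : ℕ) (h₀ : X.stage + k₀ = Y.stage + l₀)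
    (φ : iterObj F k₀ X.obj ⟶ iterObj F l₀ Y.obj) : Nonempty (PreHom X Y) := by
  let M : ∀ j : ℕ, iterObj F (k₀ + j) X.obj ⟶ iterObj F (l₀ + j) Y.obj :=
    fun j => Nat.rec φ (fun _ ψ => F.map ψ) j
  have hk : ∀ {k : ℕ}, X.stage + k₀ ≤ X.stage + k → k = k₀ + (k - k₀) := by omega
  have hl : ∀ {k l : ℕ}, X.stage + k = Y.stage + l → X.stage + k₀ ≤ X.stage + k →
      l₀ + (k - k₀) = l := by omega
  refine ⟨⟨X.stage + k₀, fun k l h hs => eqToHom (congrArg (iterObj F · X.obj) (hk hs)) ≫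
    M (k - k₀) ≫ eqToHom (congrArg (iterObj F · Y.obj) (hl h hs)), ?_⟩⟩
  intro k l h hs h' hs'
  obtain ⟨j, rfl⟩ : ∃ j, k = k₀ + j := ⟨_, hk hs⟩
  obtain rfl : l = l₀ + j := by omega
  have key : ∀ i i' (e : i = i') (e1 : iterObj F (k₀ + i') X.obj = iterObj F (k₀ + i) X.obj)
      (e2 : iterObj F (l₀ + i) Y.obj = iterObj F (l₀ + i') Y.obj),
      eqToHom e1 ≫ M i ≫ eqToHom e2 = M i' := by
    rintro i _ rfl _ _
    simp
  rw [key (k₀ + j - k₀) j (by omega)]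
  exact key (k₀ + (j + 1) - k₀) (j + 1) (by omega) _ _

/-- `EqAfter F n` at one stage is equality `n` stages later, and compatibility with the transition
functors carries equality to every stage after that. -/
lemma PreHom.map_eq_of_eqAfter {X Y : ColimLoc F} {f g : PreHom X Y} (n k l k' l' : ℕ)
    (h : X.stage + k = Y.stage + l) (hf : f.start ≤ X.stage + k) (hg : g.start ≤ X.stage + k)
    (hfg : EqAfter F n (f.map k l h hf) (g.map k l h hg)) (hk : k + n ≤ k')
    (h' : X.stage + k' = Y.stage + l') (hf' : f.start ≤ X.stage + k')
    (hg' : g.start ≤ X.stage + k') : f.map k' l' h' hf' = g.map k' l' h' hg' := by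
  induction n generalizing k l with
  | zero =>
    obtain ⟨j, rfl⟩ : ∃ j, k' = k + j := Nat.exists_eq_add_of_le hk
    obtain rfl : l' = l + j := by omega
    induction j with
    | zero => exact hfg
    | succ j ih =>
      refine (f.map_succ (k + j) (l + j) (by omega) (by omega) (by omega) (by omega)).trans ?_
      refine (congrArg F.map (ih (by omega) (by omega) (by omega) (by omega))).trans ?_
      exact (g.map_succ (k + j) (l + j) (by omega) (by omega) (by omega) (by omega)).symm
  | succ n ih =>
    refine ih (k + 1) (l + 1) (by omega) (by omega) (by omega) ?_ (by omega)
    rw [f.map_succ k l h hf, g.map_succ k l h hg]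
    exact hfg

end ColimLoc

/-- A functor is contracting if every object is eventually taken to a fixed one and parallel
morphisms eventually become equal. -/
lemma isContracting_of_eventually (c : C)
    (h : ∀ A : C, ∃ n, ∀ k, n ≤ k →
      Nonempty (iterObj F k A ⟶ c) ∧ Nonempty (c ⟶ iterObj F k A))
    (h' : ∀ {A B : C} (f g : A ⟶ B), ∃ n, EqAfter F n f g) : IsContracting F := by
  refine (equiv_punit_iff_unique _).2 ⟨⟨⟨0, c⟩⟩, fun X Y => ?_⟩
  obtain ⟨n, hn⟩ := h X.obj
  obtain ⟨m, hm⟩ := h Y.obj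
  -- The numbers of iterations are chosen so that both objects arrive at the common stage `X.stage +
  -- Y.stage + n + m`, where a morphism through `c` can be formed.
  obtain ⟨⟨φ⟩, -⟩ := hn (n + (Y.stage + m)) (by omega)
  obtain ⟨-, ⟨ψ⟩⟩ := hm (m + (X.stage + n)) (by omega)
  obtain ⟨e⟩ := ColimLoc.nonempty_preHom (X := X) (Y := Y) _ _ (by omega) (φ ≫ ψ)
  refine ⟨⟨⟨Quotient.mk _ e⟩, ?_⟩⟩
  rintro ⟨f⟩
  refine Quotient.sound ?_
  -- A stage late enough for both representatives to be defined and not earlier than `Y.stage`.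
  obtain ⟨l, hl⟩ : ∃ l, X.stage + (f.start + e.start + Y.stage) = Y.stage + l :=
    ⟨X.stage + (f.start + e.start), by omega⟩
  obtain ⟨N, hN⟩ := h' (f.map _ l hl (by omega)) (e.map _ l hl (by omega))
  exact ⟨X.stage + (f.start + e.start + Y.stage + N), fun k' l' h1 h2 h3 h4 =>
    ColimLoc.PreHom.map_eq_of_eqAfter N _ l k' l' hl _ _ hN (by omega) h1 h2 h3⟩

end Colim

/-! ### Frobenius-twisted maps of torsors, and morphisms that agree up to the kernel of a Frobenius
power. -/

section Twisted

variable {p : ℕ} [Fact p.Prime]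

lemma resU_iterate_frobU {T S : Scheme.{u}} (f : T ⟶ S) (k : ℕ) (a : (W p S)ˣ) :
    resU f (frobU^[k] a) = frobU^[k] (resU f a) := by
  induction k with
  | zero => rfl
  | succ k ih => rw [Function.iterate_succ_apply', resU_frobU, ih, Function.iterate_succ_apply']

lemma coe_iterate_frobU {S : Scheme.{u}} (k : ℕ) (a : (W p S)ˣ) :
    ((frobU^[k] a : (W p S)ˣ) : W p S) = WittVector.frobenius^[k] (a : W p S) := by
  induction k with
  | zero => rfl
  | succ k ih => rw [Function.iterate_succ_apply', coe_frobU, ih, Function.iterate_succ_apply']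

lemma res_iterate_frobenius {T S : Scheme.{u}} (f : T ⟶ S) (k : ℕ) (a : W p S) :
    res f (WittVector.frobenius^[k] a : W p S) = WittVector.frobenius^[k] (res f a) := by
  induction k with
  | zero => rfl
  | succ k ih =>
    rw [Function.iterate_succ_apply', res_frobenius, ih, Function.iterate_succ_apply']

namespace SigmaPt

/-- The maps of torsors which are equivariant up to the `k`-th power of the Frobenius and are
compatible with the `k`-th power of the Frobenius of `W_prim`. -/
structure TwistedHom (k : ℕ) (A B : SigmaPt.{u} p) where
  /-- the morphism of schemes -/
  base : A.base ⟶ B.base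
  /-- the map of torsors -/
  map : ∀ {T : Scheme.{u}}, A.torsor.pts T → B.torsor.pts T
  map_rst : ∀ {T U : Scheme.{u}} (f : U ⟶ T) (x : A.torsor.pts T),
    map (A.torsor.rst f x) = B.torsor.rst f (map x)
  map_smul : ∀ {T : Scheme.{u}} (a : (W p T)ˣ) (x : A.torsor.pts T),
    map (a • x) = (frobU^[k] a : (W p T)ˣ) • map x
  proj_map : ∀ {T : Scheme.{u}} (x : A.torsor.pts T),
    B.torsor.proj (map x) = A.torsor.proj x ≫ base
  ξ_map : ∀ {T : Scheme.{u}} (x : A.torsor.pts T),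
    B.ξ (map x) = WittVector.frobenius^[k] (A.ξ x)

namespace TwistedHom

variable {k : ℕ} {A B : SigmaPt.{u} p}

/-- A map without a twist is a morphism. -/
def toHom (f : TwistedHom 0 A B) : A ⟶ B :=
  Hom.mk (A := A) (B := B) f.base f.map f.map_rst f.map_smul f.proj_map f.ξ_map

/-- The universal property of the push-out: the class of `(x, c)` goes to `F^k(c) • f(x)`.
Independence of `x` is exactly `F^(k+1)`-equivariance, and sections `x` exist only locally, whence
the gluing. One Frobenius in the twist is thereby traded for one Frobenius on the source. -/
lemma exists_extend (f : TwistedHom (k + 1) A B) {T : Scheme.{u}} (y : FrobPt A.torsor T) :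
    ∃ z : B.torsor.pts T, ∀ ⦃U : Scheme.{u}⦄ (h : U ⟶ T) (x : A.torsor.pts U)
      (hx : A.torsor.proj x = h ≫ y.base),
      B.torsor.rst h z = (frobU^[k] (y.val h x hx) : (W p U)ˣ) • f.map x := by
  have indep : ∀ ⦃U : Scheme.{u}⦄ (h : U ⟶ T) (x x' : A.torsor.pts U)
      (hx : A.torsor.proj x = h ≫ y.base) (hx' : A.torsor.proj x' = h ≫ y.base),
      (frobU^[k] (y.val h x hx) : (W p U)ˣ) • f.map x =
        (frobU^[k] (y.val h x' hx') : (W p U)ˣ) • f.map x' := by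
    intro U h x x' hx hx'
    obtain ⟨a, rfl, -⟩ := A.torsor.simply_transitive x x' (by rw [hx, hx'])
    rw [y.val_smul h a x hx hx', f.map_smul, iterate_map_mul, iterate_map_inv,
      ← Function.iterate_succ_apply, smul_smul, mul_right_comm, inv_mul_cancel, one_mul]
  obtain ⟨R, hR, hR'⟩ := A.torsor.exists_cover y.base
  choose x hx using hR'
  obtain ⟨z, hz⟩ := B.torsor.glue hR
    (fun U h hh => (frobU^[k] (y.val h (x h hh) (hx h hh)) : (W p U)ˣ) • f.map (x h hh)) (by
      intro U V h g hh
      have h1 : A.torsor.proj (A.torsor.rst g (x h hh)) = (g ≫ h) ≫ y.base := by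
        rw [A.torsor.proj_rst, hx, Category.assoc]
      rw [indep _ _ _ _ h1, y.val_rst h g (x h hh) (hx h hh) h1, f.map_rst, B.torsor.rst_smul,
        resU_iterate_frobU])
  refine ⟨z, fun U h x' hx' => ?_⟩
  refine B.torsor.sep (GrothendieckTopology.pullback_stable _ h hR) fun V g hg => ?_
  have h1 : A.torsor.proj (A.torsor.rst g x') = (g ≫ h) ≫ y.base := by
    rw [A.torsor.proj_rst, hx', Category.assoc]
  rw [← B.torsor.rst_comp, hz (g ≫ h) hg, indep _ _ _ _ h1, y.val_rst h g x' hx' h1, f.map_rst,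
    B.torsor.rst_smul, resU_iterate_frobU]

/-- The extension of a twisted map along the push-out by the Frobenius, on points. -/
noncomputable def extend (f : TwistedHom (k + 1) A B) {T : Scheme.{u}} (y : FrobPt A.torsor T) :
    B.torsor.pts T :=
  (f.exists_extend y).choose

lemma rst_extend (f : TwistedHom (k + 1) A B) {T : Scheme.{u}} (y : FrobPt A.torsor T)
    {U : Scheme.{u}} (h : U ⟶ T) (x : A.torsor.pts U) (hx : A.torsor.proj x = h ≫ y.base) :
    B.torsor.rst h (f.extend y) = (frobU^[k] (y.val h x hx) : (W p U)ˣ) • f.map x :=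
  (f.exists_extend y).choose_spec h x hx

/-- The extension of a twisted map along the push-out by the Frobenius. -/
noncomputable def ofFrobObj (f : TwistedHom (k + 1) A B) : TwistedHom k (frobObj A) B where
  base := f.base
  map y := f.extend y
  map_rst {T U} g y := by
    change FrobPt A.torsor T at y
    change f.extend (FrobPt.rst g y) = B.torsor.rst g (f.extend y)
    obtain ⟨R, hR, hR'⟩ := A.torsor.exists_cover (g ≫ y.base)
    refine B.torsor.sep hR fun V h hh => ?_
    obtain ⟨x, hx⟩ := hR' h hh
    have hx' : A.torsor.proj x = (h ≫ g) ≫ y.base := by rw [hx, Category.assoc]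
    rw [f.rst_extend (FrobPt.rst g y) h x hx, ← B.torsor.rst_comp, f.rst_extend y (h ≫ g) x hx']
    rfl
  map_smul {T} a y := by
    change FrobPt A.torsor T at y
    change f.extend (FrobPt.act a y) = (frobU^[k] a : (W p T)ˣ) • f.extend y
    obtain ⟨R, hR, hR'⟩ := A.torsor.exists_cover y.base
    refine B.torsor.sep hR fun V h hh => ?_
    obtain ⟨x, hx⟩ := hR' h hh
    rw [f.rst_extend (FrobPt.act a y) h x hx, B.torsor.rst_smul, f.rst_extend y h x hx, smul_smul,
      resU_iterate_frobU, ← iterate_map_mul]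
    rfl
  proj_map {T} y := by
    change FrobPt A.torsor T at y
    change B.torsor.proj (f.extend y) = y.base ≫ f.base
    obtain ⟨R, hR, hR'⟩ := A.torsor.exists_cover y.base
    refine hom_sep hR fun V h hh => ?_
    obtain ⟨x, hx⟩ := hR' h hh
    rw [← B.torsor.proj_rst, f.rst_extend y h x hx, B.torsor.proj_smul, f.proj_map, hx,
      Category.assoc]
  ξ_map {T} y := by
    change FrobPt A.torsor T at y
    change B.ξ (f.extend y) = WittVector.frobenius^[k] (A.frobξ y)
    obtain ⟨R, hR, hR'⟩ := A.torsor.exists_cover y.base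
    refine res_sep hR fun V h hh => ?_
    obtain ⟨x, hx⟩ := hR' h hh
    rw [← B.ξ_rst, f.rst_extend y h x hx, B.ξ_smul, f.ξ_map, res_iterate_frobenius,
      A.res_frobξ y h x hx, iterate_map_mul, ← iterate_map_inv, coe_iterate_frobU,
      ← Function.iterate_succ_apply]

end TwistedHom

lemma exists_unit_eq_iterate_frobenius_shift {A : SigmaPt.{u} p} {n : ℕ}
    (hn : ∀ {T : Scheme.{u}} (x : A.torsor.pts T),
      IsPrimitiveModulo (A.ξ x) (primIdeal (A.ξ x)) n) {T : Scheme.{u}} (x : A.torsor.pts T) :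
    ∃ c : (W p T)ˣ, (c : W p T) = WittVector.frobenius^[n] ((A.ξ x).shift 1) :=
  (hn x).isUnit_iterate_frobenius_shift

lemma shift_res {T S : Scheme.{u}} (f : T ⟶ S) (x : W p S) (n : ℕ) :
    (res f x).shift n = res f (x.shift n) := rfl

/-- In the trivial torsor the section `x` gets the coordinate `U⁻¹`, where `U` is `F^n` of the shift
of `ξ(x)`; the inverse appears because units act on `W_prim` by division. Equivariance is
`iterate_frobenius_shift_mul`, and compatibility with `ξ` is the formula `F^(n+1)(ξ(x)) = p U`. The
exponent `n` must be the same for all sections. -/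
lemma exists_twistedHom {A : SigmaPt.{u} p} {n : ℕ}
    (hn : ∀ {T : Scheme.{u}} (x : A.torsor.pts T),
      IsPrimitiveModulo (A.ξ x) (primIdeal (A.ξ x)) n)
    {S : Scheme.{u}} (hS : IsPNilpotent p S) (e : A.base ⟶ S) :
    ∃ f : TwistedHom (n + 1) A (ofPrim S (p : W p S) (isPrimitive_natCast hS)), f.base = e := by
  choose c hc using fun (T : Scheme.{u}) (x : A.torsor.pts T) => exists_unit_eq_iterate_frobenius_shift hn x
  refine ⟨⟨e, fun {T} x => (ULift.up (A.torsor.proj x ≫ e, (c T x)⁻¹) :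
    ULift.{u + 1} (TrivialPt p S T)), ?_, ?_, fun _ => rfl, ?_⟩, rfl⟩
  · intro T U f x
    refine congrArg ULift.up (Prod.ext ?_ ?_)
    · change A.torsor.proj (A.torsor.rst f x) ≫ e = f ≫ A.torsor.proj x ≫ e
      rw [A.torsor.proj_rst, Category.assoc]
    · change (c U (A.torsor.rst f x))⁻¹ = resU f (c T x)⁻¹
      rw [map_inv, inv_inj]
      refine Units.ext ?_
      rw [coe_resU, hc, hc, res_iterate_frobenius, A.ξ_rst, shift_res]
  · intro T a x
    refine congrArg ULift.up (Prod.ext ?_ ?_)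
    · change A.torsor.proj (a • x) ≫ e = A.torsor.proj x ≫ e
      rw [A.torsor.proj_smul]
    · change (c T (a • x))⁻¹ = frobU^[n + 1] a * (c T x)⁻¹
      rw [← inv_inj, inv_inv, mul_inv, inv_inv, ← iterate_map_inv]
      refine Units.ext ?_
      rw [Units.val_mul, hc, hc, coe_iterate_frobU, A.ξ_smul, (hn x).iterate_frobenius_shift_mul]
  · intro T x
    change (((c T x)⁻¹)⁻¹.1 * res _ (p : W p S) : W p T) = _
    rw [inv_inv, map_natCast, hc, (hn x).iterate_frobenius_succ]

/-- Two morphisms which differ by units that are killed by the `k`-th power of the Frobenius. -/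
def EqUpToKer (k : ℕ) {A B : SigmaPt.{u} p} (f g : A ⟶ B) : Prop :=
  Hom.base f = Hom.base g ∧ ∀ {T : Scheme.{u}} (x : A.torsor.pts T),
    ∃ a : (W p T)ˣ, frobU^[k] a = 1 ∧ Hom.map g x = a • Hom.map f x

lemma EqUpToKer.eq {A B : SigmaPt.{u} p} {f g : A ⟶ B} (h : EqUpToKer 0 f g) : f = g := by
  refine hom_ext h.1 fun x => ?_
  obtain ⟨a, ha, hx⟩ := h.2 x
  rw [hx, show a = 1 from ha, one_smul]

/-- If `g(x) = b • f(x)`, then in the push-out the class of `(g(x), c)` is that of `(f(x), F(b) c)`.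
The discrepancy `b` is thus replaced by `F(b)`, which one Frobenius fewer suffices to kill. -/
lemma EqUpToKer.frobMap {k : ℕ} {A B : SigmaPt.{u} p} {f g : A ⟶ B}
    (h : EqUpToKer (k + 1) f g) : EqUpToKer k (frobMap f) (frobMap g) := by
  refine ⟨h.1, fun {T} y => ?_⟩
  change FrobPt A.torsor T at y
  have hb : (frobMapPt f y).base = (frobMapPt g y).base := congrArg (y.base ≫ ·) h.1
  obtain ⟨a, ha, -⟩ := B.torsor.frob.simply_transitive (frobMapPt f y) (frobMapPt g y) hb
  change FrobPt.act a (frobMapPt f y) = frobMapPt g y at ha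
  refine ⟨a, ?_, ha.symm⟩
  obtain ⟨R, hR, hR'⟩ := A.torsor.exists_cover y.base
  refine resU_sep hR fun U i hi => ?_
  obtain ⟨x, hx⟩ := hR' i hi
  obtain ⟨b, hb1, hb2⟩ := h.2 x
  have hf : B.torsor.proj (Hom.map f x) = i ≫ (frobMapPt f y).base := by
    rw [Hom.proj_map, hx, Category.assoc]; rfl
  have hg : B.torsor.proj (Hom.map g x) = i ≫ (frobMapPt g y).base := by
    rw [Hom.proj_map, hx, Category.assoc]; rfl
  have hg' : B.torsor.proj (Hom.map g x) = i ≫ (frobMapPt f y).base := by rw [hg, hb]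
  have hg'' : B.torsor.proj (b • Hom.map f x) = i ≫ (frobMapPt f y).base := by rw [← hb2, hg']
  have e1 := frobMapPt_val g y i x hx hg
  have e2 : ∀ (z : FrobPt B.torsor T) (hz : B.torsor.proj (Hom.map g x) = i ≫ z.base),
      FrobPt.act a (frobMapPt f y) = z →
      z.val i (Hom.map g x) hz = resU i a * (frobMapPt f y).val i (Hom.map g x) hg' := by
    rintro _ _ rfl
    rfl
  -- Evaluating both image points at `g(x)` turns `e1` into the statement that `a` restricts to
  -- `F(b)`.
  rw [e2 _ hg ha, FrobPt.val_congr (frobMapPt f y) rfl hb2 hg' hg'',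
    (frobMapPt f y).val_smul i b _ hf hg'', frobMapPt_val f y i x hx hf, ← mul_assoc,
    mul_eq_right, mul_inv_eq_one] at e1
  rw [resU_iterate_frobU, e1, ← Function.iterate_succ_apply, hb1, map_one]

/-- Both morphisms preserve `ξ`, so the discrepancy `a` satisfies `a⁻¹ * ξ(x) = ξ(x)`. Such
stabilizers need not be trivial, but `F^(n+1)` kills them. -/
lemma eqUpToKer_of_isPrimitiveModulo {A B : SigmaPt.{u} p} {n : ℕ}
    (hn : ∀ {T : Scheme.{u}} (x : A.torsor.pts T),
      IsPrimitiveModulo (A.ξ x) (primIdeal (A.ξ x)) n) (f g : A ⟶ B)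
    (h : Hom.base f = Hom.base g) : EqUpToKer (n + 1) f g := by
  refine ⟨h, fun {T} x => ?_⟩
  obtain ⟨a, ha, -⟩ := B.torsor.simply_transitive (Hom.map f x) (Hom.map g x) (by
    rw [Hom.proj_map, Hom.proj_map, h])
  refine ⟨a, ?_, ha.symm⟩
  have h1 := Hom.ξ_map g x
  rw [← ha, B.ξ_smul, Hom.ξ_map] at h1
  have h2 : (a⁻¹.1 * A.ξ x : W p T) = (1 : W p T) * A.ξ x := by rw [h1, one_mul]
  have h3 := (hn x).iterate_frobenius_congr h2
  rw [iterate_map_one, ← coe_iterate_frobU, iterate_map_inv] at h3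
  exact inv_eq_one.1 (Units.ext h3)

end SigmaPt

end Twisted

/-! ### The Frobenius of `Σ(S)` is contracting. -/

section Contracting

variable {p : ℕ} [Fact p.Prime]

namespace SigmaPt

lemma map_injective {A B : SigmaPt.{u} p} (φ : A ⟶ B) {T : Scheme.{u}} {x x' : A.torsor.pts T}
    (h : A.torsor.proj x = A.torsor.proj x') (h' : Hom.map φ x = Hom.map φ x') : x = x' :=
  (exists_unique_lift φ (A.torsor.proj x') (Hom.map φ x') (Hom.proj_map φ x')).unique
    ⟨h, h'⟩ ⟨rfl, rfl⟩

/-- A morphism of `Σ` is invertible if it is so on the bases. -/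
lemma isIso_of_isIso_base {A B : SigmaPt.{u} p} (φ : A ⟶ B) [IsIso (Hom.base φ)] : IsIso φ := by
  have hex : ∀ (T : Scheme.{u}) (y : B.torsor.pts T), ∃ x : A.torsor.pts T,
      A.torsor.proj x = B.torsor.proj y ≫ inv (Hom.base φ) ∧ Hom.map φ x = y := fun T y =>
    (exists_unique_lift φ (B.torsor.proj y ≫ inv (Hom.base φ)) y (by simp)).exists
  choose m hm hm' using hex
  have uniq : ∀ {T : Scheme.{u}} (x x' : A.torsor.pts T), Hom.map φ x = Hom.map φ x' → x = x' := by
    intro T x x' h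
    refine map_injective φ ?_ h
    have := congrArg B.torsor.proj h
    rw [Hom.proj_map, Hom.proj_map] at this
    exact (cancel_mono (Hom.base φ)).1 this
  let ψ : B ⟶ A := Hom.mk (A := B) (B := A) (inv (Hom.base φ)) (fun {T} y => m T y)
    (fun f y => uniq _ _ (by rw [hm', Hom.map_rst, hm']))
    (fun a y => uniq _ _ (by rw [hm', Hom.map_smul, hm'])) (fun y => hm _ y)
    (fun y => by rw [← Hom.ξ_map φ, hm'])
  exact ⟨ψ, hom_ext (IsIso.hom_inv_id (Hom.base φ)) fun x => uniq _ _ (hm' _ _),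
    hom_ext (IsIso.inv_hom_id (Hom.base φ)) fun y => hm' _ y⟩

end SigmaPt

/-- The fibre `Σ(S)`. -/
abbrev SigmaFiber (p : ℕ) [Fact p.Prime] (S : Scheme.{u}) := Functor.Fiber (Sigma.{u} p).p S

namespace SigmaFiber

variable {S : Scheme.{u}}

/-- The underlying object of `Σ`. -/
abbrev toSigmaPt (c : SigmaFiber.{u} p S) : SigmaPt.{u} p := c.1

lemma base_eq (c : SigmaFiber.{u} p S) : c.toSigmaPt.base = S := c.2

/-- The underlying morphism of `Σ`. -/
abbrev toHom {c d : SigmaFiber.{u} p S} (f : c ⟶ d) : c.toSigmaPt ⟶ d.toSigmaPt := f.1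

lemma base_toHom {c d : SigmaFiber.{u} p S} (f : c ⟶ d) :
    SigmaPt.Hom.base (toHom f) = eqToHom (c.base_eq.trans d.base_eq.symm) := by
  have := f.2
  have h := IsHomLift.fac' (Sigma.{u} p).p (𝟙 S) f.1
  refine Eq.trans h ?_
  rw [Category.id_comp, eqToHom_trans]
  rfl

/-- A morphism of `Σ` over the identity of `S` is a morphism of the fibre. -/
lemma exists_toHom_eq {c d : SigmaFiber.{u} p S} (φ : c.toSigmaPt ⟶ d.toSigmaPt)
    (h : SigmaPt.Hom.base φ = eqToHom (c.base_eq.trans d.base_eq.symm)) :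
    ∃ f : c ⟶ d, toHom f = φ := by
  refine ⟨⟨φ, ?_⟩, rfl⟩
  refine IsHomLift.of_fac' (Sigma.{u} p).p (𝟙 S) φ c.2 d.2 ?_
  refine Eq.trans h ?_
  rw [Category.id_comp, eqToHom_trans]
  rfl

lemma nonempty_hom_symm {c d : SigmaFiber.{u} p S} (f : c ⟶ d) : Nonempty (d ⟶ c) := by
  have hb := base_toHom f
  have : IsIso (SigmaPt.Hom.base (toHom f)) := by rw [hb]; infer_instance
  have := SigmaPt.isIso_of_isIso_base (toHom f)
  obtain ⟨g, -⟩ := exists_toHom_eq (c := d) (d := c) (inv (toHom f)) (by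
    have h1 : SigmaPt.Hom.base (inv (toHom f)) ≫ SigmaPt.Hom.base (toHom f) = 𝟙 _ := by
      rw [← SigmaPt.comp_base, IsIso.inv_hom_id]
      rfl
    rw [← cancel_mono (SigmaPt.Hom.base (toHom f)), h1, hb]
    simp)
  exact ⟨g⟩

variable (p S) in
/-- The Frobenius of the fibre. -/
noncomputable abbrev frob : SigmaFiber.{u} p S ⥤ SigmaFiber.{u} p S :=
  fiberFunctor (Sigma.frob.{u} p) S

/-- Trade the twist for Frobenii on the source one at a time: after `j` steps the remaining twist is
`m` with `m + j = k`, and a map with twist `0` is a morphism. -/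
lemma nonempty_iterObj_hom {c d : SigmaFiber.{u} p S} {k : ℕ}
    (f : SigmaPt.TwistedHom k c.toSigmaPt d.toSigmaPt)
    (hf : f.base = eqToHom (c.base_eq.trans d.base_eq.symm)) :
    Nonempty (iterObj (frob p S) k c ⟶ d) := by
  have key : ∀ j m, m + j = k →
      ∃ g : SigmaPt.TwistedHom m (toSigmaPt (iterObj (frob p S) j c)) d.toSigmaPt,
        g.base = eqToHom ((base_eq _).trans d.base_eq.symm) := by
    intro j
    induction j with
    | zero =>
      rintro m rfl
      exact ⟨f, hf⟩
    | succ j ih =>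
      intro m hm
      obtain ⟨g, hg⟩ := ih (m + 1) (by omega)
      exact ⟨g.ofFrobObj, hg⟩
  obtain ⟨g, hg⟩ := key k 0 (by omega)
  exact ⟨(exists_toHom_eq g.toHom hg).choose⟩

lemma eqAfter_of_eqUpToKer (n : ℕ) {c d : SigmaFiber.{u} p S} (f g : c ⟶ d)
    (h : SigmaPt.EqUpToKer n (toHom f) (toHom g)) : EqAfter (frob p S) n f g := by
  induction n generalizing c d with
  | zero => exact Subtype.ext h.eq
  | succ n ih => exact ih _ _ h.frobMap

end SigmaFiber

/-- The object to which everything is eventually taken is the one given by `p ∈ W(S)`. -/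
theorem isContracting_frob {S : Scheme.{u}} [CompactSpace S] [QuasiSeparatedSpace S]
    (hS : IsPNilpotent p S) : IsContracting (SigmaFiber.frob.{u} p S) := by
  have bound : ∀ c : SigmaFiber.{u} p S, ∃ n, ∀ {T : Scheme.{u}} (x : c.toSigmaPt.torsor.pts T),
      IsPrimitiveModulo (c.toSigmaPt.ξ x) (primIdeal (c.toSigmaPt.ξ x)) n := by
    rintro ⟨A, hA⟩
    change A.base = S at hA
    subst hA
    exact A.exists_isPrimitiveModulo hS
  let pt : SigmaFiber.{u} p S := ⟨SigmaPt.ofPrim S (p : W p S) (isPrimitive_natCast hS), rfl⟩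
  refine isContracting_of_eventually pt (fun c => ?_) fun {c d} f g => ?_
  · obtain ⟨n, hn⟩ := bound c
    refine ⟨n + 1, fun k hk => ?_⟩
    -- An exponent `j` of nilpotency produces a twist of `j + 1`. Since exponents may be increased,
    -- every `k ≥ n + 1` is reached, not only `n + 1`.
    obtain ⟨k, rfl⟩ : ∃ j, k = j + 1 := ⟨k - 1, by omega⟩
    obtain ⟨f, hf⟩ := SigmaPt.exists_twistedHom (n := k) (fun x => (hn x).le (by omega)) hS
      (eqToHom c.base_eq)
    obtain ⟨g⟩ := SigmaFiber.nonempty_iterObj_hom (d := pt) f hf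
    exact ⟨⟨g⟩, SigmaFiber.nonempty_hom_symm g⟩
  · obtain ⟨n, hn⟩ := bound c
    refine ⟨n + 1, SigmaFiber.eqAfter_of_eqUpToKer _ _ _
      (SigmaPt.eqUpToKer_of_isPrimitiveModulo hn _ _ ?_)⟩
    rw [SigmaFiber.base_toHom, SigmaFiber.base_toHom]

end Contracting

/-! ### Reduction from locally nilpotent to nilpotent functions. -/

section Nilpotent

/-- The sieve of those morphisms along which a given function becomes nilpotent. -/
def nilpotentSieve {S : Scheme.{u}} (a : Γ(S, ⊤)) : Sieve S where
  arrows T f := IsNilpotent (f.appTop a)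
  downward_closed {T U f} hf g := by
    rw [Scheme.Hom.comp_appTop]
    exact hf.map g.appTop.hom

/-- On the members of an affine cover, which are quasi-compact, locally nilpotent functions are
nilpotent. This makes the algebra above available fpqc-locally on an arbitrary scheme. -/
lemma IsLocallyNilpotent.nilpotentSieve_mem {S : Scheme.{u}} {a : Γ(S, ⊤)}
    (h : IsLocallyNilpotent a) : nilpotentSieve a ∈ Scheme.fpqcTopology S := by
  refine GrothendieckTopology.superset_covering _ ?_
    (Scheme.zariskiTopology_le_fpqcTopology _ S.affineCover.mem_grothendieckTopology)
  rintro T f ⟨_, g, k, ⟨i⟩, rfl⟩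
  exact (nilpotentSieve a).downward_closed (h.pullback (S.affineCover.f i)).isNilpotent g

end Nilpotent

/-! ### Homomorphisms from `ℤ_p` to rings of functions on `p`-nilpotent schemes. -/

section PadicHom

variable {p : ℕ} [Fact p.Prime] {R : Type*} [CommRing R]

lemma exists_padicInt_hom (h : IsNilpotent (p : R)) : Nonempty (ℤ_[p] →+* R) := by
  obtain ⟨n, hn⟩ := h
  have h1 : ((p ^ n : ℕ) : R) = 0 := by rw [Nat.cast_pow, hn]
  exact ⟨(ZMod.castHom (ringChar.dvd h1) R).comp (PadicInt.toZModPow n)⟩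

/-- The homomorphism kills `p ^ n`, and `z.appr n` is a natural number congruent to `z` modulo `p ^
n`. No continuity is needed. -/
lemma padicInt_hom_eq_natCast (f : ℤ_[p] →+* R) {n : ℕ} (hn : (p : R) ^ n = 0) (z : ℤ_[p]) :
    f z = (z.appr n : R) := by
  obtain ⟨y, hy⟩ := Ideal.mem_span_singleton.1 (PadicInt.appr_spec n z)
  have := congrArg f hy
  rwa [map_sub, map_mul, map_pow, map_natCast, map_natCast, hn, zero_mul, sub_eq_zero] at this

lemma padicInt_hom_eq (h : IsNilpotent (p : R)) (f g : ℤ_[p] →+* R) : f = g := by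
  obtain ⟨n, hn⟩ := h
  ext z
  rw [padicInt_hom_eq_natCast f hn, padicInt_hom_eq_natCast g hn]

lemma isOpen_padicInt_hom_ker (h : IsNilpotent (p : R)) (f : ℤ_[p] →+* R) :
    IsOpen {z : ℤ_[p] | f z = 0} := by
  obtain ⟨n, hn⟩ := h
  refine AddSubgroup.isOpen_of_mem_nhds (RingHom.ker f).toAddSubgroup (g := 0) ?_
  have h0 : (0 : ℝ) < (p : ℝ) ^ (-n : ℤ) := by
    have := (Fact.out : p.Prime).pos
    positivity
  refine Filter.mem_of_superset (Metric.ball_mem_nhds (0 : ℤ_[p]) h0) fun z hz => ?_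
  rw [mem_ball_zero_iff] at hz
  obtain ⟨y, rfl⟩ := Ideal.mem_span_singleton.1 ((PadicInt.norm_le_pow_iff_mem_span_pow z n).1 hz.le)
  change f _ = 0
  rw [map_mul, map_pow, map_natCast, hn, zero_mul]

lemma IsPNilpotent.padicInt_hom_eq {S : Scheme.{u}} (hS : IsPNilpotent p S)
    (f g : ℤ_[p] →+* Γ(S, ⊤)) : f = g := by
  ext z
  rw [← sub_eq_zero]
  refine eq_zero_of_cover hS.nilpotentSieve_mem fun T h hh => ?_
  rw [map_sub, sub_eq_zero]
  have hT : IsNilpotent (p : Γ(T, ⊤)) := by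
    have := hh
    change IsNilpotent (h.appTop (p : Γ(S, ⊤))) at this
    rwa [map_natCast] at this
  exact congrArg (fun φ : ℤ_[p] →+* Γ(T, ⊤) => φ z)
    (Prismatization.padicInt_hom_eq hT (h.appTop.hom.comp f) (h.appTop.hom.comp g))

/-- Where `p` is nilpotent there is exactly one morphism to `Spec ℤ_p`, so these local morphisms are
automatically compatible and glue. Working with morphisms of schemes lets the sheaf property of
representable functors do the gluing; the `ULift` only adjusts the universe. -/
lemma IsPNilpotent.exists_padicInt_hom {S : Scheme.{u}} (hS : IsPNilpotent p S) :
    Nonempty (ℤ_[p] →+* Γ(S, ⊤)) := by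
  let X : Scheme.{u} := Spec (CommRingCat.of (ULift.{u} ℤ_[p]))
  let ι : ℤ_[p] →+* Γ(X, ⊤) :=
    (Scheme.ΓSpecIso (CommRingCat.of (ULift.{u} ℤ_[p]))).inv.hom.comp
      (ULift.ringEquiv.symm : ℤ_[p] ≃+* ULift.{u} ℤ_[p]).toRingHom
  have hι : Function.Surjective ι := by
    intro y
    refine ⟨((Scheme.ΓSpecIso (CommRingCat.of (ULift.{u} ℤ_[p]))).hom.hom y).down, ?_⟩
    change (Scheme.ΓSpecIso (CommRingCat.of (ULift.{u} ℤ_[p]))).inv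
      ((Scheme.ΓSpecIso (CommRingCat.of (ULift.{u} ℤ_[p]))).hom y) = y
    simp
  have hT : ∀ ⦃T : Scheme.{u}⦄ (h : T ⟶ S), nilpotentSieve (p : Γ(S, ⊤)) h →
      IsNilpotent (p : Γ(T, ⊤)) := by
    intro T h hh
    change IsNilpotent (h.appTop (p : Γ(S, ⊤))) at hh
    rwa [map_natCast] at hh
  have huniq : ∀ (T : Scheme.{u}), IsNilpotent (p : Γ(T, ⊤)) → ∀ f g : T ⟶ X, f = g := by
    intro T hT f g
    refine ext_of_isAffine ?_
    ext y
    obtain ⟨z, rfl⟩ := hι y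
    exact congrArg (fun φ : ℤ_[p] →+* Γ(T, ⊤) => φ z)
      (Prismatization.padicInt_hom_eq hT (f.appTop.hom.comp ι) (g.appTop.hom.comp ι))
  have hex : ∀ (T : Scheme.{u}), IsNilpotent (p : Γ(T, ⊤)) → Nonempty (T ⟶ X) := by
    intro T hT
    obtain ⟨φ⟩ := Prismatization.exists_padicInt_hom hT
    exact ⟨T.toSpecΓ ≫ Spec.map (CommRingCat.ofHom
      (φ.comp (ULift.ringEquiv : ULift.{u} ℤ_[p] ≃+* ℤ_[p]).toRingHom))⟩
  obtain ⟨t, -⟩ := hom_glue (S := X) hS.nilpotentSieve_mem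
    (fun T h hh => (hex T (hT h hh)).some)
    (fun T U h g hh => huniq U (hT _ (Sieve.downward_closed _ hh g)) _ _)
  exact ⟨t.appTop.hom.comp ι⟩

end PadicHom

/-! ### Primitive Witt vectors preserved by the Frobenius up to a unit. -/

section Trivialization

variable {p : ℕ} [Fact p.Prime]

/-- Equality of units is local, and on a cover where `p` and `x_0` are nilpotent it is
`unit_eq_of_frobenius_eq`. -/
lemma unit_eq_of_isPrimitive {S : Scheme.{u}} {x : W p S} (hx : IsPrimitive x)
    {a c d : (W p S)ˣ} (hc : c = a * frobU c) (hd : d = a * frobU d)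
    (hcd : (c * x : W p S) = d * x) : c = d := by
  refine resU_sep (GrothendieckTopology.intersection_covering _ hx.isPNilpotent.nilpotentSieve_mem
    hx.coeff_zero.nilpotentSieve_mem) fun T f hf => ?_
  obtain ⟨⟨N, hN⟩, ⟨m, hm⟩⟩ := hf
  refine ((hx.res f).isPrimitiveModulo (N := N) (m := m) (by simpa using hN) hm).unit_eq_of_frobenius_eq
    (a := resU f a) ?_ ?_ ?_
  · rw [← coe_frobU, ← resU_frobU, ← Units.val_mul, ← map_mul, ← hc]
  · rw [← coe_frobU, ← resU_frobU, ← Units.val_mul, ← map_mul, ← hd]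
  · rw [coe_resU, coe_resU, ← map_mul, ← map_mul, hcd]

/-- A primitive Witt vector which is preserved by the Frobenius up to a unit `a` is `p` up to a
unit. -/
lemma exists_unit_of_isPrimitive {S : Scheme.{u}} {x : W p S} (hx : IsPrimitive x)
    {a : (W p S)ˣ} (ha : WittVector.frobenius x = a * x) :
    ∃ c : (W p S)ˣ, c = a * frobU c ∧ (c * x : W p S) = p := by
  have hR := GrothendieckTopology.intersection_covering _ hx.isPNilpotent.nilpotentSieve_mem
    hx.coeff_zero.nilpotentSieve_mem
  have hex : ∀ ⦃T : Scheme.{u}⦄ (f : T ⟶ S),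
      (nilpotentSieve (p : Γ(S, ⊤)) ⊓ nilpotentSieve (x.coeff 0)) f →
      ∃ c : (W p T)ˣ, c = resU f a * frobU c ∧ (c * res f x : W p T) = p := by
    rintro T f ⟨⟨N, hN⟩, ⟨m, hm⟩⟩
    obtain ⟨c, h1, h2⟩ := ((hx.res f).isPrimitiveModulo (N := N) (m := m) (by simpa using hN)
      hm).exists_unit_of_frobenius_eq (a := resU f a) (by
        rw [← res_frobenius, ha, map_mul, coe_resU])
    exact ⟨c, Units.ext h1, h2⟩
  choose c hc hc' using hex
  -- The local solutions agree on restrictions by uniqueness, so no bound on the exponents of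
  -- nilpotency is required.
  obtain ⟨d, hd⟩ := resU_glue hR c (by
    intro T U f g hf
    refine unit_eq_of_isPrimitive (hx.res (g ≫ f)) (hc _ _) ?_ ?_
    · conv_lhs => rw [hc f hf]
      rw [map_mul, resU_frobU, resU_comp]
    · rw [hc', res_comp, coe_resU, ← map_mul, hc', map_natCast])
  refine ⟨d, resU_sep hR fun T f hf => ?_, res_sep hR fun T f hf => ?_⟩
  · rw [map_mul, resU_frobU, hd f hf, ← hc]
  · rw [map_mul, ← coe_resU, hd f hf, hc', map_natCast]

end Trivialization

/-! ### Objects of `Σ^F` and their canonical coordinate. -/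

section FixedPoints

variable {p : ℕ} [Fact p.Prime]

/-- Points of the pushed out torsor over the same base agree if they have the same value at a
section. -/
lemma FrobPt.ext_of_section {S : Scheme.{u}} {P : WTorsor p S} {T : Scheme.{u}} {y z : FrobPt P T}
    (x : P.pts T) (hy : P.proj x = 𝟙 T ≫ y.base) (hz : P.proj x = 𝟙 T ≫ z.base)
    (h : y.val (𝟙 T) x hy = z.val (𝟙 T) x hz) : y = z := by
  refine FrobPt.ext_local (by rw [← Category.id_comp y.base, ← hy, hz, Category.id_comp])
    (GrothendieckTopology.top_mem _ T) fun U f _ => ?_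
  have h1 : P.proj (P.rst f x) = (f ≫ 𝟙 T) ≫ y.base := by rw [P.proj_rst, hy, Category.assoc]
  have h2 : P.proj (P.rst f x) = (f ≫ 𝟙 T) ≫ z.base := by rw [P.proj_rst, hz, Category.assoc]
  have h1' : P.proj (P.rst f x) = f ≫ y.base := by rw [h1, Category.comp_id]
  have h2' : P.proj (P.rst f x) = f ≫ z.base := by rw [h2, Category.comp_id]
  refine ⟨P.rst f x, h1', h2', ?_⟩
  rw [y.val_congr (Category.comp_id f).symm rfl h1' h1,
    z.val_congr (Category.comp_id f).symm rfl h2' h2, y.val_rst _ f x hy h1,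
    z.val_rst _ f x hz h2, h]

namespace SigmaPt

/-- The map from the trivial torsor to its push-out along the Frobenius, on points. -/
noncomputable def trivialFrobPt {S T : Scheme.{u}} (x : TrivialPt p S T) :
    FrobPt (WTorsor.trivial p S) T where
  base := x.1
  -- A point with coordinate `c` goes to the class of `(1, c)`; equivariance dictates its value
  -- `F(b)⁻¹ c` at the point with coordinate `b`.
  val _ h y _ := resU h x.2 * (frobU (ULift.down y).2)⁻¹
  val_rst U V h k y hy hy' := by
    change resU (k ≫ h) x.2 * (frobU (resU k (ULift.down y).2))⁻¹ = _
    rw [map_mul, map_inv, resU_comp, resU_frobU]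
  val_smul U h a y hy hy' := by
    change resU h x.2 * (frobU (a * (ULift.down y).2))⁻¹ = _
    rw [map_mul, mul_inv, mul_left_comm]

lemma trivialFrobPt_rst {S T U : Scheme.{u}} (f : U ⟶ T) (x : TrivialPt p S T) :
    trivialFrobPt (f ≫ x.1, resU f x.2) = FrobPt.rst f (trivialFrobPt x) := by
  refine FrobPt.ext' rfl fun V h y hy hy' => ?_
  change resU h (resU f x.2) * (frobU (ULift.down y).2)⁻¹ =
    resU (h ≫ f) x.2 * (frobU (ULift.down y).2)⁻¹
  rw [resU_comp]

lemma trivialFrobPt_smul {S T : Scheme.{u}} (a : (W p T)ˣ) (x : TrivialPt p S T) :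
    trivialFrobPt (x.1, a * x.2) = FrobPt.act a (trivialFrobPt x) := by
  refine FrobPt.ext' rfl fun V h y hy hy' => ?_
  change resU h (a * x.2) * (frobU (ULift.down y).2)⁻¹ =
    resU h a * (resU h x.2 * (frobU (ULift.down y).2)⁻¹)
  rw [map_mul]
  exact mul_assoc (resU h a) (resU h x.2) (frobU (ULift.down y).2)⁻¹

/-- Evaluated at the unit section, the class of `(1, c)` goes to `c⁻¹ * F(w)`, and `F(w) = w`. -/
lemma frobξ_trivialFrobPt {S T : Scheme.{u}} (w : W p S) (hw : IsPrimitive w)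
    (hF : WittVector.frobenius w = w) (x : TrivialPt p S T) :
    frobξ (ofPrim S w hw) (trivialFrobPt x) = (↑x.2⁻¹ * res x.1 w : W p T) := by
  let y : (ofPrim S w hw).torsor.pts T := (ULift.up (x.1, 1) : ULift.{u + 1} (TrivialPt p S T))
  have hy : (ofPrim S w hw).torsor.proj y = 𝟙 T ≫ x.1 := (Category.id_comp x.1).symm
  have h1 := res_frobξ (ofPrim S w hw) (trivialFrobPt x) (𝟙 T) y hy
  have hval : (trivialFrobPt x).val (𝟙 T) y hy = x.2 := by
    refine Eq.trans (b := resU (𝟙 T) x.2 * (frobU 1)⁻¹) rfl ?_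
    rw [map_one, inv_one, mul_one, resU_id]
  have hξ : (ofPrim S w hw).ξ y = res x.1 w := by
    refine Eq.trans (b := ((1 : (W p T)ˣ)⁻¹.1 * res x.1 w : W p T)) rfl ?_
    rw [inv_one, Units.val_one, one_mul]
  rw [res_id] at h1
  refine h1.trans ?_
  rw [hξ, ← res_frobenius, hF]
  exact congrArg (fun c : (W p T)ˣ => (c⁻¹.1 * res x.1 w : W p T)) hval

/-- The isomorphism between the object given by a primitive Witt vector fixed by the Frobenius and
its image under the Frobenius. -/
noncomputable def ofPrimFrob (S : Scheme.{u}) (w : W p S) (hw : IsPrimitive w)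
    (hF : WittVector.frobenius w = w) : ofPrim S w hw ⟶ frobObj (ofPrim S w hw) :=
  Hom.mk (A := ofPrim S w hw) (B := frobObj (ofPrim S w hw)) (𝟙 S)
    (fun x => trivialFrobPt (ULift.down x))
    (fun f x => trivialFrobPt_rst f (ULift.down x))
    (fun a x => trivialFrobPt_smul a (ULift.down x))
    (fun x => (Category.comp_id (ULift.down x).1).symm)
    (fun x => frobξ_trivialFrobPt w hw hF (ULift.down x))

/-- The isomorphism `ofPrimFrob`. -/
noncomputable def ofPrimFrobIso (S : Scheme.{u}) (w : W p S) (hw : IsPrimitive w)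
    (hF : WittVector.frobenius w = w) : ofPrim S w hw ≅ frobObj (ofPrim S w hw) :=
  have : IsIso (Hom.base (ofPrimFrob S w hw hF)) := inferInstanceAs (IsIso (𝟙 S))
  have := isIso_of_isIso_base (ofPrimFrob S w hw hF)
  asIso (ofPrimFrob S w hw hF)

end SigmaPt

variable (p) in
/-- The category `Σ^F`. -/
abbrev SigmaFixed := FixedPt (Sigma.frob.{u} p)

/-- A morphism of fixed points which is invertible in the ambient category is invertible. -/
noncomputable def FixedPt.isoMk {𝒮 : Type*} [Category 𝒮] {X : BasedCategory 𝒮}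
    {F : BasedFunctor X X} {a b : FixedPt F} (f : a ⟶ b) (_ : IsIso (FixedPt.Hom.hom f)) :
    a ≅ b where
  hom := f
  inv := FixedPt.Hom.mk (a := b) (b := a) (inv (FixedPt.Hom.hom f)) (by
    rw [Functor.map_inv, IsIso.comp_inv_eq, Category.assoc, IsIso.eq_inv_comp, FixedPt.Hom.comm])
  hom_inv_id := FixedPt.Hom.ext (IsIso.hom_inv_id (FixedPt.Hom.hom f))
  inv_hom_id := FixedPt.Hom.ext (IsIso.inv_hom_id (FixedPt.Hom.hom f))

/-- The object of `Σ^F` given by a primitive Witt vector fixed by the Frobenius. -/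
noncomputable def SigmaFixed.ofPrim (S : Scheme.{u}) (w : W p S) (hw : IsPrimitive w)
    (hF : WittVector.frobenius w = w) : SigmaFixed.{u} p where
  pt := SigmaPt.ofPrim S w hw
  iso := SigmaPt.ofPrimFrobIso S w hw hF
  isHomLift := by
    exact IsHomLift.map (Sigma.{u} p).p (a := SigmaPt.ofPrim S w hw)
      (b := SigmaPt.frobObj (SigmaPt.ofPrim S w hw)) (SigmaPt.ofPrimFrob S w hw hF)

namespace SigmaFixed

variable (A B : SigmaFixed.{u} p)

/-- The underlying object of `Σ`. -/
abbrev toSigmaPt : SigmaPt.{u} p := A.pt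

/-- The isomorphism with the image under the Frobenius. -/
abbrev toFrob : A.toSigmaPt ⟶ A.toSigmaPt.frobObj := A.iso.hom

lemma base_toFrob : SigmaPt.Hom.base A.toFrob = 𝟙 A.toSigmaPt.base := by
  have := A.isHomLift
  have h := IsHomLift.fac' (Sigma.{u} p).p (𝟙 ((Sigma.{u} p).p.obj A.pt)) A.iso.hom
  refine Eq.trans h ?_
  rw [Category.id_comp, eqToHom_trans]
  rfl

/-- The image of a section of the torsor under the isomorphism with the push-out. -/
def toFrobPt {T : Scheme.{u}} (x : A.toSigmaPt.torsor.pts T) : FrobPt A.toSigmaPt.torsor T :=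
  SigmaPt.Hom.map A.toFrob x

lemma toFrobPt_base {T : Scheme.{u}} (x : A.toSigmaPt.torsor.pts T) :
    (A.toFrobPt x).base = A.toSigmaPt.torsor.proj x := by
  refine (SigmaPt.Hom.proj_map A.toFrob x).trans ?_
  rw [base_toFrob]
  exact Category.comp_id _

lemma proj_eq {T : Scheme.{u}} (x : A.toSigmaPt.torsor.pts T) :
    A.toSigmaPt.torsor.proj x = 𝟙 T ≫ (A.toFrobPt x).base := by
  rw [toFrobPt_base, Category.id_comp]

/-- The isomorphism with the push-out, in the coordinates given by a section of the torsor. -/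
noncomputable def frobCoord {T : Scheme.{u}} (x : A.toSigmaPt.torsor.pts T) : (W p T)ˣ :=
  (A.toFrobPt x).val (𝟙 T) x (A.proj_eq x)

/-- Write `α(x)` as the class of `(x, a)`. Compatibility of `α` with the maps to `W_prim` reads
`ξ(x) = a⁻¹ * F(ξ(x))`. -/
lemma frobenius_ξ {T : Scheme.{u}} (x : A.toSigmaPt.torsor.pts T) :
    WittVector.frobenius (A.toSigmaPt.ξ x) = (A.frobCoord x * A.toSigmaPt.ξ x : W p T) := by
  have h1 := A.toSigmaPt.res_frobξ (A.toFrobPt x) (𝟙 T) x (A.proj_eq x)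
  have h2 : A.toSigmaPt.frobξ (A.toFrobPt x) = A.toSigmaPt.ξ x := SigmaPt.Hom.ξ_map A.toFrob x
  rw [res_id, h2, ← frobCoord] at h1
  conv_rhs => rw [h1]
  rw [← mul_assoc, Units.mul_inv, one_mul]

lemma toFrobPt_rst {T U : Scheme.{u}} (f : U ⟶ T) (x : A.toSigmaPt.torsor.pts T) :
    A.toFrobPt (A.toSigmaPt.torsor.rst f x) = FrobPt.rst f (A.toFrobPt x) :=
  SigmaPt.Hom.map_rst A.toFrob f x

lemma toFrobPt_smul {T : Scheme.{u}} (a : (W p T)ˣ) (x : A.toSigmaPt.torsor.pts T) :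
    A.toFrobPt (a • x) = FrobPt.act a (A.toFrobPt x) :=
  SigmaPt.Hom.map_smul A.toFrob a x

lemma val_eq_frobCoord {T : Scheme.{u}} {x x' : A.toSigmaPt.torsor.pts T} (hx : x = x')
    {y : FrobPt A.toSigmaPt.torsor T} (hy : A.toFrobPt x = y)
    (h : A.toSigmaPt.torsor.proj x' = 𝟙 T ≫ y.base) : y.val (𝟙 T) x' h = A.frobCoord x := by
  subst hx hy
  rfl

lemma frobCoord_rst {T U : Scheme.{u}} (f : U ⟶ T) (x : A.toSigmaPt.torsor.pts T) :
    A.frobCoord (A.toSigmaPt.torsor.rst f x) = resU f (A.frobCoord x) := by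
  have h1 : A.toSigmaPt.torsor.proj (A.toSigmaPt.torsor.rst f x) =
      𝟙 U ≫ (FrobPt.rst f (A.toFrobPt x)).base := by
    rw [← toFrobPt_rst]
    exact A.proj_eq _
  have h2 : A.toSigmaPt.torsor.proj (A.toSigmaPt.torsor.rst f x) =
      (f ≫ 𝟙 T) ≫ (A.toFrobPt x).base := by
    rw [A.toSigmaPt.torsor.proj_rst, Category.comp_id, toFrobPt_base]
  rw [← A.val_eq_frobCoord rfl (A.toFrobPt_rst f x) h1, frobCoord,
    ← (A.toFrobPt x).val_rst (𝟙 T) f x (A.proj_eq x) h2]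
  exact FrobPt.val_congr (A.toFrobPt x) (by rw [Category.id_comp, Category.comp_id]) rfl _ _

/-- The factor `b` comes from the equivariance of `α`, for `b` the acting unit, and `F(b)⁻¹` from
evaluating at `b • x` instead of `x`. -/
lemma frobCoord_smul {T : Scheme.{u}} (a : (W p T)ˣ) (x : A.toSigmaPt.torsor.pts T) :
    A.frobCoord (a • x) = a * (frobU a)⁻¹ * A.frobCoord x := by
  have h1 : A.toSigmaPt.torsor.proj (a • x) = 𝟙 T ≫ (A.toFrobPt x).base := by
    rw [A.toSigmaPt.torsor.proj_smul]
    exact A.proj_eq x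
  rw [← A.val_eq_frobCoord rfl (A.toFrobPt_smul a x) h1]
  change resU (𝟙 T) a * (A.toFrobPt x).val (𝟙 T) (a • x) h1 = _
  rw [(A.toFrobPt x).val_smul (𝟙 T) a x (A.proj_eq x) h1, resU_id, mul_assoc, frobCoord]

/-- The coordinate of a section with respect to the canonical trivialization of the torsor. -/
noncomputable def coord {T : Scheme.{u}} (x : A.toSigmaPt.torsor.pts T) : (W p T)ˣ :=
  (exists_unit_of_isPrimitive (A.toSigmaPt.ξ_isPrimitive x) (A.frobenius_ξ x)).choose

lemma coord_eq {T : Scheme.{u}} (x : A.toSigmaPt.torsor.pts T) :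
    A.coord x = A.frobCoord x * frobU (A.coord x) :=
  (exists_unit_of_isPrimitive (A.toSigmaPt.ξ_isPrimitive x) (A.frobenius_ξ x)).choose_spec.1

lemma coord_mul_ξ {T : Scheme.{u}} (x : A.toSigmaPt.torsor.pts T) :
    (A.coord x * A.toSigmaPt.ξ x : W p T) = p :=
  (exists_unit_of_isPrimitive (A.toSigmaPt.ξ_isPrimitive x) (A.frobenius_ξ x)).choose_spec.2

/-- Since the two equations characterize the coordinate, its compatibility with restriction, with
the action and with morphisms is obtained by checking them. -/
lemma eq_coord {T : Scheme.{u}} (x : A.toSigmaPt.torsor.pts T) {c : (W p T)ˣ}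
    (h : c = A.frobCoord x * frobU c) (h' : (c * A.toSigmaPt.ξ x : W p T) = p) :
    c = A.coord x :=
  unit_eq_of_isPrimitive (A.toSigmaPt.ξ_isPrimitive x) h (A.coord_eq x) (by rw [h', coord_mul_ξ])

lemma coord_rst {T U : Scheme.{u}} (f : U ⟶ T) (x : A.toSigmaPt.torsor.pts T) :
    A.coord (A.toSigmaPt.torsor.rst f x) = resU f (A.coord x) := by
  refine (A.eq_coord _ ?_ ?_).symm
  · rw [frobCoord_rst, ← resU_frobU, ← map_mul, ← coord_eq]
  · rw [A.toSigmaPt.ξ_rst, coe_resU, ← map_mul, coord_mul_ξ, map_natCast]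

lemma coord_smul {T : Scheme.{u}} (a : (W p T)ˣ) (x : A.toSigmaPt.torsor.pts T) :
    A.coord (a • x) = a * A.coord x := by
  refine (A.eq_coord _ ?_ ?_).symm
  · rw [frobCoord_smul, map_mul, mul_assoc, mul_left_comm _ (frobU a), ← mul_assoc (a * _),
      inv_mul_cancel_right, ← coord_eq]
  · rw [A.toSigmaPt.ξ_smul, Units.val_mul, mul_right_comm, ← mul_assoc, Units.mul_inv, one_mul,
      mul_comm, coord_mul_ξ]

/-- A morphism of `Σ^F` preserves `ξ` and commutes with `α`, hence preserves both data `ξ(x)` and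
`frobCoord` that determine the coordinate. -/
lemma coord_map {A B : SigmaFixed.{u} p} (f : A ⟶ B) {T : Scheme.{u}}
    (x : A.toSigmaPt.torsor.pts T) :
    B.coord (SigmaPt.Hom.map (FixedPt.Hom.hom f) x) = A.coord x := by
  let φ : A.toSigmaPt ⟶ B.toSigmaPt := FixedPt.Hom.hom f
  have hcomm : A.toFrob ≫ SigmaPt.frobMap φ = φ ≫ B.toFrob := FixedPt.Hom.comm f
  have h1 : B.toFrobPt (SigmaPt.Hom.map φ x) = SigmaPt.frobMapPt φ (A.toFrobPt x) :=
    congrArg (fun ψ : A.toSigmaPt ⟶ B.toSigmaPt.frobObj => SigmaPt.Hom.map ψ x) hcomm.symm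
  have h2 : B.toSigmaPt.torsor.proj (SigmaPt.Hom.map φ x) =
      𝟙 T ≫ (SigmaPt.frobMapPt φ (A.toFrobPt x)).base := by
    rw [← h1]
    exact B.proj_eq _
  have h3 : B.frobCoord (SigmaPt.Hom.map φ x) = A.frobCoord x := by
    rw [← B.val_eq_frobCoord rfl h1 h2]
    exact SigmaPt.frobMapPt_val φ (A.toFrobPt x) (𝟙 T) x (A.proj_eq x) h2
  refine (B.eq_coord (SigmaPt.Hom.map φ x) ?_ ?_).symm
  · rw [h3, ← coord_eq]
  · rw [SigmaPt.Hom.ξ_map, coord_mul_ξ]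

lemma isPNilpotent : IsPNilpotent p A.toSigmaPt.base := by
  obtain ⟨R, hR, h⟩ := A.toSigmaPt.torsor.locally_nonempty
  refine isLocallyNilpotent_of_cover hR fun T f hf => ?_
  obtain ⟨x, -⟩ := h f hf
  rw [map_natCast]
  exact (A.toSigmaPt.ξ_isPrimitive x).isPNilpotent

end SigmaFixed

end FixedPoints

/-! ### The equivalence between `Spf ℤ_p` and `Σ^F`. -/

section Comparison

lemma isHomLift_id_of_map_eq {𝒮 𝒳 : Type*} [Category 𝒮] [Category 𝒳] (P : 𝒳 ⥤ 𝒮) {S : 𝒮} {a b : 𝒳}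
    (φ : a ⟶ b) (ha : P.obj a = S) (hb : P.obj b = S)
    (h : P.map φ = eqToHom (ha.trans hb.symm)) : P.IsHomLift (𝟙 S) φ :=
  IsHomLift.of_fac' P (𝟙 S) φ ha hb (by rw [h, Category.id_comp, eqToHom_trans])

variable {p : ℕ} [Fact p.Prime]

namespace SigmaPt

lemma ofPrimFrob_naturality {S S' : Scheme.{u}} (f : S ⟶ S') (w : W p S) (hw : IsPrimitive w)
    (hF : WittVector.frobenius w = w) (w' : W p S') (hw' : IsPrimitive w')
    (hF' : WittVector.frobenius w' = w') (h : res f w' = w) :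
    ofPrimFrob S w hw hF ≫ frobMap (ofPrimMap f w hw w' hw' h) =
      ofPrimMap f w hw w' hw' h ≫ ofPrimFrob S' w' hw' hF' := by
  refine hom_ext ((Category.id_comp f).trans (Category.comp_id f).symm) fun {T} x => ?_
  let φ := ofPrimMap f w hw w' hw' h
  let x' : TrivialPt p S T := ULift.down x
  change frobMapPt φ (trivialFrobPt x') = trivialFrobPt (x'.1 ≫ f, x'.2)
  refine frobPt_ext φ x'.1 rfl rfl fun U g y hy h1 h2 => ?_
  rw [frobMapPt_val φ (trivialFrobPt x') g y hy h1]
  rfl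

end SigmaPt

namespace SigmaFixed

variable (A : SigmaFixed.{u} p)

/-- The canonical trivialization of the torsor underlying an object of `Σ^F`. -/
noncomputable def trivialize (w : W p A.toSigmaPt.base) (hw : IsPrimitive w) (h : w = p) :
    A.toSigmaPt ⟶ SigmaPt.ofPrim A.toSigmaPt.base w hw :=
  SigmaPt.Hom.mk (A := A.toSigmaPt) (B := SigmaPt.ofPrim A.toSigmaPt.base w hw)
    (𝟙 A.toSigmaPt.base)
    (fun {T} x => (ULift.up (A.toSigmaPt.torsor.proj x, A.coord x) :
      ULift.{u + 1} (TrivialPt p A.toSigmaPt.base T)))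
    (fun f x => congrArg ULift.up (Prod.ext (A.toSigmaPt.torsor.proj_rst f x) (A.coord_rst f x)))
    (fun a x => congrArg ULift.up (Prod.ext (A.toSigmaPt.torsor.proj_smul a x) (A.coord_smul a x)))
    (fun x => (Category.comp_id (A.toSigmaPt.torsor.proj x)).symm)
    (fun {T} x => by
      change ((A.coord x)⁻¹.1 * res (A.toSigmaPt.torsor.proj x) w : W p T) = A.toSigmaPt.ξ x
      rw [h, map_natCast, ← A.coord_mul_ξ x, ← mul_assoc, Units.inv_mul, one_mul])

/-- Points of the push-out can be compared at a single section. At the image of `x`, whose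
coordinate is `c`, the two values are `a` and `c F(c)⁻¹`, so the claim is the equation `c = a F(c)`.
This is why the coordinate is required to satisfy it. -/
lemma toFrob_trivialize (w : W p A.toSigmaPt.base) (hw : IsPrimitive w) (h : w = p)
    (hF : WittVector.frobenius w = w) :
    A.toFrob ≫ SigmaPt.frobMap (A.trivialize w hw h) =
      A.trivialize w hw h ≫ SigmaPt.ofPrimFrob A.toSigmaPt.base w hw hF := by
  refine SigmaPt.hom_ext ?_ fun {T} x => ?_
  · change SigmaPt.Hom.base A.toFrob ≫ 𝟙 _ = 𝟙 _ ≫ 𝟙 _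
    rw [base_toFrob]
    rfl
  let φ := A.trivialize w hw h
  change SigmaPt.frobMapPt φ (A.toFrobPt x) =
    SigmaPt.trivialFrobPt (A.toSigmaPt.torsor.proj x, A.coord x)
  have hz : (SigmaPt.ofPrim A.toSigmaPt.base w hw).torsor.proj (SigmaPt.Hom.map φ x) =
      𝟙 T ≫ A.toSigmaPt.torsor.proj x := (Category.id_comp (A.toSigmaPt.torsor.proj x)).symm
  have hy : (SigmaPt.ofPrim A.toSigmaPt.base w hw).torsor.proj (SigmaPt.Hom.map φ x) =
      𝟙 T ≫ (SigmaPt.frobMapPt φ (A.toFrobPt x)).base := by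
    refine hz.trans (congrArg (𝟙 T ≫ ·) ?_)
    exact (A.toFrobPt_base x).symm.trans (Category.comp_id (A.toFrobPt x).base).symm
  refine FrobPt.ext_of_section (SigmaPt.Hom.map φ x) hy hz ?_
  rw [SigmaPt.frobMapPt_val φ (A.toFrobPt x) (𝟙 T) x (A.proj_eq x) hy]
  change A.frobCoord x = resU (𝟙 T) (A.coord x) * (frobU (A.coord x))⁻¹
  rw [resU_id, eq_mul_inv_iff_mul_eq, ← coord_eq]

end SigmaFixed

namespace SpfPt

lemma witt_eq (a : SpfPt.{u} p) : a.witt = p := by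
  rw [witt, map_natCast]

lemma frobenius_witt (a : SpfPt.{u} p) : WittVector.frobenius a.witt = a.witt := by
  rw [witt_eq, map_natCast]

/-- The canonical point of `Spf ℤ_p` over a `p`-nilpotent scheme. -/
noncomputable def ofIsPNilpotent (S : Scheme.{u}) (hS : IsPNilpotent p S) : SpfPt.{u} p where
  base := S
  φ := hS.exists_padicInt_hom.some
  isOpen_ker U hU := by
    have h1 : IsNilpotent (p : Γ(S, U)) := by
      have h2 : IsNilpotent (S.presheaf.map (homOfLE le_top : U ⟶ ⊤).op (p : Γ(S, ⊤))) := by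
        rw [Scheme.isNilpotent_iff_basicOpen_eq_bot_of_isCompact hU.isCompact,
          Scheme.basicOpen_res, (isLocallyNilpotent_iff _).1 hS]
        simp
      rwa [map_natCast] at h2
    exact isOpen_padicInt_hom_ker h1 ((S.presheaf.map (homOfLE le_top : U ⟶ ⊤).op).hom.comp
      hS.exists_padicInt_hom.some)

/-- Every morphism of schemes underlies a unique morphism of points of `Spf ℤ_p`. -/
def homMk {a b : SpfPt.{u} p} (f : a.base ⟶ b.base) : a ⟶ b :=
  Hom.mk (a := a) (b := b) f fun z =>
    congrArg (fun φ : ℤ_[p] →+* Γ(a.base, ⊤) => φ z)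
      (a.isPNilpotent.padicInt_hom_eq (f.appTop.hom.comp b.φ) a.φ)

lemma hom_ext {a b : SpfPt.{u} p} {f g : a ⟶ b} (h : Hom.base f = Hom.base g) : f = g :=
  Hom.ext h

/-- Points of `Spf ℤ_p` over the same scheme are isomorphic. -/
def isoMk {a b : SpfPt.{u} p} (e : a.base ≅ b.base) : a ≅ b where
  hom := homMk e.hom
  inv := homMk e.inv
  hom_inv_id := hom_ext e.hom_inv_id
  inv_hom_id := hom_ext e.inv_hom_id

end SpfPt

variable (p)

/-- The morphism `Spf ℤ_p ⟶ Σ^F` given by the Witt vector `p`. -/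
noncomputable def SpfZp.toFixedPoints :
    BasedFunctor (SpfZp.{u} p) (fixedPoints (Sigma.frob.{u} p)) where
  obj a := SigmaFixed.ofPrim (SpfPt.base a) (SpfPt.witt a) (SpfPt.isPrimitive_witt a)
    (SpfPt.frobenius_witt a)
  map {a b} f := FixedPt.Hom.mk
    (SigmaPt.ofPrimMap (SpfPt.Hom.base f) _ (SpfPt.isPrimitive_witt a) _ (SpfPt.isPrimitive_witt b)
      (SpfPt.res_witt f))
    (SigmaPt.ofPrimFrob_naturality (SpfPt.Hom.base f) _ _ (SpfPt.frobenius_witt a) _ _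
      (SpfPt.frobenius_witt b) _)
  map_id _ := rfl
  map_comp _ _ := rfl
  w := rfl

/-- The morphism `Σ^F ⟶ Spf ℤ_p` given by the structure of `p`-nilpotent scheme on the base. -/
noncomputable def SpfZp.ofFixedPoints :
    BasedFunctor (fixedPoints (Sigma.frob.{u} p)) (SpfZp.{u} p) where
  obj A := SpfPt.ofIsPNilpotent _ (SigmaFixed.isPNilpotent A)
  map {A B} f := SpfPt.homMk (a := SpfPt.ofIsPNilpotent _ (SigmaFixed.isPNilpotent A))
    (b := SpfPt.ofIsPNilpotent _ (SigmaFixed.isPNilpotent B))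
    (SigmaPt.Hom.base (FixedPt.Hom.hom f))
  map_id _ := rfl
  map_comp _ _ := rfl
  w := rfl

/-- The composite endomorphism of `Spf ℤ_p` is isomorphic to the identity. -/
noncomputable def SpfZp.unitIso :
    (SpfZp.toFixedPoints.{u} p).comp (SpfZp.ofFixedPoints.{u} p) ≅ BasedFunctor.id _ :=
  BasedNatIso.mkNatIso
    (NatIso.ofComponents (fun a => SpfPt.isoMk (Iso.refl (SpfPt.base a)))
      (fun f => SpfPt.hom_ext ((Category.comp_id (SpfPt.Hom.base f)).trans
        (Category.id_comp (SpfPt.Hom.base f)).symm)))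
    (fun _ => isHomLift_id_of_map_eq _ _ rfl rfl rfl)

namespace SigmaFixed

variable {p} (A : SigmaFixed.{u} p)

/-- The canonical isomorphism of an object of `Σ^F` with the one given by the Witt vector `p`. -/
noncomputable def trivializeIso :
    A ≅ (SpfZp.toFixedPoints.{u} p).obj ((SpfZp.ofFixedPoints.{u} p).obj A) :=
  let a : SpfPt.{u} p := SpfPt.ofIsPNilpotent _ A.isPNilpotent
  let B : SigmaFixed.{u} p := SigmaFixed.ofPrim a.base a.witt a.isPrimitive_witt a.frobenius_witt
  let f : A ⟶ B := FixedPt.Hom.mk (a := A) (b := B)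
    (A.trivialize a.witt a.isPrimitive_witt a.witt_eq)
    (A.toFrob_trivialize a.witt a.isPrimitive_witt a.witt_eq a.frobenius_witt)
  have : IsIso (SigmaPt.Hom.base (A.trivialize a.witt a.isPrimitive_witt a.witt_eq)) :=
    inferInstanceAs (IsIso (𝟙 A.toSigmaPt.base))
  FixedPt.isoMk f
    (SigmaPt.isIso_of_isIso_base (A.trivialize a.witt a.isPrimitive_witt a.witt_eq))

lemma trivializeIso_naturality {A B : SigmaFixed.{u} p} (f : A ⟶ B) :
    f ≫ B.trivializeIso.hom = A.trivializeIso.hom ≫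
      (SpfZp.toFixedPoints.{u} p).map ((SpfZp.ofFixedPoints.{u} p).map f) := by
  refine FixedPt.Hom.ext (SigmaPt.hom_ext ?_ fun {T} x => ?_)
  · exact (Category.comp_id (SigmaPt.Hom.base (FixedPt.Hom.hom f))).trans
      (Category.id_comp (SigmaPt.Hom.base (FixedPt.Hom.hom f))).symm
  · exact congrArg ULift.up (Prod.ext (SigmaPt.Hom.proj_map (FixedPt.Hom.hom f) x)
      (SigmaFixed.coord_map f x))

end SigmaFixed

/-- The composite endomorphism of `Σ^F` is isomorphic to the identity. -/
noncomputable def SpfZp.counitIso :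
    (SpfZp.ofFixedPoints.{u} p).comp (SpfZp.toFixedPoints.{u} p) ≅ BasedFunctor.id _ :=
  (BasedNatIso.mkNatIso
    (F := BasedFunctor.id _)
    (G := (SpfZp.ofFixedPoints.{u} p).comp (SpfZp.toFixedPoints.{u} p))
    (NatIso.ofComponents (fun A => SigmaFixed.trivializeIso A)
      (fun f => SigmaFixed.trivializeIso_naturality f))
    (fun _ => isHomLift_id_of_map_eq _ _ rfl rfl rfl)).symm

end Comparison

end Prismatization

theorem propositionp (p : ℕ) [Fact p.Prime] :
    (∀ S : Scheme.{u}, CompactSpace S → QuasiSeparatedSpace S → Prismatization.IsPNilpotent p S →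
      Prismatization.IsContracting
        (Prismatization.fiberFunctor (Prismatization.Sigma.frob.{u} p) S)) ∧
    ∃ (e : BasedFunctor (Prismatization.SpfZp.{u} p)
        (Prismatization.fixedPoints (Prismatization.Sigma.frob.{u} p)))
      (e' : BasedFunctor (Prismatization.fixedPoints (Prismatization.Sigma.frob.{u} p))
        (Prismatization.SpfZp.{u} p)),
      Nonempty (e.comp e' ≅ BasedFunctor.id _) ∧ Nonempty (e'.comp e ≅ BasedFunctor.id _) ∧
      Nonempty (e.comp (Prismatization.fixedPoints.forget (Prismatization.Sigma.frob.{u} p)) ≅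
        Prismatization.deRhamPoint.{u} p) := by
  -- The last isomorphism is the identity: forgetting `α` from the fixed point attached to the Witt
  -- vector `p` gives by definition the value of `deRhamPoint`.
  refine ⟨fun S _ _ hS => Prismatization.isContracting_frob hS,
    Prismatization.SpfZp.toFixedPoints p, Prismatization.SpfZp.ofFixedPoints p,
    ⟨Prismatization.SpfZp.unitIso p⟩, ⟨Prismatization.SpfZp.counitIso p⟩, ⟨Iso.refl _⟩⟩
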